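/- **Setting.** Fix $\alpha>2$, $\beta,d,R>0$, $\varepsilon\in(0,1)$. A typical receiver with $N$ antennas sits at the origin of $\mathbb R^2$; its transmitter is at distance $d$, and the interfering transmitters form a homogeneous Poisson point process of intensity $\lambda$; let $d_1\le d_2\le\dots$ be their distances from the origin. Every transmitter sends $k$ independent data streams from $k$ antennas (no channel knowledge at the transmitters). All channel coefficients are i.i.d. $\mathcal{CN}(0,1)$ and independent of the locations; path loss is $D^{-\alpha}$ and noise is neglected. To decode one stream the receiver projects to the unit vector $q$ that is orthogonal to the channel vectors of the other $k-1$ desired streams and of all streams of the $c=\lfloor m/k\rfloor$ nearest interferers, and that maximizes the signal power (the normalized projection of the desired channel vector). With $s$ the power of the desired channel vector along $q$ and $\rho_n$ the sum of the powers along $q$ of the $k$ channel vectors of the $n$-th nearest interferer, $$P_{out}(\lambda)=P\Big(\frac{d^{-\alpha}s}{\sum_{n>c}d_n^{-\alpha}\rho_n}\le\beta\Big),\qquad C_\varepsilon(N,k,m)=k\,\lambda^\star(1-\varepsilon)R,\quad \lambda^\star=\sup\{\lambda>0: P_{out}(\lambda)\le\varepsilon\}.$$ Call $(k,m)$ admissible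 for $N$ if $k\ge1$, $k+m\le N$ and $\lfloor m/k\rfloor>\frac\alpha2-1$. With $c=\lfloor m/k\rfloor$ put $$U(N,k,m)=\begin{cases}\frac{kR(1-\varepsilon)^{1-2/\alpha}}{\pi}\Big(\frac{N-m-k+1}{(k-1)d^\alpha\beta}\Big)^{2/\alpha}\big(c+\tfrac58+\tfrac\alpha4\big),&k>1,\\ \frac{R(1-\varepsilon)^{1-2/\alpha}}{\pi}\Big(\frac{N-m}{d^\alpha\beta}\Big)^{2/\alpha}\big(m+\tfrac{13}8+\tfrac\alpha4+1\big),&k=1,\end{cases}$$ $$L(N,k,m)=\frac{kR(1-\varepsilon)}{\pi}\Big(\frac{\eta}{k\beta d^\alpha}\Big)^{2/\alpha}\Big(\big(\tfrac\alpha2-1\big)^{-1}(c+1)^{1-\alpha/2}\Big)^{-2/\alpha},\quad \eta=\begin{cases}-\ln(1-\varepsilon),&k+m=N,\\(N-k-m)\varepsilon,&\text{otherwise.}\end{cases}$$ **Statement.** 1. *Bounds.* For all $N$ and admissible $(k,m)$, with $c=\lfloor m/k\rfloor$ (so only $kc$ degrees of freedom are really used for cancelation), $\kappa_c\,L(N,k,m)\le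 C_\varepsilon(N,k,m)\le U(N,k,kc)$, where $\kappa_c=\big((c+1)^{1-\alpha/2}\,\Gamma(c)/\Gamma(c+1-\tfrac\alpha2)\big)^{2/\alpha}>0$ for $c>\frac\alpha2-1$ and $\kappa_c\to1$ as $c\to\infty$. 2. *$k=1$ maximizes the lower bound.* If $(k,m)$ is admissible for $N$, so is $(1,m+k-1)$, and $L(N,k,m)\le L(N,1,m+k-1)$. 3. *$k=1$ maximizes the upper bound.* If $\alpha\le\frac{11}2$, then for every admissible $(k,m)$ with $k>1$ the pair $(1,m)$ is admissible and $U(N,k,m)<U(N,1,m)$. For every $\alpha>2$ and $\delta>0$, for all large $N$, every admissible $(k,m)$ has $U(N,k,m)\le(1+\delta)\,U(N,1,m')$ for some admissible $(1,m')$. 4. *No better scaling.* There is a constant $K$ with $L(N,k,m)\le KN$, $C_\varepsilon(N,k,m)\le KN$ and $U(N,k,m)\le KN^{1+2/\alpha}$ for all $N$ and all admissible $(k,m)$. 5. *$k=1$, $m=\theta N$ attains the best scaling.* Let $\theta\in(0,1)$ and let $m_N$ be integers with $m_N/N\to\theta$. Then $(1,m_N)$ is admissible for all large $N$, $C_\varepsilon(N,1,m_N)=\Theta(N)$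 (in particular $\Omega(N)$), $U(N,1,m_N)=\Theta(N^{1+2/\alpha})$, and $$\frac{L(N,1,m_N)}{N}\to\frac{R(1-\varepsilon)}{\pi}\Big(\frac{\varepsilon(\frac\alpha2-1)}{\beta d^\alpha}\Big)^{2/\alpha}(1-\theta)^{2/\alpha}\theta^{1-2/\alpha}.$$ 6. *Optimal fraction.* $1-\frac2\alpha\in(0,1)$, and $\theta=1-\frac2\alpha$ is the unique maximizer of $(1-\theta)^{2/\alpha}\theta^{1-2/\alpha}$ on $(0,1)$. For all large $N$, if $L(N,1,m)$ is maximal among all $L(N,k',m')$ with $(k',m')$ admissible, then $m+1$ is $\lfloor(1-\frac2\alpha)N\rfloor$ or $\lceil(1-\frac2\alpha)N\rceil$. -/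

import Mathlib

open MeasureTheory ProbabilityTheory Filter Topology Asymptotics
open scoped ENNReal NNReal

noncomputable section

namespace AdHoc

/-- The two-dimensional plane in which the nodes are located. -/
abbrev Plane : Type := EuclideanSpace ℝ (Fin 2)

/-- The law `CN(0,1)`: real and imaginary part are independent real Gaussians of mean `0` and
variance `1/2`. -/
def complexGaussian : Measure ℂ :=
  ((gaussianReal 0 (1 / 2)).prod (gaussianReal 0 (1 / 2))).map
    (fun x : ℝ × ℝ => (⟨x.1, x.2⟩ : ℂ))

/-- The number of points of the sequence `T` (at the outcome `ω`) that lie in `A`. -/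
def pointCount {Ω : Type*} (T : ℕ → Ω → Plane) (A : Set Plane) (ω : Ω) : ℝ≥0∞ :=
  ∑' n, A.indicator (fun _ => (1 : ℝ≥0∞)) (T n ω)

/-- `T 0, T 1, …` enumerates, by increasing distance from the origin, the points of a homogeneous
Poisson point process of intensity `lam` on the plane. -/
structure IsSortedPoissonProcess {Ω : Type*} [MeasurableSpace Ω] (μ : Measure Ω) (lam : ℝ)
    (T : ℕ → Ω → Plane) : Prop where
  measurable : ∀ n, Measurable (T n)
  sorted : ∀ᵐ ω ∂μ, Monotone fun n => ‖T n ω‖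
  count_law : ∀ A : Set Plane, MeasurableSet A → volume A ≠ ∞ → ∀ j : ℕ,
    μ {ω | pointCount T A ω = j} = poissonMeasure (lam.toNNReal * (volume A).toNNReal) {j}
  count_indep : ∀ (r : ℕ) (A : Fin r → Set Plane), (∀ i, MeasurableSet (A i)) →
    Pairwise (fun i j => Disjoint (A i) (A j)) → iIndepFun (fun i => pointCount T (A i)) μ

/-- The random network seen from the typical receiver, which sits at the origin.
`T lam n` is the location of the `(n+1)`-st nearest interfering transmitter when the transmitters
have intensity `lam`. `h n i j` is the fading coefficient between the `j`-th transmit antenna of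
node `n` and the `i`-th antenna of the typical receiver, where node `0` is the typical transmitter
and node `n + 1` is the interferer at `T lam n`. All coefficients are i.i.d. `CN(0,1)` and
independent of the locations. -/
structure IsNetwork {Ω : Type*} [MeasurableSpace Ω] (μ : Measure Ω) (T : ℝ → ℕ → Ω → Plane)
    (h : ℕ → ℕ → ℕ → Ω → ℂ) : Prop where
  poisson : ∀ lam : ℝ, 0 < lam → IsSortedPoissonProcess μ lam (T lam)
  measurable_fading : ∀ n i j, Measurable (h n i j)
  fading_law : ∀ n i j, μ.map (h n i j) = complexGaussian
  fading_indep : iIndepFun (fun p : ℕ × ℕ × ℕ => h p.1 p.2.1 p.2.2) μ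
  indep : ∀ lam : ℝ, 0 < lam →
    IndepFun (fun ω (n : ℕ) => T lam n ω) (fun ω (p : ℕ × ℕ × ℕ) => h p.1 p.2.1 p.2.2 ω) μ

/-- The channel vector in `ℂ^N` from the `j`-th transmit antenna of node `n` to the `N` antennas
of the typical receiver. -/
def column {Ω : Type*} (h : ℕ → ℕ → ℕ → Ω → ℂ) (N n j : ℕ) (ω : Ω) :
    EuclideanSpace ℂ (Fin N) :=
  WithLp.toLp 2 fun i : Fin N => h n i j ω

/-- The span of the channel vectors that are zero-forced when stream `l` is decoded: the other
streams of the typical transmitter and all `k` streams of each of the `c` nearest interferers. -/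
def nulledSpace {Ω : Type*} (h : ℕ → ℕ → ℕ → Ω → ℂ) (N k c l : ℕ) (ω : Ω) :
    Submodule ℂ (EuclideanSpace ℂ (Fin N)) :=
  Submodule.span ℂ
    ({v | ∃ j < k, j ≠ l ∧ v = column h N 0 j ω} ∪
      {v | ∃ n < c, ∃ j < k, v = column h N (n + 1) j ω})

/-- The partial zero-forcing combiner for stream `l`: the normalized projection of the channel
vector of stream `l` to the orthogonal complement of the zero-forced channel vectors. Among the
unit vectors of that complement it maximizes the signal power. -/
def combiner {Ω : Type*} (h : ℕ → ℕ → ℕ → Ω → ℂ) (N k c l : ℕ) (ω : Ω) :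
    EuclideanSpace ℂ (Fin N) :=
  ((‖(nulledSpace h N k c l ω)ᗮ.starProjection (column h N 0 l ω)‖⁻¹ : ℝ) : ℂ) •
    (nulledSpace h N k c l ω)ᗮ.starProjection (column h N 0 l ω)

/-- Post-combining power `s` of the fading of the desired stream `l`. -/
def signalPower {Ω : Type*} (h : ℕ → ℕ → ℕ → Ω → ℂ) (N k c l : ℕ) (ω : Ω) : ℝ :=
  ‖inner ℂ (combiner h N k c l ω) (column h N 0 l ω)‖ ^ 2

/-- Post-combining power `ρ` of the fading of the interferer of index `n`, summed over its `k`
streams. -/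
def interfererPower {Ω : Type*} (h : ℕ → ℕ → ℕ → Ω → ℂ) (N k c l n : ℕ) (ω : Ω) : ℝ :=
  ∑ j ∈ Finset.range k, ‖inner ℂ (combiner h N k c l ω) (column h N (n + 1) j ω)‖ ^ 2

/-- The signal-to-interference ratio of stream `l` at the typical receiver, whose transmitter is
at distance `d`, with path loss exponent `α`, when the `c` nearest of the interferers located at
the points `T 0, T 1, …` are canceled. The remaining interference may be an infinite sum, so
the ratio is formed in `[0, ∞]`. -/
def sir {Ω : Type*} (α d : ℝ) (T : ℕ → Ω → Plane) (h : ℕ → ℕ → ℕ → Ω → ℂ)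
    (N k c l : ℕ) (ω : Ω) : ℝ≥0∞ :=
  ENNReal.ofReal (d ^ (-α) * signalPower h N k c l ω) /
    ∑' n : ℕ, ‖T (c + n) ω‖ₑ ^ (-α) * ENNReal.ofReal (interfererPower h N k c l (c + n) ω)

/-- Outage probability of stream `l`: the probability that its SIR is at most `β`. With `k`
streams and `m` receive degrees of freedom for cancelation, the `⌊m/k⌋` nearest interferers are
canceled. -/
def outageProb {Ω : Type*} [MeasurableSpace Ω] (μ : Measure Ω) (α β d : ℝ) (T : ℕ → Ω → Plane)
    (h : ℕ → ℕ → ℕ → Ω → ℂ) (N k m l : ℕ) : ℝ :=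
  μ.real {ω | sir α d T h N k (m / k) l ω ≤ ENNReal.ofReal β}

/-- Transmission capacity `k λ⋆ (1 - ε) R`, where `λ⋆` is the largest intensity of transmitters
for which the outage probability of the first stream is at most `ε`. -/
def capacity {Ω : Type*} [MeasurableSpace Ω] (μ : Measure Ω) (α β d ε R : ℝ)
    (T : ℝ → ℕ → Ω → Plane) (h : ℕ → ℕ → ℕ → Ω → ℂ) (N k m : ℕ) : ℝ :=
  k * sSup {lam : ℝ | 0 < lam ∧ outageProb μ α β d (T lam) h N k m 0 ≤ ε} * (1 - ε) * R

/-- The admissible numbers `k` of streams and `m` of degrees of freedom used for cancelation, for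
`N` antennas: at least one degree of freedom is left for the desired stream, and the number
`⌊m/k⌋` of canceled interferers exceeds `α/2 - 1`. -/
def Admissible (α : ℝ) (N k m : ℕ) : Prop :=
  1 ≤ k ∧ k + m ≤ N ∧ α / 2 - 1 < ((m / k : ℕ) : ℝ)

/-- The derived upper bound on the transmission capacity. -/
def upperBound (α β d ε R : ℝ) (N k m : ℕ) : ℝ :=
  if k = 1 then
    R * (1 - ε) ^ (1 - 2 / α) / Real.pi * (((N : ℝ) - m) / (d ^ α * β)) ^ (2 / α)
      * (m + 13 / 8 + α / 4 + 1)
  else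
    k * R * (1 - ε) ^ (1 - 2 / α) / Real.pi
      * (((N : ℝ) - m - k + 1) / (((k : ℝ) - 1) * d ^ α * β)) ^ (2 / α)
      * (((m / k : ℕ) : ℝ) + 5 / 8 + α / 4)

/-- The derived lower bound on the transmission capacity. -/
def lowerBound (α β d ε R : ℝ) (N k m : ℕ) : ℝ :=
  if k + m = N then
    k * R * (1 - ε) / Real.pi * (-Real.log (1 - ε) / (k * β * d ^ α)) ^ (2 / α)
      * ((α / 2 - 1)⁻¹ * (((m / k : ℕ) : ℝ) + 1) ^ (1 - α / 2)) ^ (-(2 / α))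
  else
    k * R * (1 - ε) / Real.pi * (((N : ℝ) - k - m) * ε / (k * β * d ^ α)) ^ (2 / α)
      * ((α / 2 - 1)⁻¹ * (((m / k : ℕ) : ℝ) + 1) ^ (1 - α / 2)) ^ (-(2 / α))

/-- The factor that replaces the term `(c+1)^(1-α/2)` of the lower bound by the exact value
`Γ(c+1-α/2)/Γ(c)` of the mean interference (up to the other factors) left after the `c` nearest
interferers are canceled. -/
def meanCorrection (α : ℝ) (c : ℕ) : ℝ :=
  (((c : ℝ) + 1) ^ (1 - α / 2) * Real.Gamma c / Real.Gamma ((c : ℝ) + 1 - α / 2)) ^ (2 / α)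

end AdHoc

end

/-! ### The complex Gaussian law and its squared modulus -/

noncomputable section
namespace AdHoc

/-! The probabilistic half rests on the unitary invariance of complex Gaussian vectors. The combiner
is computed from the channel vectors of the desired transmitter and of the `c` canceled interferers.
The vectors of all other interferers are independent of it, so their inner products with this unit
vector are again i.i.d. `CN(0,1)`, whatever the combiner is. The signal power `s` is the squared
length of a Gaussian vector projected to an independent subspace, almost surely of dimension `D = N
- (k - 1 + kc)`. It is thus a sum of `D` unit exponentials, with `E s = D` and, for `D ≥ 2`, `E
(1/s) = 1/(D - 1)`. Locations, signal power and the remaining fading are independent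
(`exists_fading`). Since the points are sorted, `πλ d_n²` has the Gamma law of shape `n`
(`map_norm_sq`), so all moments of distances are Gamma ratios.

Lower bound on the capacity: the mean of the remaining interference `I` is a telescoping sum of
Gamma ratios (`sum_range_Gamma_ratio_le`). Markov's inequality for `I/s` bounds the outage
(`measure_sir_le_le`). If `k + m = N` there may be no spare degree of freedom and `E (1/s)` may be
infinite. A Jensen argument then gives the bound `1 - exp(-β d^α E I)`
(`measure_sir_le_le_one_sub_exp`). The intensity at which the estimated interference makes these
bounds at most `ε` yields `κ_c L` exactly.

Upper bound on the capacity: outage at most `ε` means that the SIR exceeds `β` with probability at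
least `1 - ε`. Markov's inequality is applied to the SIR itself, with only the `M` nearest remaining
interferers kept and all of them moved out to the distance of the farthest one
(`mul_measure_lt_sir_le`). Solving for `λ` leaves a power of a Gamma ratio, estimated by a weighted
AM-GM inequality (`Gamma_add_le`). Small `M` gives `U`, of order up to `N^(1+2/α)`. The choice `M =
c + 1` gives the sharper `O(N)`, so the linear scaling of the capacity is not deduced from `U`.

The rest is calculus. `L` is a constant times `η^(2/α) (k(c+1))^(1-2/α)`, and `k(c+1) ≤ k + m` with
equality for `k = 1`, so a single stream with the same total `k + m` is best. For `k = 1` and `m + 1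
< N` this is `N` times the profile `(1-θ)^(2/α) θ^(1-2/α)` at `θ = (m+1)/N`, which rises up to `1 -
2/α` and falls afterwards. Hence an integer maximizer is one of the two neighbours of `(1 - 2/α)N`.
-/

theorem measurable_complex_mk : Measurable (fun x : ℝ × ℝ => (⟨x.1, x.2⟩ : ℂ)) :=
  Complex.measurableEquivRealProd.symm.measurable

instance : IsProbabilityMeasure complexGaussian :=
  Measure.isProbabilityMeasure_map measurable_complex_mk.aemeasurable

theorem lintegral_Ioi_comp_sq (g : ℝ → ℝ≥0∞) :
    ∫⁻ r in Set.Ioi (0 : ℝ), ENNReal.ofReal (2 * r) * g (r ^ 2) = ∫⁻ t in Set.Ioi (0 : ℝ), g t := by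
  have himg : (fun r : ℝ => r ^ 2) '' Set.Ioi (0 : ℝ) = Set.Ioi 0 := by
    ext t
    constructor
    · rintro ⟨r, hr, rfl⟩
      exact pow_pos (Set.mem_Ioi.1 hr) 2
    · intro ht
      exact ⟨√t, Real.sqrt_pos.2 ht, Real.sq_sqrt (le_of_lt ht)⟩
  have hinj : Set.InjOn (fun r : ℝ => r ^ 2) (Set.Ioi (0 : ℝ)) := by
    intro a ha b hb hab
    exact (pow_left_inj₀ (le_of_lt ha) (le_of_lt hb) two_ne_zero).1 hab
  have h := lintegral_image_eq_lintegral_abs_deriv_mul (f := fun r : ℝ => r ^ 2)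
    (f' := fun r => 2 * r) measurableSet_Ioi
    (fun x _ => by simpa using (hasDerivAt_pow 2 x).hasDerivWithinAt) hinj g
  rw [himg] at h
  rw [h]
  refine setLIntegral_congr_fun measurableSet_Ioi fun r hr => ?_
  simp only [abs_of_pos (mul_pos two_pos (Set.mem_Ioi.1 hr))]

theorem gaussianPDFReal_half_mul (x y : ℝ) :
    gaussianPDFReal 0 (1 / 2) x * gaussianPDFReal 0 (1 / 2) y
      = Real.pi⁻¹ * Real.exp (-(x ^ 2 + y ^ 2)) := by
  have h2 : (2 * Real.pi * ((1 / 2 : ℝ≥0) : ℝ)) = Real.pi := by push_cast; ring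
  simp only [gaussianPDFReal, h2]
  rw [show ∀ a b c d : ℝ, a * b * (c * d) = (a * c) * (b * d) by intros; ring, ← Real.exp_add,
    ← mul_inv, Real.mul_self_sqrt Real.pi_pos.le]
  congr 2
  push_cast
  ring

/-- The squared modulus of a `CN(0,1)` variable is exponentially distributed. -/
theorem lintegral_normSq_complexGaussian {f : ℝ → ℝ≥0∞} (hf : Measurable f) :
    ∫⁻ z, f (‖z‖ ^ 2) ∂complexGaussian
      = ∫⁻ t in Set.Ioi (0 : ℝ), ENNReal.ofReal (Real.exp (-t)) * f t := by
  have h12 : (1 / 2 : ℝ≥0) ≠ 0 := by norm_num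
  have hm : Measurable (fun z : ℂ => f (‖z‖ ^ 2)) := hf.comp (by fun_prop)
  have hm' : Measurable (fun a : ℝ × ℝ => f (‖(⟨a.1, a.2⟩ : ℂ)‖ ^ 2)) :=
    hm.comp measurable_complex_mk
  rw [complexGaussian, lintegral_map hm measurable_complex_mk,
    gaussianReal_of_var_ne_zero _ h12,
    prod_withDensity (measurable_gaussianPDF _ _) (measurable_gaussianPDF _ _),
    lintegral_withDensity_eq_lintegral_mul _ (by fun_prop) hm']
  have e1 : ∀ p : ℝ × ℝ, ((fun z : ℝ × ℝ => gaussianPDF 0 (1 / 2) z.1 * gaussianPDF 0 (1 / 2) z.2) *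
      fun a : ℝ × ℝ => f (‖(⟨a.1, a.2⟩ : ℂ)‖ ^ 2)) p
      = ENNReal.ofReal (Real.pi⁻¹ * Real.exp (-(p.1 ^ 2 + p.2 ^ 2))) * f (p.1 ^ 2 + p.2 ^ 2) := by
    intro p
    simp only [Pi.mul_apply, gaussianPDF]
    rw [← ENNReal.ofReal_mul (gaussianPDFReal_nonneg _ _ _), gaussianPDFReal_half_mul,
      ← Complex.normSq_eq_norm_sq, Complex.normSq_mk, pow_two, pow_two]
  simp_rw [e1]
  -- In polar coordinates the angle contributes `2π`, which turns the density `π⁻¹ exp(-r²) r` into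
  -- `2r exp(-r²)`. The substitution `t = r²` then gives the exponential law.
  rw [← Measure.volume_eq_prod, ← lintegral_comp_polarCoord_symm]
  have e2 : ∀ p : ℝ × ℝ, ENNReal.ofReal p.1 • (ENNReal.ofReal (Real.pi⁻¹ *
      Real.exp (-((polarCoord.symm p).1 ^ 2 + (polarCoord.symm p).2 ^ 2))) *
        f ((polarCoord.symm p).1 ^ 2 + (polarCoord.symm p).2 ^ 2))
      =
        ENNReal.ofReal p.1 * (ENNReal.ofReal (Real.pi⁻¹ * Real.exp (-(p.1 ^ 2))) * f (p.1 ^ 2)) := by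
    intro p
    have : (polarCoord.symm p).1 ^ 2 + (polarCoord.symm p).2 ^ 2 = p.1 ^ 2 := by
      simp only [polarCoord_symm_apply]
      have := Real.sin_sq_add_cos_sq p.2
      linear_combination p.1 ^ 2 * this
    rw [this, smul_eq_mul]
  simp_rw [e2]
  rw [polarCoord_target, Measure.volume_eq_prod, ← Measure.prod_restrict,
    lintegral_prod _ (by fun_prop)]
  simp only [lintegral_const, Measure.restrict_apply MeasurableSet.univ, Set.univ_inter,
    Real.volume_Ioo]
  rw [← lintegral_Ioi_comp_sq (fun t => ENNReal.ofReal (Real.exp (-t)) * f t)]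
  refine setLIntegral_congr_fun measurableSet_Ioi fun r hr => ?_
  have hr' : 0 < r := hr
  have hpi := Real.pi_pos
  rw [mul_comm _ (ENNReal.ofReal (Real.pi - -Real.pi)), ← mul_assoc, ← mul_assoc, ← mul_assoc,
    ← ENNReal.ofReal_mul (by linarith), ← ENNReal.ofReal_mul (by nlinarith),
    ← ENNReal.ofReal_mul (by linarith)]
  congr 2
  field_simp
  ring

theorem complexGaussian_normSq_gt (x : ℝ) (hx : 0 ≤ x) :
    complexGaussian {z | x < ‖z‖ ^ 2} = ENNReal.ofReal (Real.exp (-x)) := by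
  have hms : MeasurableSet {z : ℂ | x < ‖z‖ ^ 2} :=
    measurableSet_lt measurable_const (by fun_prop)
  rw [← lintegral_indicator_one hms]
  have : ∀ z : ℂ, Set.indicator {z : ℂ | x < ‖z‖ ^ 2} (1 : ℂ → ℝ≥0∞) z
      = (Set.Ioi x).indicator 1 (‖z‖ ^ 2) := by
    intro z; simp [Set.indicator_apply]
  simp_rw [this]
  rw [lintegral_normSq_complexGaussian (measurable_one.indicator measurableSet_Ioi)]
  have : ∀ t : ℝ, ENNReal.ofReal (Real.exp (-t)) * (Set.Ioi x).indicator 1 t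
      = (Set.Ioi x).indicator (fun t => ENNReal.ofReal (Real.exp (-t))) t := by
    intro t; by_cases h : t ∈ Set.Ioi x <;> simp [h]
  simp_rw [this]
  rw [lintegral_indicator measurableSet_Ioi, Measure.restrict_restrict measurableSet_Ioi,
    Set.inter_eq_self_of_subset_left (Set.Ioi_subset_Ioi hx),
    ← ofReal_integral_eq_lintegral_ofReal (integrableOn_exp_neg_Ioi x)
      (ae_of_all _ fun t => (Real.exp_pos _).le), integral_exp_neg_Ioi]

theorem lintegral_exp_neg_mul_Ioi {b : ℝ} (hb : 0 < b) :
    ∫⁻ t in Set.Ioi (0 : ℝ), ENNReal.ofReal (Real.exp (-(b * t))) = ENNReal.ofReal b⁻¹ := by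
  have h := integral_exp_mul_Ioi (a := -b) (by linarith) 0
  have hi := integrableOn_exp_mul_Ioi (a := -b) (by linarith) 0
  simp only [neg_mul] at h hi
  rw [← ofReal_integral_eq_lintegral_ofReal hi (ae_of_all _ fun t => (Real.exp_pos _).le), h]
  simp

/-- Laplace transform of the squared modulus of a `CN(0,1)` variable. -/
theorem lintegral_exp_neg_complexGaussian {t : ℝ} (ht : 0 ≤ t) :
    ∫⁻ z, ENNReal.ofReal (Real.exp (-(t * ‖z‖ ^ 2))) ∂complexGaussian
      = ENNReal.ofReal (1 + t)⁻¹ := by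
  rw [lintegral_normSq_complexGaussian (f := fun x => ENNReal.ofReal (Real.exp (-(t * x))))
    (by fun_prop), ← lintegral_exp_neg_mul_Ioi (by linarith)]
  refine lintegral_congr fun x => ?_
  rw [← ENNReal.ofReal_mul (Real.exp_pos _).le, ← Real.exp_add]
  congr 2
  ring

theorem lintegral_normSq_complexGaussian_eq_one :
    ∫⁻ z, ENNReal.ofReal (‖z‖ ^ 2) ∂complexGaussian = 1 := by
  rw [lintegral_normSq_complexGaussian (f := fun x => ENNReal.ofReal x) (by fun_prop)]
  have h := Real.GammaIntegral_convergent (s := 2) (by norm_num)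
  have e : ∀ t ∈ Set.Ioi (0 : ℝ), ENNReal.ofReal (Real.exp (-t)) * ENNReal.ofReal t
      = ENNReal.ofReal (Real.exp (-t) * t ^ ((2 : ℝ) - 1)) := by
    intro t _
    rw [← ENNReal.ofReal_mul (Real.exp_pos _).le]
    norm_num
  rw [setLIntegral_congr_fun measurableSet_Ioi e,
    ← ofReal_integral_eq_lintegral_ofReal h ?_, ← Real.Gamma_eq_integral two_pos]
  · simp
  · refine (ae_restrict_iff' measurableSet_Ioi).2 (ae_of_all _ fun t ht => ?_)
    have : (0 : ℝ) < t := ht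
    positivity

/-- `E exp(-tS)`, integrated over `t`, is `E (1/S)`. -/
theorem lintegral_exp_neg_mul_eq_inv (s : ℝ) (hs : 0 ≤ s) :
    ∫⁻ t in Set.Ioi (0 : ℝ), ENNReal.ofReal (Real.exp (-(t * s))) = (ENNReal.ofReal s)⁻¹ := by
  -- At `s = 0` both sides are `∞`, so no positivity of the power has to be established before this
  -- identity is used.
  rcases hs.eq_or_lt with rfl | hs
  · simp
  · simp_rw [mul_comm _ s]
    rw [lintegral_exp_neg_mul_Ioi hs, ENNReal.ofReal_inv_of_pos hs]

/-- The integrand has an explicit antiderivative. For `n = 1` the integral diverges, which is why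
every inverse moment of a power needs two degrees of freedom. -/
theorem lintegral_one_add_inv_pow {n : ℕ} (hn : 2 ≤ n) :
    ∫⁻ t in Set.Ioi (0 : ℝ), ENNReal.ofReal (1 + t)⁻¹ ^ n = ENNReal.ofReal ((n : ℝ) - 1)⁻¹ := by
  have hn' : (2 : ℝ) ≤ n := by exact_mod_cast hn
  have hd : ∀ x ∈ Set.Ioi (0 : ℝ), HasDerivAt
      (fun t : ℝ => -(((n : ℝ) - 1)⁻¹ * (1 + t) ^ (1 - (n : ℝ)))) ((1 + x)⁻¹ ^ n) x := by
    intro x hx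
    have hx' : 0 < 1 + x := by have : (0 : ℝ) < x := hx; linarith
    have h1 := ((((hasDerivAt_id x).const_add 1).rpow_const (p := 1 - (n : ℝ))
      (Or.inl hx'.ne')).const_mul ((n : ℝ) - 1)⁻¹).neg
    refine h1.congr_deriv ?_
    have : (1 : ℝ) - n - 1 = -n := by ring
    simp only [id, this]
    rw [Real.rpow_neg hx'.le, Real.rpow_natCast, inv_pow]
    field_simp [show (n : ℝ) - 1 ≠ 0 by linarith]
    ring
  have hc : ContinuousWithinAt (fun t : ℝ => -(((n : ℝ) - 1)⁻¹ * (1 + t) ^ (1 - (n : ℝ))))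
      (Set.Ici 0) 0 := by
    have : ContinuousAt (fun t : ℝ => (1 + t) ^ (1 - (n : ℝ))) 0 :=
      ContinuousAt.rpow_const (by fun_prop) (Or.inl (by norm_num))
    exact (this.const_mul _).neg.continuousWithinAt
  have hlim : Tendsto (fun t : ℝ => -(((n : ℝ) - 1)⁻¹ * (1 + t) ^ (1 - (n : ℝ)))) atTop (𝓝 0) := by
    have h1 := (tendsto_rpow_neg_atTop (y := (n : ℝ) - 1) (by linarith)).comp
      (tendsto_atTop_add_const_left atTop (1 : ℝ) tendsto_id)
    simpa using (h1.const_mul ((n : ℝ) - 1)⁻¹).neg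
  have hnn : ∀ x ∈ Set.Ioi (0 : ℝ), 0 ≤ (1 + x)⁻¹ ^ n := by
    intro x hx
    have : (0 : ℝ) < x := hx
    positivity
  have hi := integrableOn_Ioi_deriv_of_nonneg hc hd hnn hlim
  have he := integral_Ioi_of_hasDerivAt_of_nonneg hc hd hnn hlim
  rw [setLIntegral_congr_fun (g := fun t => ENNReal.ofReal ((1 + t)⁻¹ ^ n)) measurableSet_Ioi ?_,
    ← ofReal_integral_eq_lintegral_ofReal hi ((ae_restrict_iff' measurableSet_Ioi).2
      (ae_of_all _ hnn)), he]
  · simp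
  · intro t ht
    have : (0 : ℝ) < t := ht
    exact (ENNReal.ofReal_pow (by positivity) n).symm

/-- The mean of `1/S` where `S` is the total power of `n` independent `CN(0,1)` variables. -/
theorem lintegral_inv_sum_normSq {Ω ι : Type*} [MeasurableSpace Ω] {μ : Measure Ω}
    [IsProbabilityMeasure μ] {X : ι → Ω → ℂ} (hX : ∀ i, Measurable (X i))
    (hlaw : ∀ i, μ.map (X i) = complexGaussian) (hind : iIndepFun X μ) (s : Finset ι)
    (hs : 2 ≤ s.card) :
    ∫⁻ ω, (ENNReal.ofReal (∑ i ∈ s, ‖X i ω‖ ^ 2))⁻¹ ∂μ = ENNReal.ofReal ((s.card : ℝ) - 1)⁻¹ := by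
  have h1 : ∀ ω, (ENNReal.ofReal (∑ i ∈ s, ‖X i ω‖ ^ 2))⁻¹
      = ∫⁻ t in Set.Ioi (0 : ℝ), ENNReal.ofReal (Real.exp (-(t * ∑ i ∈ s, ‖X i ω‖ ^ 2))) :=
    fun ω => (lintegral_exp_neg_mul_eq_inv _ (by positivity)).symm
  simp_rw [h1]
  -- By Tonelli, `E (1/S)` is the integral over `t` of the Laplace transform of `S`. By independence
  -- that transform is `(1 + t)⁻¹` to the power of the number of summands.
  rw [lintegral_lintegral_swap (by fun_prop), ← lintegral_one_add_inv_pow hs]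
  refine setLIntegral_congr_fun measurableSet_Ioi fun t ht => ?_
  have ht' : (0 : ℝ) ≤ t := le_of_lt ht
  have h2 : ∀ ω, ENNReal.ofReal (Real.exp (-(t * ∑ i ∈ s, ‖X i ω‖ ^ 2)))
      = ∏ i ∈ s, ENNReal.ofReal (Real.exp (-(t * ‖X i ω‖ ^ 2))) := by
    intro ω
    rw [← ENNReal.ofReal_prod_of_nonneg fun i _ => (Real.exp_pos _).le, ← Real.exp_sum,
      Finset.mul_sum, Finset.sum_neg_distrib]
  simp_rw [h2]
  have hg : Measurable (fun z : ℂ => ENNReal.ofReal (Real.exp (-(t * ‖z‖ ^ 2)))) := by fun_prop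
  have h3 := lintegral_prod_eq_prod_lintegral_of_indepFun (μ := μ) s
    (fun i ω => ENNReal.ofReal (Real.exp (-(t * ‖X i ω‖ ^ 2))))
    (hind.comp (fun _ z => ENNReal.ofReal (Real.exp (-(t * ‖z‖ ^ 2)))) fun _ => hg)
    (fun i => hg.comp (hX i))
  rw [h3, Finset.prod_congr rfl (g := fun _ => ENNReal.ofReal (1 + t)⁻¹), Finset.prod_const]
  intro i _
  rw [← lintegral_exp_neg_complexGaussian ht', ← hlaw i, lintegral_map hg (hX i)]

/-! ### Unitary invariance of Gaussian vectors and powers of their projections -/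

theorem charFun_complexGaussian (t : ℂ) :
    charFun complexGaussian t = Complex.exp (-(‖t‖ ^ 2 / 4 : ℝ)) := by
  rw [charFun_apply, complexGaussian,
    integral_map measurable_complex_mk.aemeasurable (by fun_prop)]
  have e : ∀ x : ℝ × ℝ, Complex.exp ((inner ℝ (⟨x.1, x.2⟩ : ℂ) t : ℝ) * Complex.I)
      = Complex.exp (t.re * x.1 * Complex.I) * Complex.exp (t.im * x.2 * Complex.I) := by
    intro x
    rw [← Complex.exp_add, Complex.inner]
    congr 1
    simp
    ring
  simp_rw [e]
  rw [integral_prod_mul (fun x : ℝ => Complex.exp (t.re * x * Complex.I))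
    (fun x : ℝ => Complex.exp (t.im * x * Complex.I)), ← charFun_apply_real, ← charFun_apply_real,
    charFun_gaussianReal, charFun_gaussianReal, ← Complex.exp_add, ← Complex.normSq_eq_norm_sq,
    Complex.normSq_apply]
  congr 1
  push_cast
  ring

/-- The law of a vector of `N` independent `CN(0,1)` variables. -/
def gaussianVector (N : ℕ) : Measure (EuclideanSpace ℂ (Fin N)) :=
  (Measure.pi fun _ : Fin N => complexGaussian).map (WithLp.toLp 2)

instance (N : ℕ) : IsProbabilityMeasure (gaussianVector N) :=
  Measure.isProbabilityMeasure_map (by fun_prop)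

theorem real_inner_eq_re {N : ℕ} (x y : EuclideanSpace ℂ (Fin N)) :
    inner ℝ x y = (inner ℂ x y).re := by
  simp [PiLp.inner_apply, Complex.inner, Complex.mul_re]

theorem charFun_gaussianVector {N : ℕ} (t : EuclideanSpace ℂ (Fin N)) :
    charFun (gaussianVector N) t = Complex.exp (-(‖t‖ ^ 2 / 4 : ℝ)) := by
  rw [gaussianVector, charFun_pi, EuclideanSpace.norm_sq_eq]
  simp_rw [charFun_complexGaussian]
  rw [← Complex.exp_sum]
  congr 1
  push_cast
  rw [Finset.sum_neg_distrib, Finset.sum_div]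

/-- The characteristic function of a Gaussian vector depends on the norm of its argument only, and
testing `⟨q, x⟩` against `t` is testing `x` against `t • q`, which has norm `‖t‖`. -/
theorem gaussianVector_map_inner {N : ℕ} {q : EuclideanSpace ℂ (Fin N)} (hq : ‖q‖ = 1) :
    (gaussianVector N).map (fun x => inner ℂ q x) = complexGaussian := by
  have hm : Measurable fun x : EuclideanSpace ℂ (Fin N) => inner ℂ q x := by fun_prop
  have := Measure.isProbabilityMeasure_map (μ := gaussianVector N) hm.aemeasurable
  refine Measure.ext_of_charFun (funext fun t => ?_)
  rw [charFun_complexGaussian, charFun_apply, integral_map hm.aemeasurable (by fun_prop)]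
  have e : ∀ x : EuclideanSpace ℂ (Fin N), (inner ℝ (inner ℂ q x) t : ℝ) = inner ℝ x (t • q) := by
    intro x
    rw [real_inner_eq_re, inner_smul_right, Complex.inner, inner_conj_symm, mul_comm]
  simp_rw [e]
  rw [← charFun_apply, charFun_gaussianVector, norm_smul, hq, mul_one]

theorem gaussianVector_map_orthonormal {N D : ℕ} {u : Fin D → EuclideanSpace ℂ (Fin N)}
    (hu : Orthonormal ℂ u) :
    (gaussianVector N).map (fun x => WithLp.toLp 2 fun i => inner ℂ (u i) x)
      = gaussianVector D := by
  have hm : Measurable fun x : EuclideanSpace ℂ (Fin N) =>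
      (WithLp.toLp 2 fun i => inner ℂ (u i) x : EuclideanSpace ℂ (Fin D)) := by fun_prop
  have := Measure.isProbabilityMeasure_map (μ := gaussianVector N) hm.aemeasurable
  refine Measure.ext_of_charFun (funext fun t => ?_)
  rw [charFun_gaussianVector, charFun_apply, integral_map hm.aemeasurable (by fun_prop)]
  have e : ∀ x : EuclideanSpace ℂ (Fin N),
      (inner ℝ (WithLp.toLp 2 fun i => inner ℂ (u i) x : EuclideanSpace ℂ (Fin D)) t : ℝ)
        = inner ℝ x (∑ i, t i • u i) := by
    intro x
    rw [real_inner_eq_re, real_inner_eq_re, inner_sum, PiLp.inner_apply]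
    congr 1
    refine Finset.sum_congr rfl fun i _ => ?_
    rw [inner_smul_right]
    simp [inner_conj_symm]
  have e2 : ‖∑ i, t i • u i‖ ^ 2 = ‖t‖ ^ 2 := by
    have h := hu.inner_sum t t Finset.univ
    rw [EuclideanSpace.norm_sq_eq t]
    have h2 := inner_self_eq_norm_sq_to_K (𝕜 := ℂ) (∑ i, t i • u i)
    rw [h] at h2
    have : ((‖∑ i, t i • u i‖ ^ 2 : ℝ) : ℂ) = ((∑ i, ‖t i‖ ^ 2 : ℝ) : ℂ) := by
      rw [Complex.ofReal_pow, Complex.ofReal_sum]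
      refine h2.symm.trans (Finset.sum_congr rfl fun i _ => ?_)
      rw [Complex.conj_mul', Complex.ofReal_pow]
    exact_mod_cast this
  simp_rw [e]
  rw [← charFun_apply, charFun_gaussianVector, e2]

/-- The power of the projection of a Gaussian vector to a subspace of dimension `D` is the total
power of `D` independent `CN(0,1)` variables. -/
theorem lintegral_norm_sq_starProjection {N : ℕ} (L : Submodule ℂ (EuclideanSpace ℂ (Fin N)))
    {f : ℝ → ℝ≥0∞} (hf : Measurable f) :
    ∫⁻ x, f (‖L.starProjection x‖ ^ 2) ∂gaussianVector N
      = ∫⁻ z, f (∑ i, ‖z i‖ ^ 2)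
          ∂Measure.pi (fun _ : Fin (Module.finrank ℂ L) => complexGaussian) := by
  set b := stdOrthonormalBasis ℂ L
  have hu : Orthonormal ℂ fun i => (b i : EuclideanSpace ℂ (Fin N)) :=
    b.orthonormal.comp_linearIsometry L.subtypeₗᵢ
  have e1 : ∀ x, ‖L.starProjection x‖ ^ 2
      = ‖(WithLp.toLp 2 fun i => inner ℂ (b i : EuclideanSpace ℂ (Fin N)) x :
          EuclideanSpace ℂ (Fin (Module.finrank ℂ L)))‖ ^ 2 := by
    intro x
    rw [Submodule.starProjection_apply, ← Submodule.coe_norm, ← b.sum_sq_norm_inner_right,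
      EuclideanSpace.norm_sq_eq]
    refine Finset.sum_congr rfl fun i _ => ?_
    simp
  simp_rw [e1]
  have hm : Measurable fun x : EuclideanSpace ℂ (Fin N) =>
      (WithLp.toLp 2 fun i => inner ℂ (b i : EuclideanSpace ℂ (Fin N)) x :
        EuclideanSpace ℂ (Fin (Module.finrank ℂ L))) := by fun_prop
  rw [← lintegral_map (f := fun y : EuclideanSpace ℂ (Fin (Module.finrank ℂ L)) => f (‖y‖ ^ 2))
    (hf.comp (by fun_prop)) hm, gaussianVector_map_orthonormal hu, gaussianVector,
    lintegral_map (f := fun y : EuclideanSpace ℂ (Fin (Module.finrank ℂ L)) => f (‖y‖ ^ 2))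
      (hf.comp (by fun_prop)) (by fun_prop)]
  simp_rw [EuclideanSpace.norm_sq_eq]

theorem lintegral_norm_sq_starProjection_eq_finrank {N : ℕ}
    (L : Submodule ℂ (EuclideanSpace ℂ (Fin N))) :
    ∫⁻ x, ENNReal.ofReal (‖L.starProjection x‖ ^ 2) ∂gaussianVector N = Module.finrank ℂ L := by
  rw [lintegral_norm_sq_starProjection L ENNReal.measurable_ofReal]
  simp_rw [ENNReal.ofReal_sum_of_nonneg fun i _ => sq_nonneg _]
  rw [lintegral_finsetSum _ (by fun_prop)]
  have : ∀ i : Fin (Module.finrank ℂ L), ∫⁻ z, ENNReal.ofReal (‖z i‖ ^ 2)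
      ∂Measure.pi (fun _ : Fin (Module.finrank ℂ L) => complexGaussian) = 1 := by
    intro i
    rw [← lintegral_normSq_complexGaussian_eq_one,
      ← (measurePreserving_eval (fun _ : Fin (Module.finrank ℂ L) => complexGaussian)
        i).lintegral_comp
        (f := fun z => ENNReal.ofReal (‖z‖ ^ 2)) (by fun_prop)]
  rw [Finset.sum_congr rfl fun i _ => this i]
  simp

theorem lintegral_inv_norm_sq_starProjection {N : ℕ}
    (L : Submodule ℂ (EuclideanSpace ℂ (Fin N))) (hL : 2 ≤ Module.finrank ℂ L) :
    ∫⁻ x, (ENNReal.ofReal (‖L.starProjection x‖ ^ 2))⁻¹ ∂gaussianVector N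
      = ENNReal.ofReal ((Module.finrank ℂ L : ℝ) - 1)⁻¹ := by
  rw [lintegral_norm_sq_starProjection (f := fun x => (ENNReal.ofReal x)⁻¹) L (by fun_prop)]
  have hmp := fun i => measurePreserving_eval
    (fun _ : Fin (Module.finrank ℂ L) => complexGaussian) i
  have h := lintegral_inv_sum_normSq
    (μ := Measure.pi (fun _ : Fin (Module.finrank ℂ L) => complexGaussian))
    (X := fun i z => z i) (fun i => measurable_pi_apply i) (fun i => (hmp i).map_eq)
    (iIndepFun_pi (X := fun _ z => z) fun i => aemeasurable_id) Finset.univ (by simpa using hL)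
  simpa using h

/-- The power along a single unit vector of `L` is a unit exponential and is at most the power along
all of `L`. This crude tail bound serves when no second degree of freedom is left. -/
theorem exp_neg_le_gaussianVector_norm_sq_starProjection {N : ℕ}
    (L : Submodule ℂ (EuclideanSpace ℂ (Fin N))) (hL : 1 ≤ Module.finrank ℂ L) {y : ℝ}
    (hy : 0 ≤ y) :
    ENNReal.ofReal (Real.exp (-y)) ≤ gaussianVector N {x | y < ‖L.starProjection x‖ ^ 2} := by
  obtain ⟨v, hv⟩ := (Submodule.ne_bot_iff L).1 (by
    rintro rfl
    simp at hL)
  set u : EuclideanSpace ℂ (Fin N) := ((‖v‖⁻¹ : ℝ) : ℂ) • v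
  have hu : ‖u‖ = 1 := by
    simp only [u, norm_smul]
    simp [hv.2]
  have huL : u ∈ L := L.smul_mem _ hv.1
  rw [← complexGaussian_normSq_gt y hy, ← gaussianVector_map_inner hu,
    Measure.map_apply (by fun_prop) (measurableSet_lt measurable_const (by fun_prop))]
  refine measure_mono fun x hx => lt_of_lt_of_le (show y < ‖inner ℂ u x‖ ^ 2 from hx) ?_
  have : inner ℂ u x = inner ℂ u (L.starProjection x) := by
    rw [← Submodule.inner_starProjection_left_eq_right, Submodule.starProjection_eq_self_iff.2 huL]
  rw [this]
  have h2 := norm_inner_le_norm (𝕜 := ℂ) u (L.starProjection x)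
  rw [hu, one_mul] at h2
  gcongr

/-- The tail bound for `Kᗮ` at `y = 0` says that the component orthogonal to `K` is nonzero with
probability one. -/
theorem gaussianVector_submodule {N : ℕ} (K : Submodule ℂ (EuclideanSpace ℂ (Fin N)))
    (hK : Module.finrank ℂ K < N) : gaussianVector N K = 0 := by
  have h1 : Module.finrank ℂ K + Module.finrank ℂ Kᗮ = N := by
    rw [Submodule.finrank_add_finrank_orthogonal, finrank_euclideanSpace_fin]
  have h := exp_neg_le_gaussianVector_norm_sq_starProjection Kᗮ (by omega) le_rfl
  have hm : MeasurableSet {x : EuclideanSpace ℂ (Fin N) | 0 < ‖Kᗮ.starProjection x‖ ^ 2} :=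
    measurableSet_lt measurable_const (by fun_prop)
  have h3 := prob_le_one (μ := gaussianVector N)
    (s := {x : EuclideanSpace ℂ (Fin N) | 0 < ‖Kᗮ.starProjection x‖ ^ 2})
  simp only [neg_zero, Real.exp_zero, ENNReal.ofReal_one] at h
  refine measure_mono_null (t := {x | 0 < ‖Kᗮ.starProjection x‖ ^ 2}ᶜ) (fun x hx => ?_)
    ((prob_compl_eq_zero_iff hm).2 (le_antisymm h3 h))
  have : Kᗮ.starProjection x = 0 := by
    rw [Submodule.starProjection_apply_eq_zero_iff]
    exact Submodule.le_orthogonal_orthogonal K hx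
  simp only [Set.mem_compl_iff, Set.mem_ofPred_eq, this]
  simp

/-! ### Measurability of projections by Gram-Schmidt -/

section Projection

variable {E : Type*} [NormedAddCommGroup E] [InnerProductSpace ℂ E] [FiniteDimensional ℂ E]

/-- One Gram-Schmidt step. -/
theorem starProjection_orthogonal_span_insert (s : Set E) (v x : E) :
    (Submodule.span ℂ (insert v s))ᗮ.starProjection x
      = (Submodule.span ℂ s)ᗮ.starProjection x
        - (inner ℂ ((Submodule.span ℂ s)ᗮ.starProjection v)
            ((Submodule.span ℂ s)ᗮ.starProjection x)
              / ((‖(Submodule.span ℂ s)ᗮ.starProjection v‖ ^ 2 : ℝ) : ℂ))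
          • (Submodule.span ℂ s)ᗮ.starProjection v := by
  set S := Submodule.span ℂ s
  set Px := Sᗮ.starProjection x with hPx
  set Pv := Sᗮ.starProjection v with hPv
  have hSle : S ≤ Submodule.span ℂ (insert v s) := Submodule.span_mono (Set.subset_insert v s)
  have hmem : ∀ y : E, Sᗮ.starProjection y ∈ Sᗮ := fun y => Submodule.starProjection_apply_mem _ y
  have hsub : ∀ y : E, y - Sᗮ.starProjection y ∈ S := by
    intro y
    have := Submodule.sub_starProjection_mem_orthogonal (K := Sᗮ) y
    rwa [Submodule.orthogonal_orthogonal] at this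
  have hPvK : Pv ∈ Submodule.span ℂ (insert v s) := by
    have h1 : v ∈ Submodule.span ℂ (insert v s) := Submodule.subset_span (Set.mem_insert v s)
    have h2 := Submodule.sub_mem _ h1 (hSle (hsub v))
    rwa [sub_sub_cancel] at h2
  refine (Submodule.eq_starProjection_of_mem_of_inner_eq_zero ?_ ?_)
  · have hyS : Px - (inner ℂ Pv Px / ((‖Pv‖ ^ 2 : ℝ) : ℂ)) • Pv ∈ Sᗮ :=
      Submodule.sub_mem _ (hmem x) (Submodule.smul_mem _ _ (hmem v))
    rw [Submodule.span_insert, ← Submodule.inf_orthogonal]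
    refine ⟨?_, hyS⟩
    refine Submodule.mem_orthogonal_singleton_iff_inner_right.2 ?_
    have hdec : v = Pv + (v - Pv) := by abel
    rw [hdec, inner_add_left, Submodule.inner_right_of_mem_orthogonal (hsub v) hyS, add_zero,
      inner_sub_right, inner_smul_right, inner_self_eq_norm_sq_to_K]
    -- If `v` already lies in the span, the coefficient is a division by zero, hence `0`, and the
    -- formula stays correct. No linear independence is needed.
    rcases eq_or_ne Pv 0 with h0 | h0
    · simp [h0]
    · have : ((‖Pv‖ : ℝ) : ℂ) ≠ 0 := by simpa using h0
      push_cast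
      field_simp
      simp
  · intro w hw
    have : x - (Px - (inner ℂ Pv Px / ((‖Pv‖ ^ 2 : ℝ) : ℂ)) • Pv) ∈
        Submodule.span ℂ (insert v s) := by
      have h1 : x - (Px - (inner ℂ Pv Px / ((‖Pv‖ ^ 2 : ℝ) : ℂ)) • Pv)
          = (x - Px) + (inner ℂ Pv Px / ((‖Pv‖ ^ 2 : ℝ) : ℂ)) • Pv := by abel
      rw [h1]
      exact Submodule.add_mem _ (hSle (hsub x)) (Submodule.smul_mem _ _ hPvK)
    exact Submodule.inner_right_of_mem_orthogonal this hw

/-- The projection to the orthogonal complement of finitely many vectors depends measurably on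
these vectors and on the projected vector. -/
theorem measurable_starProjection_orthogonal_span [MeasurableSpace E] [BorelSpace E]
    {ι : Type*} [DecidableEq ι] (A : Finset ι) :
    Measurable fun p : (ι → E) × E => (Submodule.span ℂ (p.1 '' A))ᗮ.starProjection p.2 := by
  have : ProperSpace E := FiniteDimensional.proper ℂ E
  have : SecondCountableTopology E := secondCountable_of_proper
  induction A using Finset.induction_on with
  | empty =>
    have : ∀ x : E, (⊤ : Submodule ℂ E).starProjection x = x := fun x =>
      Submodule.starProjection_eq_self_iff.2 trivial
    simpa [this] using measurable_snd
  | insert a A ha ih =>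
    -- The projection is discontinuous where the rank drops, but the Gram-Schmidt formula is an
    -- everywhere valid expression in measurable operations.
    simp only [Finset.coe_insert, Set.image_insert_eq, starProjection_orthogonal_span_insert]
    have h1 : Measurable fun p : (ι → E) × E =>
        (Submodule.span ℂ (p.1 '' A))ᗮ.starProjection (p.1 a) :=
      ih.comp (measurable_fst.prodMk ((measurable_pi_apply a).comp measurable_fst))
    exact
      ih.sub (((h1.inner ih).div (Complex.measurable_ofReal.comp (h1.norm.pow_const 2))).smul h1)

end Projection

/-! ### Grouping independent variables -/

section Independence

variable {Ω : Type*} [MeasurableSpace Ω] {μ : Measure Ω}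

/-- Grouping independent variables that are indexed by a product gives independent families. -/
theorem iIndepFun_curry [IsProbabilityMeasure μ] {ι κ 𝓧 : Type*} [MeasurableSpace 𝓧]
    {f : ι × κ → Ω → 𝓧} (hf : ∀ p, Measurable (f p)) (h : iIndepFun f μ) :
    iIndepFun (fun i ω (j : κ) => f (i, j) ω) μ := by
  have hp : ∀ p, IsProbabilityMeasure (μ.map (f p)) := fun p =>
    Measure.isProbabilityMeasure_map (hf p).aemeasurable
  rw [iIndepFun_iff_map_fun_eq_infinitePi_map fun i => measurable_pi_iff.2 fun j => hf (i, j)]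
  have h1 : μ.map (fun ω i (j : κ) => f (i, j) ω)
      = (μ.map fun ω p => f p ω).map (MeasurableEquiv.curry ι κ 𝓧) := by
    rw [Measure.map_map (MeasurableEquiv.measurable _) (measurable_pi_iff.2 hf)]
    rfl
  rw [h1, h.map_fun_eq_infinitePi_map hf,
    Measure.infinitePi_map_curry (fun i j => μ.map (f (i, j)))]
  congr 1
  funext i
  have hi : iIndepFun (fun j => f (i, j)) μ :=
    h.precomp (g := fun j : κ => (i, j)) fun a b hab => by simpa using hab
  exact (hi.map_fun_eq_infinitePi_map fun j => hf (i, j)).symm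

/-- Functions of two disjoint subfamilies of an independent family are independent. -/
theorem iIndepFun.indepFun_of_measurable_iSup {ι 𝓧 β γ : Type*} [m𝓧 : MeasurableSpace 𝓧]
    [MeasurableSpace β] [MeasurableSpace γ]
    {f : ι → Ω → 𝓧} (hf : ∀ p, Measurable (f p)) (h : iIndepFun f μ) {S T : Set ι}
    (hST : Disjoint S T) {u : Ω → β} {v : Ω → γ}
    (hu : Measurable[⨆ i ∈ S, MeasurableSpace.comap (f i) m𝓧] u)
    (hv : Measurable[⨆ i ∈ T, MeasurableSpace.comap (f i) m𝓧] v) :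
    IndepFun u v μ := by
  rw [IndepFun_iff_Indep]
  exact indep_of_indep_of_le_left (indep_of_indep_of_le_right
    (indep_iSup_of_disjoint (fun i => (hf i).comap_le) ((iIndepFun_iff_iIndep _ _ _).1 h) hST)
    hv.comap_le) hu.comap_le

end Independence

theorem measurable_iSup_comap {Ω ι 𝓧 : Type*} [m𝓧 : MeasurableSpace 𝓧] {f : ι → Ω → 𝓧} {S : Set ι}
    {i : ι} (hi : i ∈ S) : Measurable[⨆ i ∈ S, MeasurableSpace.comap (f i) m𝓧] (f i) :=
  (comap_measurable (f i)).mono (le_iSup₂_of_le i hi le_rfl) le_rfl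

section Span

variable {Ω ι : Type*} {N : ℕ} {C : ι → Ω → EuclideanSpace ℂ (Fin N)}

theorem image_restrict [DecidableEq ι] (A : Finset ι) (ω : Ω) :
    (fun i => if i ∈ A then C i ω else 0) '' (A : Set ι) = (fun i => C i ω) '' A :=
  Set.image_congr fun i hi => by simp [Finset.mem_coe.1 hi]

theorem finrank_span_image_le (A : Finset ι) (ω : Ω) :
    Module.finrank ℂ (Submodule.span ℂ ((fun i => C i ω) '' A)) ≤ A.card := by
  classical
  rw [← Finset.coe_image]
  exact (finrank_span_finset_le_card _).trans Finset.card_image_le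

end Span

/-! ### One Gaussian vector projected away from others -/

section GaussianFamily

variable {Ω ι : Type*} [MeasurableSpace Ω] {μ : Measure Ω} [IsProbabilityMeasure μ] [DecidableEq ι]
  {N : ℕ} {C : ι → Ω → EuclideanSpace ℂ (Fin N)}

/-- The power of the projection of one member of a Gaussian family to the orthogonal complement of
other members: the projected member may be integrated out first. -/
theorem map_restrict_prod_eq (hC : ∀ i, Measurable (C i))
    (hlaw : ∀ i, μ.map (C i) = gaussianVector N) (hind : iIndepFun C μ) {A : Finset ι} {b : ι}
    (hb : b ∉ A) :
    μ.map (fun ω => (fun i => if i ∈ A then C i ω else 0, C b ω))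
      = (μ.map fun ω i => if i ∈ A then C i ω else 0).prod (gaussianVector N) := by
  -- Setting the entries outside `A` to zero keeps the index type `ι` while making the family
  -- measurable with respect to the vectors in `A` alone.
  have hu : Measurable[⨆ i ∈ (A : Set ι), MeasurableSpace.comap (C i) inferInstance]
      (fun ω i => if i ∈ A then C i ω else 0) := by
    refine @measurable_pi_lambda _ _ _ (_) _ _ fun i => ?_
    by_cases hi : i ∈ A
    · simpa only [hi, if_true] using measurable_iSup_comap (f := C) (Finset.mem_coe.2 hi)
    · simpa only [hi, if_false] using measurable_const
  have hu' : Measurable (fun ω i => if i ∈ A then C i ω else 0) :=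
    hu.mono (iSup₂_le fun i _ => (hC i).comap_le) le_rfl
  have hv : Measurable[⨆ i ∈ ({b} : Set ι), MeasurableSpace.comap (C i) inferInstance] (C b) :=
    measurable_iSup_comap (f := C) (Set.mem_singleton b)
  have hi := iIndepFun.indepFun_of_measurable_iSup hC hind
    (Set.disjoint_singleton_right.2 (by simpa using hb)) hu hv
  rw [(indepFun_iff_map_prod_eq_prod_map_map hu'.aemeasurable (hC b).aemeasurable).1 hi, hlaw]

theorem measurable_restrict (hC : ∀ i, Measurable (C i)) (A : Finset ι) :
    Measurable (fun ω i => if i ∈ A then C i ω else 0) := by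
  refine measurable_pi_lambda _ fun i => ?_
  by_cases hi : i ∈ A
  · simpa only [hi, if_true] using hC i
  · simp only [hi, if_false, measurable_const]

/-- By independence and Fubini the subspace may be frozen while the projected vector is integrated,
so the facts about projections to a fixed subspace apply to a random one. -/
theorem lintegral_residual (hC : ∀ i, Measurable (C i))
    (hlaw : ∀ i, μ.map (C i) = gaussianVector N) (hind : iIndepFun C μ) {A : Finset ι} {b : ι}
    (hb : b ∉ A) {f : ℝ → ℝ≥0∞} (hf : Measurable f) :
    ∫⁻ ω, f (‖(Submodule.span ℂ ((fun i => C i ω) '' A))ᗮ.starProjection (C b ω)‖ ^ 2) ∂μ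
      = ∫⁻ ω, ∫⁻ x, f (‖(Submodule.span ℂ ((fun i => C i ω) '' A))ᗮ.starProjection x‖ ^ 2)
          ∂gaussianVector N ∂μ := by
  have hg : Measurable fun p : (ι → EuclideanSpace ℂ (Fin N)) × EuclideanSpace ℂ (Fin N) =>
      f (‖(Submodule.span ℂ (p.1 '' A))ᗮ.starProjection p.2‖ ^ 2) :=
    hf.comp ((measurable_starProjection_orthogonal_span A).norm.pow_const 2)
  have h := lintegral_map (μ := μ) hg ((measurable_restrict hC A).prodMk (hC b))
  rw [map_restrict_prod_eq hC hlaw hind hb, lintegral_prod _ hg.aemeasurable,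
    lintegral_map hg.lintegral_prod_right' (measurable_restrict hC A)] at h
  simp only [image_restrict] at h
  exact h.symm

/-- At most `N` members of a Gaussian family in `ℂ^N` are linearly independent. -/
theorem ae_finrank_span_image (hC : ∀ i, Measurable (C i))
    (hlaw : ∀ i, μ.map (C i) = gaussianVector N) (hind : iIndepFun C μ) (A : Finset ι)
    (hA : A.card ≤ N) :
    ∀ᵐ ω ∂μ, Module.finrank ℂ (Submodule.span ℂ ((fun i => C i ω) '' A)) = A.card := by
  induction A using Finset.induction_on with
  | empty => simp
  | insert a A ha ih =>
    rw [Finset.card_insert_of_notMem ha] at hA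
    -- This integral is the probability that the new vector lies in the span of the others. It
    -- vanishes because that span has dimension below `N` and is independent of the vector.
    have h0 : ∫⁻ ω, Set.indicator {0} 1
        (‖(Submodule.span ℂ ((fun i => C i ω) '' A))ᗮ.starProjection (C a ω)‖ ^ 2) ∂μ = 0 := by
      rw [lintegral_residual hC hlaw hind ha (measurable_one.indicator (measurableSet_singleton 0))]
      refine lintegral_eq_zero_of_ae_eq_zero (ae_of_all _ fun ω => ?_)
      have hK := gaussianVector_submodule (Submodule.span ℂ ((fun i => C i ω) '' A))
        ((finrank_span_image_le A ω).trans_lt hA)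
      refine lintegral_eq_zero_of_ae_eq_zero ?_
      filter_upwards [measure_eq_zero_iff_ae_notMem.1 hK] with x hx
      simp only [Pi.zero_apply, Set.indicator_apply_eq_zero, Set.mem_singleton_iff]
      intro h
      refine absurd ?_ hx
      rw [pow_eq_zero_iff two_ne_zero, norm_eq_zero, Submodule.starProjection_apply_eq_zero_iff,
        Submodule.orthogonal_orthogonal] at h
      exact h
    have hm : Measurable fun ω => Set.indicator {0} (1 : ℝ → ℝ≥0∞)
        (‖(Submodule.span ℂ ((fun i => C i ω) '' A))ᗮ.starProjection (C a ω)‖ ^ 2) :=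
      (measurable_one.indicator (measurableSet_singleton 0)).comp
        (((measurable_starProjection_orthogonal_span A).comp
          ((measurable_pi_iff.2 hC).prodMk (hC a))).norm.pow_const 2)
    filter_upwards [ih (by omega), (lintegral_eq_zero_iff hm).1 h0] with ω h1 h2
    rw [Finset.card_insert_of_notMem ha]
    refine le_antisymm ?_ ?_
    · have := finrank_span_image_le (C := C) (insert a A) ω
      rwa [Finset.card_insert_of_notMem ha] at this
    rw [← h1]
    refine Submodule.finrank_lt_finrank_of_lt (lt_of_le_of_ne (Submodule.span_mono
      (Set.image_mono (by simp))) fun heq => ?_)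
    have hmem : C a ω ∈ Submodule.span ℂ ((fun i => C i ω) '' A) := by
      rw [heq]
      exact Submodule.subset_span ⟨a, by simp, rfl⟩
    have hz : (Submodule.span ℂ ((fun i => C i ω) '' A))ᗮ.starProjection (C a ω) = 0 := by
      rw [Submodule.starProjection_apply_eq_zero_iff, Submodule.orthogonal_orthogonal]
      exact hmem
    rw [hz] at h2
    simp at h2

theorem ae_finrank_orthogonal (hC : ∀ i, Measurable (C i))
    (hlaw : ∀ i, μ.map (C i) = gaussianVector N) (hind : iIndepFun C μ) (A : Finset ι)
    (hA : A.card ≤ N) :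
    ∀ᵐ ω ∂μ, Module.finrank ℂ (Submodule.span ℂ ((fun i => C i ω) '' A))ᗮ = N - A.card := by
  filter_upwards [ae_finrank_span_image hC hlaw hind A hA] with ω hω
  have h1 := Submodule.finrank_add_finrank_orthogonal (Submodule.span ℂ ((fun i => C i ω) '' A))
  rw [finrank_euclideanSpace_fin] at h1
  omega

theorem lintegral_residual_eq (hC : ∀ i, Measurable (C i))
    (hlaw : ∀ i, μ.map (C i) = gaussianVector N) (hind : iIndepFun C μ) {A : Finset ι} {b : ι}
    (hb : b ∉ A) (hA : A.card ≤ N) :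
    ∫⁻ ω, ENNReal.ofReal
        (‖(Submodule.span ℂ ((fun i => C i ω) '' A))ᗮ.starProjection (C b ω)‖ ^ 2) ∂μ
      = (N - A.card : ℕ) := by
  rw [lintegral_residual hC hlaw hind hb ENNReal.measurable_ofReal]
  simp_rw [lintegral_norm_sq_starProjection_eq_finrank]
  rw [lintegral_congr_ae (g := fun _ => ((N - A.card : ℕ) : ℝ≥0∞))]
  · simp
  · filter_upwards [ae_finrank_orthogonal hC hlaw hind A hA] with ω hω
    rw [hω]

theorem lintegral_inv_residual_eq (hC : ∀ i, Measurable (C i))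
    (hlaw : ∀ i, μ.map (C i) = gaussianVector N) (hind : iIndepFun C μ) {A : Finset ι} {b : ι}
    (hb : b ∉ A) (hA : A.card + 2 ≤ N) :
    ∫⁻ ω, (ENNReal.ofReal
        (‖(Submodule.span ℂ ((fun i => C i ω) '' A))ᗮ.starProjection (C b ω)‖ ^ 2))⁻¹ ∂μ
      = ENNReal.ofReal ((N : ℝ) - A.card - 1)⁻¹ := by
  rw [lintegral_residual (f := fun x => (ENNReal.ofReal x)⁻¹) hC hlaw hind hb (by fun_prop),
    lintegral_congr_ae (g := fun _ => ENNReal.ofReal ((N : ℝ) - A.card - 1)⁻¹)]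
  · simp
  · filter_upwards [ae_finrank_orthogonal hC hlaw hind A (by omega)] with ω hω
    rw [lintegral_inv_norm_sq_starProjection _ (by omega), hω, Nat.cast_sub (by omega)]

theorem exp_neg_le_measure_residual (hC : ∀ i, Measurable (C i))
    (hlaw : ∀ i, μ.map (C i) = gaussianVector N) (hind : iIndepFun C μ) {A : Finset ι} {b : ι}
    (hb : b ∉ A) (hA : A.card < N) {y : ℝ} (hy : 0 ≤ y) :
    ENNReal.ofReal (Real.exp (-y)) ≤ μ {ω | y <
      ‖(Submodule.span ℂ ((fun i => C i ω) '' A))ᗮ.starProjection (C b ω)‖ ^ 2} := by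
  have hind1 : Measurable ((Set.Ioi y).indicator (1 : ℝ → ℝ≥0∞)) :=
    measurable_one.indicator measurableSet_Ioi
  have h := lintegral_residual hC hlaw hind hb hind1
  have hmeas : Measurable fun ω =>
      ‖(Submodule.span ℂ ((fun i => C i ω) '' A))ᗮ.starProjection (C b ω)‖ ^ 2 :=
    ((measurable_starProjection_orthogonal_span A).comp
      ((measurable_pi_iff.2 hC).prodMk (hC b))).norm.pow_const 2
  have e1 : μ {ω | y <
      ‖(Submodule.span ℂ ((fun i => C i ω) '' A))ᗮ.starProjection (C b ω)‖ ^ 2}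
      = ∫⁻ ω, (Set.Ioi y).indicator 1
        (‖(Submodule.span ℂ ((fun i => C i ω) '' A))ᗮ.starProjection (C b ω)‖ ^ 2) ∂μ := by
    rw [← lintegral_indicator_one (measurableSet_lt measurable_const hmeas)]
    rfl
  rw [e1, h]
  have h1 : ∫⁻ _ : Ω, ENNReal.ofReal (Real.exp (-y)) ∂μ = ENNReal.ofReal (Real.exp (-y)) := by simp
  rw [← h1]
  refine lintegral_mono fun ω => ?_
  set L := (Submodule.span ℂ ((fun i => C i ω) '' A))ᗮ
  -- Fewer than `N` vectors leave a nonzero complement at every outcome, so generic position is not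
  -- needed here.
  have hL : 1 ≤ Module.finrank ℂ L := by
    have h2 := Submodule.finrank_add_finrank_orthogonal
      (Submodule.span ℂ ((fun i => C i ω) '' A))
    rw [finrank_euclideanSpace_fin] at h2
    have h3 := finrank_span_image_le (C := C) A ω
    change 1 ≤ Module.finrank ℂ (Submodule.span ℂ ((fun i => C i ω) '' A))ᗮ
    omega
  refine (exp_neg_le_gaussianVector_norm_sq_starProjection L hL hy).trans (le_of_eq ?_)
  rw [← lintegral_indicator_one (measurableSet_lt measurable_const (by fun_prop))]
  rfl

end GaussianFamily

theorem starProjection_orthogonal_congr {E : Type*} [NormedAddCommGroup E] [InnerProductSpace ℂ E]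
    [FiniteDimensional ℂ E] {K K' : Submodule ℂ E} (h : K = K') (x : E) :
    Kᗮ.starProjection x = K'ᗮ.starProjection x := by
  subst h
  rfl

/-! ### The combiner is independent of the interference that is not canceled -/

section UnitCombiner

variable {Ω : Type*} [MeasurableSpace Ω] {μ : Measure Ω} [IsProbabilityMeasure μ]
  {N : ℕ}

/-- The part of the vector with index `b` that is orthogonal to the vectors with indices in `A`. -/
def residual (A : Finset (ℕ × ℕ)) (b : ℕ × ℕ) (w : ℕ × ℕ → EuclideanSpace ℂ (Fin N)) :
    EuclideanSpace ℂ (Fin N) :=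
  (Submodule.span ℂ (w '' A))ᗮ.starProjection (w b)

/-- The normalized residual, replaced by the unit vector `e` where it vanishes. -/
def unitResidual (e : EuclideanSpace ℂ (Fin N)) (A : Finset (ℕ × ℕ)) (b : ℕ × ℕ)
    (w : ℕ × ℕ → EuclideanSpace ℂ (Fin N)) : EuclideanSpace ℂ (Fin N) :=
  open Classical in
  if residual A b w = 0 then e else ((‖residual A b w‖⁻¹ : ℝ) : ℂ) • residual A b w

theorem norm_unitResidual {e : EuclideanSpace ℂ (Fin N)} (he : ‖e‖ = 1) (A : Finset (ℕ × ℕ))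
    (b : ℕ × ℕ) (w : ℕ × ℕ → EuclideanSpace ℂ (Fin N)) : ‖unitResidual e A b w‖ = 1 := by
  unfold unitResidual
  split_ifs with h
  · exact he
  · rw [norm_smul]
    simp [h]

theorem measurable_residual (A : Finset (ℕ × ℕ)) (b : ℕ × ℕ) :
    Measurable fun w : ℕ × ℕ → EuclideanSpace ℂ (Fin N) => residual A b w := by
  have h : Measurable fun w : ℕ × ℕ → EuclideanSpace ℂ (Fin N) => (w, w b) :=
    measurable_id.prodMk (measurable_pi_apply b)
  have h2 := (measurable_starProjection_orthogonal_span (E := EuclideanSpace ℂ (Fin N)) A).comp h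
  simp only [Function.comp_def] at h2
  unfold residual
  exact h2

theorem measurable_unitResidual (e : EuclideanSpace ℂ (Fin N)) (A : Finset (ℕ × ℕ)) (b : ℕ × ℕ) :
    Measurable (unitResidual e A b) := by
  unfold unitResidual
  have h := measurable_residual (N := N) A b
  exact Measurable.ite (h (measurableSet_singleton 0)) measurable_const
    ((Complex.measurable_ofReal.comp h.norm.inv).smul h)

theorem residual_congr {A : Finset (ℕ × ℕ)} {b : ℕ × ℕ}
    {w w' : ℕ × ℕ → EuclideanSpace ℂ (Fin N)} (h : ∀ p ∈ insert b A, w p = w' p) :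
    residual A b w = residual A b w' := by
  unfold residual
  rw [h b (Finset.mem_insert_self b A)]
  refine starProjection_orthogonal_congr ?_ _
  rw [Set.image_congr (g := w') fun p hp => h p (Finset.mem_insert_of_mem hp)]

theorem unitResidual_congr {e : EuclideanSpace ℂ (Fin N)} {A : Finset (ℕ × ℕ)} {b : ℕ × ℕ}
    {w w' : ℕ × ℕ → EuclideanSpace ℂ (Fin N)} (h : ∀ p ∈ insert b A, w p = w' p) :
    unitResidual e A b w = unitResidual e A b w' := by
  simp only [unitResidual, residual_congr h]

/-- The normalized residual is a function of vectors of nodes up to `c`, hence independent of all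
later nodes. Replacing a vanishing residual by `e` makes it a unit vector at every outcome, so
unitary invariance applies without exception. -/
theorem map_inner_unitResidual {C : ℕ × ℕ → Ω → EuclideanSpace ℂ (Fin N)}
    (hC : ∀ i, Measurable (C i)) (hlaw : ∀ i, μ.map (C i) = gaussianVector N)
    (hind : iIndepFun C μ) {A : Finset (ℕ × ℕ)} {b : ℕ × ℕ} {c : ℕ}
    (hA : ∀ p ∈ insert b A, p.1 ≤ c) {e : EuclideanSpace ℂ (Fin N)} (he : ‖e‖ = 1) :
    μ.map (fun ω => (fun p => if p ∈ insert b A then C p ω else 0,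
        fun p : ℕ × ℕ => inner ℂ (unitResidual e A b fun p => C p ω) (C (c + 1 + p.1, p.2) ω)))
      = (μ.map fun ω p => if p ∈ insert b A then C p ω else 0).prod
          (Measure.infinitePi fun _ : ℕ × ℕ => complexGaussian) := by
  set W : Ω → ℕ × ℕ → EuclideanSpace ℂ (Fin N) :=
    fun ω p => if p ∈ insert b A then C p ω else 0 with hW
  set V : Ω → ℕ × ℕ → EuclideanSpace ℂ (Fin N) := fun ω p => C (c + 1 + p.1, p.2) ω with hV
  have hWm : Measurable W := measurable_restrict hC _
  have hVm : Measurable V := measurable_pi_lambda _ fun p => hC _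
  have hWi : Measurable[⨆ i ∈ (insert b A : Set (ℕ × ℕ)),
      MeasurableSpace.comap (C i) inferInstance] W := by
    refine @measurable_pi_lambda _ _ _ (_) _ _ fun i => ?_
    by_cases hi : i ∈ insert b A
    · simp only [hW, hi, if_true]
      exact measurable_iSup_comap (f := C) (S := insert b A) (by simpa using hi)
    · simp only [hW, hi, if_false]
      exact measurable_const
  have hVi : Measurable[⨆ i ∈ {p : ℕ × ℕ | c < p.1},
      MeasurableSpace.comap (C i) inferInstance] V := by
    refine @measurable_pi_lambda _ _ _ (_) _ _ fun p => ?_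
    exact measurable_iSup_comap (f := C) (S := {p : ℕ × ℕ | c < p.1})
      (show c < c + 1 + p.1 by omega)
  have hdisj : Disjoint (insert b A : Set (ℕ × ℕ)) {p : ℕ × ℕ | c < p.1} := by
    rw [Set.disjoint_left]
    intro p hp hp2
    exact absurd (hA p (by simpa using hp)) (not_le.2 hp2)
  have hWV := (indepFun_iff_map_prod_eq_prod_map_map hWm.aemeasurable hVm.aemeasurable).1
    (iIndepFun.indepFun_of_measurable_iSup hC hind hdisj hWi hVi)
  have hVlaw : μ.map V = Measure.infinitePi fun _ : ℕ × ℕ => gaussianVector N := by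
    have h1 : iIndepFun (fun p : ℕ × ℕ => C (c + 1 + p.1, p.2)) μ :=
      hind.precomp (g := fun p : ℕ × ℕ => (c + 1 + p.1, p.2)) fun p q hpq => by
        simp only [Prod.mk.injEq] at hpq
        exact Prod.ext (by omega) hpq.2
    rw [h1.map_fun_eq_infinitePi_map fun p => hC _]
    simp_rw [hlaw]
  -- For each frozen `w`, taking inner products with one unit vector turns i.i.d. Gaussian vectors
  -- into i.i.d. `CN(0,1)` variables. Their law is the same for every `w`, so this skew product maps
  -- a product measure to a product measure.
  have hsk : MeasurePreserving
      (fun p : (ℕ × ℕ → EuclideanSpace ℂ (Fin N)) × (ℕ × ℕ → EuclideanSpace ℂ (Fin N)) =>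
        (p.1, fun i : ℕ × ℕ => inner ℂ (unitResidual e A b p.1) (p.2 i)))
      ((μ.map W).prod (Measure.infinitePi fun _ : ℕ × ℕ => gaussianVector N))
      ((μ.map W).prod (Measure.infinitePi fun _ : ℕ × ℕ => complexGaussian)) := by
    have := Measure.isProbabilityMeasure_map (μ := μ) hWm.aemeasurable
    refine (MeasurePreserving.id _).skew_product
      (g := fun w (v : ℕ × ℕ → EuclideanSpace ℂ (Fin N)) =>
      fun i : ℕ × ℕ => inner ℂ (unitResidual e A b w) (v i)) ?_ (ae_of_all _ fun w => ?_)
    · refine measurable_pi_lambda _ fun i => ?_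
      exact ((measurable_unitResidual e A b).comp measurable_fst).inner
        ((measurable_pi_apply i).comp measurable_snd)
    · have := Measure.infinitePi_map_pi (fun _ : ℕ × ℕ => gaussianVector N)
        (f := fun _ x => inner ℂ (unitResidual e A b w) x) (fun _ => by fun_prop)
      rw [this]
      simp_rw [gaussianVector_map_inner (norm_unitResidual he A b w)]
  rw [← hsk.map_eq, ← hVlaw, ← hWV, Measure.map_map hsk.measurable (hWm.prodMk hVm)]
  congr 1
  funext ω
  simp only [Function.comp_apply, hV]
  rw [unitResidual_congr (w := fun p => C p ω) (w' := W ω)]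
  intro p hp
  simp only [hW, hp, if_true]

end UnitCombiner

/-! ### Combiner and signal power as functions of the residual -/

section NulledIndex

variable {Ω : Type*} {h : ℕ → ℕ → ℕ → Ω → ℂ}

/-- The indices (node, stream) of the channel vectors that are zero-forced. -/
def nulledIndex (k c l : ℕ) : Finset (ℕ × ℕ) :=
  ((Finset.range k).erase l).image (Prod.mk 0) ∪ Finset.Icc 1 c ×ˢ Finset.range k

theorem card_nulledIndex {k c l : ℕ} (hl : l < k) :
    (nulledIndex k c l).card = k - 1 + k * c := by
  rw [nulledIndex, Finset.card_union_of_disjoint, Finset.card_image_of_injective _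
    (Prod.mk_right_injective 0), Finset.card_erase_of_mem (Finset.mem_range.2 hl),
    Finset.card_product, Finset.card_range, Nat.card_Icc, Nat.add_sub_cancel, mul_comm]
  rw [Finset.disjoint_left]
  intro p hp hp2
  simp only [Finset.mem_image, Finset.mem_product, Finset.mem_Icc] at hp hp2
  obtain ⟨j, _, rfl⟩ := hp
  simp at hp2

theorem notMem_nulledIndex (k c l : ℕ) : (0, l) ∉ nulledIndex k c l := by
  simp [nulledIndex]

theorem fst_le_of_mem_nulledIndex {k c l : ℕ} : ∀ p ∈ insert (0, l) (nulledIndex k c l),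
    p.1 ≤ c := by
  intro p hp
  simp only [nulledIndex, Finset.mem_insert, Finset.mem_union, Finset.mem_image,
    Finset.mem_product, Finset.mem_Icc] at hp
  rcases hp with rfl | ⟨j, _, rfl⟩ | hp
  · simp
  · simp
  · omega

theorem nulledSpace_eq (N k c l : ℕ) (ω : Ω) :
    nulledSpace h N k c l ω
      = Submodule.span ℂ ((fun p : ℕ × ℕ => column h N p.1 p.2 ω) '' nulledIndex k c l) := by
  unfold nulledSpace
  congr 1
  ext v
  simp only [nulledIndex, Set.mem_union, Set.mem_ofPred_eq, Set.mem_image, Finset.coe_union,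
    Finset.coe_image, Finset.coe_product, Set.mem_prod, Finset.mem_coe, Finset.mem_erase,
    Finset.mem_range, Finset.mem_Icc]
  constructor
  · rintro (⟨j, hj, hjl, rfl⟩ | ⟨n, hn, j, hj, rfl⟩)
    · exact ⟨(0, j), Or.inl ⟨j, ⟨hjl, hj⟩, rfl⟩, rfl⟩
    · exact ⟨(n + 1, j), Or.inr ⟨⟨by omega, by omega⟩, hj⟩, rfl⟩
  · rintro ⟨p, ⟨j, ⟨hjl, hj⟩, rfl⟩ | ⟨⟨h1, h2⟩, hj⟩, rfl⟩
    · exact Or.inl ⟨j, hj, hjl, rfl⟩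
    · exact Or.inr ⟨p.1 - 1, by omega, p.2, hj, by rw [Nat.sub_add_cancel h1]⟩

/-- For the projection `Px` of `x` one has `⟨Px, x⟩ = ‖Px‖²`, and normalizing divides by `‖Px‖`. If
`Px = 0`, the convention `0⁻¹ = 0` makes both sides zero. -/
theorem signalPower_eq (N k c l : ℕ) (ω : Ω) :
    signalPower h N k c l ω
      = ‖residual (nulledIndex k c l) (0, l) fun p => column h N p.1 p.2 ω‖ ^ 2 := by
  have hres : (nulledSpace h N k c l ω)ᗮ.starProjection (column h N 0 l ω)
      = (Submodule.span ℂ ((fun p : ℕ × ℕ => column h N p.1 p.2 ω) ''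
          nulledIndex k c l))ᗮ.starProjection (column h N 0 l ω) :=
    starProjection_orthogonal_congr (nulledSpace_eq N k c l ω) _
  unfold signalPower combiner residual
  rw [hres]
  set L := (Submodule.span ℂ
    ((fun p : ℕ × ℕ => column h N p.1 p.2 ω) '' nulledIndex k c l))ᗮ
  change _ = ‖L.starProjection (column h N 0 l ω)‖ ^ 2
  set x := column h N 0 l ω
  change ‖inner ℂ (((‖L.starProjection x‖⁻¹ : ℝ) : ℂ) • L.starProjection x) x‖ ^ 2 = _
  have h1 : inner ℂ (L.starProjection x) x = ((‖L.starProjection x‖ ^ 2 : ℝ) : ℂ) := by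
    have h2 : inner ℂ (L.starProjection x) x =
        inner ℂ (L.starProjection x) (L.starProjection x) := by
      rw [← Submodule.inner_starProjection_left_eq_right,
        Submodule.starProjection_eq_self_iff.2 (Submodule.starProjection_apply_mem L x)]
    rw [h2, inner_self_eq_norm_sq_to_K]
    simp
  rw [inner_smul_left, h1, Complex.conj_ofReal, ← Complex.ofReal_mul, Complex.norm_real,
    Real.norm_eq_abs, sq_abs]
  rcases eq_or_ne (L.starProjection x) 0 with h0 | h0
  · simp [h0]
  · have : ‖L.starProjection x‖ ≠ 0 := by simpa using h0
    field_simp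

/-- The actual combiner is zero when the residual vanishes, whereas the auxiliary unit vector is
`e`. They agree off the event of zero signal power, which is null by `ae_signalPower_pos` when a
degree of freedom is left. -/
theorem combiner_eq {N k c l : ℕ} {ω : Ω} (hs : signalPower h N k c l ω ≠ 0)
    (e : EuclideanSpace ℂ (Fin N)) :
    combiner h N k c l ω
      = unitResidual e (nulledIndex k c l) (0, l) fun p => column h N p.1 p.2 ω := by
  have h0 : residual (nulledIndex k c l) (0, l) (fun p => column h N p.1 p.2 ω) ≠ 0 := by
    intro h0
    rw [signalPower_eq, h0] at hs
    simp at hs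
  rw [unitResidual, if_neg h0, combiner,
    starProjection_orthogonal_congr (nulledSpace_eq N k c l ω)]
  rfl

end NulledIndex

theorem measurable_column {Ω : Type*} [MeasurableSpace Ω] {μ : Measure Ω}
    {T : ℝ → ℕ → Ω → Plane} {h : ℕ → ℕ → ℕ → Ω → ℂ} (hnet : IsNetwork μ T h) (N : ℕ) (p : ℕ × ℕ) :
    Measurable (column h N p.1 p.2) :=
  (WithLp.measurable_toLp 2 _).comp
    (measurable_pi_lambda _ fun i => hnet.measurable_fading p.1 i p.2)

theorem measurable_signalPower {Ω : Type*} [MeasurableSpace Ω] {μ : Measure Ω}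
    {T : ℝ → ℕ → Ω → Plane} {h : ℕ → ℕ → ℕ → Ω → ℂ} (hnet : IsNetwork μ T h) (N k c l : ℕ) :
    Measurable (signalPower h N k c l) := by
  have : signalPower h N k c l = fun ω => ‖residual (nulledIndex k c l) (0, l)
      fun p => column h N p.1 p.2 ω‖ ^ 2 := funext fun ω => signalPower_eq N k c l ω
  rw [this]
  exact ((measurable_residual _ _).comp
    (measurable_pi_lambda _ (measurable_column hnet N))).norm.pow_const 2

/-! ### Laws of signal power and fading in the network -/

section Network

variable {Ω : Type*} [MeasurableSpace Ω] {μ : Measure Ω} [IsProbabilityMeasure μ]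
  {T : ℝ → ℕ → Ω → Plane} {h : ℕ → ℕ → ℕ → Ω → ℂ}

theorem iIndepFun_column (hnet : IsNetwork μ T h) (N : ℕ) :
    iIndepFun (fun p : ℕ × ℕ => column h N p.1 p.2) μ := by
  have h1 : iIndepFun (fun (p : (ℕ × ℕ) × Fin N) => h p.1.1 p.2 p.1.2) μ :=
    hnet.fading_indep.precomp (g := fun p : (ℕ × ℕ) × Fin N => (p.1.1, (p.2 : ℕ), p.1.2))
      fun p q hpq => by
        simp only [Prod.mk.injEq] at hpq
        exact Prod.ext (Prod.ext hpq.1 hpq.2.2) (Fin.ext hpq.2.1)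
  have h2 := iIndepFun_curry (fun p => hnet.measurable_fading _ _ _) h1
  exact h2.comp (fun _ => WithLp.toLp 2) fun _ => WithLp.measurable_toLp 2 _

theorem map_column (hnet : IsNetwork μ T h) (N : ℕ) (p : ℕ × ℕ) :
    μ.map (column h N p.1 p.2) = gaussianVector N := by
  have h1 : iIndepFun (fun i : Fin N => h p.1 i p.2) μ :=
    hnet.fading_indep.precomp (g := fun i : Fin N => (p.1, (i : ℕ), p.2))
      fun i j hij => by
        simp only [Prod.mk.injEq] at hij
        exact Fin.ext hij.2.1
  have h2 := (iIndepFun_iff_map_fun_eq_pi_map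
    fun i => (hnet.measurable_fading p.1 _ p.2).aemeasurable).1 h1
  simp_rw [hnet.fading_law] at h2
  rw [gaussianVector, ← h2, Measure.map_map (by fun_prop)
    (measurable_pi_lambda _ fun i => hnet.measurable_fading _ _ _)]
  rfl

/-- The joint law of the locations, the signal power and the fading of the interferers that are not
canceled: the three are independent, and the interferers have i.i.d. `CN(0,1)` coefficients. -/
theorem exists_fading (hnet : IsNetwork μ T h) {N k c l : ℕ} (hN : 0 < N) :
    ∃ X : ℕ × ℕ → Ω → ℂ, (∀ p, Measurable (X p)) ∧ (∀ p, μ.map (X p) = complexGaussian) ∧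
      iIndepFun X μ ∧ IndepFun (signalPower h N k c l) (fun ω p => X p ω) μ ∧
      (∀ lam : ℝ, 0 < lam → IndepFun (fun ω n => T lam n ω)
        (fun ω => (signalPower h N k c l ω, fun p => X p ω)) μ) ∧
      ∀ ω, signalPower h N k c l ω ≠ 0 → ∀ i, interfererPower h N k c l (c + i) ω
        = ∑ j ∈ Finset.range k, ‖X (i, j) ω‖ ^ 2 := by
  set e : EuclideanSpace ℂ (Fin N) := EuclideanSpace.single ⟨0, hN⟩ 1
  have he : ‖e‖ = 1 := by simp [e]
  set A := nulledIndex k c l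
  set b : ℕ × ℕ := (0, l)
  set C : ℕ × ℕ → Ω → EuclideanSpace ℂ (Fin N) := fun p => column h N p.1 p.2
  have hC : ∀ p, Measurable (C p) := measurable_column hnet N
  have hmap := map_inner_unitResidual (A := A) (b := b) (c := c) hC (map_column hnet N)
    (iIndepFun_column hnet N)
    fst_le_of_mem_nulledIndex he
  -- The locations are independent of the whole array of coefficients. Writing the channel vectors
  -- as a measurable function of that array transfers this to the signal power and the fading.
  set col : (ℕ × ℕ × ℕ → ℂ) → ℕ × ℕ → EuclideanSpace ℂ (Fin N) :=
    fun H p => WithLp.toLp 2 fun i : Fin N => H (p.1, (i : ℕ), p.2)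
  have hcol : Measurable col := by
    refine measurable_pi_lambda _ fun p => (WithLp.measurable_toLp 2 _).comp ?_
    exact measurable_pi_lambda _ fun i => measurable_pi_apply _
  set X : ℕ × ℕ → Ω → ℂ :=
    fun p ω => inner ℂ (unitResidual e A b fun p => C p ω) (C (c + 1 + p.1, p.2) ω) with hX
  have hCm : Measurable fun ω p => C p ω := measurable_pi_lambda _ hC
  have hXm : ∀ p, Measurable (X p) := fun p =>
    ((measurable_unitResidual e A b).comp hCm).inner (hC _)
  set W := fun ω p => if p ∈ insert b A then C p ω else 0 with hWdef
  have hWm : Measurable W := measurable_restrict hC _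
  have hXm' : Measurable fun ω p => X p ω := measurable_pi_lambda _ hXm
  have hXlaw : μ.map (fun ω p => X p ω) = Measure.infinitePi fun _ : ℕ × ℕ => complexGaussian := by
    have := congrArg (Measure.map Prod.snd) hmap
    rw [Measure.map_map measurable_snd (hWm.prodMk hXm'), Measure.map_snd_prod] at this
    have hp := Measure.isProbabilityMeasure_map (μ := μ) hWm.aemeasurable
    rw [measure_univ, one_smul] at this
    exact this
  have hXp : ∀ p, μ.map (X p) = complexGaussian := by
    intro p
    rw [← (measurePreserving_eval_infinitePi (fun _ : ℕ × ℕ => complexGaussian) p).map_eq, ← hXlaw,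
      Measure.map_map (measurable_pi_apply p) hXm']
    rfl
  have hsW : signalPower h N k c l = (fun w => ‖residual A b w‖ ^ 2) ∘ W := by
    funext ω
    rw [signalPower_eq, Function.comp_apply, residual_congr]
    intro p hp
    simp only [hWdef]
    rw [if_pos hp]
  refine ⟨X, hXm, hXp, ?_, ?_, ?_, ?_⟩
  · rw [iIndepFun_iff_map_fun_eq_infinitePi_map hXm, hXlaw]
    simp_rw [hXp]
  · have hWX : IndepFun W (fun ω p => X p ω) μ := by
      rw [indepFun_iff_map_prod_eq_prod_map_map hWm.aemeasurable hXm'.aemeasurable, hXlaw]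
      exact hmap
    rw [hsW]
    exact hWX.comp ((measurable_residual A b).norm.pow_const 2) measurable_id
  · intro lam hlam
    have hG : Measurable fun H : ℕ × ℕ × ℕ → ℂ => (‖residual A b (col H)‖ ^ 2,
        fun p : ℕ × ℕ => inner ℂ (unitResidual e A b (col H)) (col H (c + 1 + p.1, p.2))) := by
      refine (((measurable_residual A b).comp hcol).norm.pow_const 2).prodMk ?_
      refine measurable_pi_lambda _ fun p => ?_
      exact ((measurable_unitResidual e A b).comp hcol).inner
        ((measurable_pi_apply _).comp hcol)
    have := (hnet.indep lam hlam).comp measurable_id hG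
    refine this.congr (ae_of_all _ fun ω => rfl) (ae_of_all _ fun ω => ?_)
    simp only [Function.comp_apply]
    rw [signalPower_eq]
    rfl
  · intro ω hω i
    unfold interfererPower
    refine Finset.sum_congr rfl fun j _ => ?_
    rw [combiner_eq hω e]
    simp only [hX, C, show c + 1 + i = c + i + 1 by omega]
    rfl

theorem lintegral_signalPower (hnet : IsNetwork μ T h) {N k c l : ℕ} (hl : l < k)
    (hN : k - 1 + k * c ≤ N) :
    ∫⁻ ω, ENNReal.ofReal (signalPower h N k c l ω) ∂μ = (N - (k - 1 + k * c) : ℕ) := by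
  have := lintegral_residual_eq (measurable_column hnet N) (map_column hnet N)
    (iIndepFun_column hnet N) (notMem_nulledIndex k c l) (by rwa [card_nulledIndex hl])
  rw [card_nulledIndex hl] at this
  simp_rw [signalPower_eq]
  exact this

theorem lintegral_inv_signalPower (hnet : IsNetwork μ T h) {N k c l : ℕ} (hl : l < k)
    (hN : k - 1 + k * c + 2 ≤ N) :
    ∫⁻ ω, (ENNReal.ofReal (signalPower h N k c l ω))⁻¹ ∂μ
      = ENNReal.ofReal ((N : ℝ) - (k - 1 + k * c : ℕ) - 1)⁻¹ := by
  have := lintegral_inv_residual_eq (measurable_column hnet N) (map_column hnet N)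
    (iIndepFun_column hnet N) (notMem_nulledIndex k c l) (by rwa [card_nulledIndex hl])
  rw [card_nulledIndex hl] at this
  simp_rw [signalPower_eq]
  exact this

theorem exp_neg_le_measure_signalPower (hnet : IsNetwork μ T h) {N k c l : ℕ} (hl : l < k)
    (hN : k - 1 + k * c < N) {y : ℝ} (hy : 0 ≤ y) :
    ENNReal.ofReal (Real.exp (-y)) ≤ μ {ω | y < signalPower h N k c l ω} := by
  have := exp_neg_le_measure_residual (measurable_column hnet N) (map_column hnet N)
    (iIndepFun_column hnet N) (notMem_nulledIndex k c l) (by rwa [card_nulledIndex hl]) hy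
  simp_rw [signalPower_eq]
  exact this

theorem ae_signalPower_pos (hnet : IsNetwork μ T h) {N k c l : ℕ} (hl : l < k)
    (hN : k - 1 + k * c < N) : ∀ᵐ ω ∂μ, 0 < signalPower h N k c l ω := by
  have h1 := exp_neg_le_measure_signalPower hnet hl hN le_rfl
  simp only [neg_zero, Real.exp_zero, ENNReal.ofReal_one] at h1
  have hm : MeasurableSet {ω | 0 < signalPower h N k c l ω} :=
    measurableSet_lt measurable_const (measurable_signalPower hnet N k c l)
  exact (mem_ae_iff_prob_eq_one hm).2 (le_antisymm prob_le_one h1)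

end Network

/-! ### Distances in a sorted Poisson process -/

/-- The probability that a Poisson variable of mean `x` is at most `n`. -/
def poissonTail (n : ℕ) (x : ℝ) : ℝ :=
  ∑ j ∈ Finset.range (n + 1), Real.exp (-x) * x ^ j / (j.factorial : ℝ)

/-- The derivatives of the summands telescope, leaving the density of the Gamma law of shape `n +
1`. -/
theorem hasDerivAt_neg_poissonTail (n : ℕ) (x : ℝ) :
    HasDerivAt (fun t => -poissonTail n t) (Real.exp (-x) * x ^ n / (n.factorial : ℝ)) x := by
  have hexp : HasDerivAt (fun t : ℝ => Real.exp (-t)) (-Real.exp (-x)) x := by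
    simpa using (hasDerivAt_id x).neg.exp
  induction n with
  | zero =>
    simp only [poissonTail, zero_add, Finset.sum_range_one, pow_zero, mul_one, Nat.factorial_zero,
      Nat.cast_one, div_one]
    exact hexp.neg.congr_deriv (neg_neg _)
  | succ n ih =>
    have h1 : HasDerivAt (fun t : ℝ => Real.exp (-t) * t ^ (n + 1) / ((n + 1).factorial : ℝ))
        ((-Real.exp (-x) * x ^ (n + 1) + Real.exp (-x) * ((n + 1 : ℕ) * x ^ n))
          / ((n + 1).factorial : ℝ)) x := by
      simpa using (hexp.mul (hasDerivAt_pow (n + 1) x)).div_const _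
    have h2 := ih.sub h1
    have he : (fun t => -poissonTail (n + 1) t)
        = fun t => -poissonTail n t - Real.exp (-t) * t ^ (n + 1) / ((n + 1).factorial : ℝ) := by
      funext t
      rw [poissonTail, Finset.sum_range_succ, ← poissonTail]
      ring
    rw [he]
    refine h2.congr_deriv ?_
    have hf : ((n + 1).factorial : ℝ) = (n + 1 : ℝ) * n.factorial := by
      rw [Nat.factorial_succ]; push_cast; ring
    have h0 : (n.factorial : ℝ) ≠ 0 := by exact_mod_cast n.factorial_ne_zero
    have h3 : (n + 1 : ℝ) ≠ 0 := by positivity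
    rw [hf]
    push_cast
    field_simp
    ring

theorem tendsto_neg_poissonTail (n : ℕ) : Tendsto (fun t => -poissonTail n t) atTop (𝓝 0) := by
  rw [← neg_zero]
  refine Tendsto.neg ?_
  have : (0 : ℝ) = ∑ j ∈ Finset.range (n + 1), 0 / (j.factorial : ℝ) := by simp
  rw [this]
  refine tendsto_finsetSum _ fun j _ => Tendsto.div_const ?_ _
  simpa [mul_comm] using Real.tendsto_pow_mul_exp_neg_atTop_nhds_zero j

theorem lintegral_gamma_Ioi (n : ℕ) {r : ℝ} (hr : 0 ≤ r) :
    ∫⁻ t in Set.Ioi r, ENNReal.ofReal (Real.exp (-t) * t ^ n / (n.factorial : ℝ))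
      = ENNReal.ofReal (poissonTail n r) := by
  have hc : ContinuousWithinAt (fun t => -poissonTail n t) (Set.Ici r) r :=
    (hasDerivAt_neg_poissonTail n r).continuousAt.continuousWithinAt
  have hnn : ∀ x ∈ Set.Ioi r, 0 ≤ Real.exp (-x) * x ^ n / (n.factorial : ℝ) := by
    intro x hx
    have : 0 < x := lt_of_le_of_lt hr hx
    positivity
  have hi := integrableOn_Ioi_deriv_of_nonneg hc (fun x _ => hasDerivAt_neg_poissonTail n x) hnn
    (tendsto_neg_poissonTail n)
  rw [← ofReal_integral_eq_lintegral_ofReal hi ((ae_restrict_iff' measurableSet_Ioi).2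
      (ae_of_all _ hnn)), integral_Ioi_of_hasDerivAt_of_nonneg hc
        (fun x _ => hasDerivAt_neg_poissonTail n x) hnn (tendsto_neg_poissonTail n)]
  simp

/-- For sorted points, the point of index `n`, the `(n+1)`-st nearest, lies outside the closed ball
exactly if the ball holds at most `n` points. This turns counting probabilities into the law of a
distance. -/
theorem lt_norm_iff_exists_pointCount_eq {Ω : Type*} {T : ℕ → Ω → Plane} {ω : Ω}
    (hω : Monotone fun n => ‖T n ω‖) (n : ℕ)
    (r : ℝ) : r < ‖T n ω‖ ↔
      ∃ j ∈ Finset.range (n + 1), pointCount T (Metric.closedBall 0 r) ω = (j : ℝ≥0∞) := by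
  classical
  constructor
  · intro hr
    refine ⟨((Finset.range n).filter fun m => T m ω ∈ Metric.closedBall (0 : Plane) r).card, ?_, ?_⟩
    · rw [Finset.mem_range]
      have := Finset.card_filter_le (Finset.range n)
        fun m => T m ω ∈ Metric.closedBall (0 : Plane) r
      rw [Finset.card_range] at this
      omega
    · rw [pointCount, tsum_eq_sum (s := Finset.range n)]
      · simp only [Set.indicator_apply, Finset.sum_boole]
      · intro m hm
        rw [Finset.mem_range, not_lt] at hm
        refine Set.indicator_of_notMem ?_ _
        rw [mem_closedBall_zero_iff, not_le]
        exact hr.trans_le (hω hm)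
  · rintro ⟨j, hj, hcount⟩
    by_contra hr
    rw [not_lt] at hr
    have h1 : ((n + 1 : ℕ) : ℝ≥0∞) ≤ pointCount T (Metric.closedBall 0 r) ω := by
      refine le_trans (le_of_eq ?_) (ENNReal.sum_le_tsum (Finset.range (n + 1)))
      rw [Finset.sum_congr rfl (g := fun _ => (1 : ℝ≥0∞))]
      · simp
      · intro m hm
        refine Set.indicator_of_mem ?_ _
        rw [mem_closedBall_zero_iff]
        exact (hω (Nat.lt_succ_iff.1 (Finset.mem_range.1 hm))).trans hr
    rw [hcount, Nat.cast_le] at h1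
    rw [Finset.mem_range] at hj
    omega

theorem measurable_pointCount {Ω : Type*} [MeasurableSpace Ω] {T : ℕ → Ω → Plane}
    (hT : ∀ n, Measurable (T n)) {A : Set Plane} (hA : MeasurableSet A) :
    Measurable (pointCount T A) :=
  Measurable.tsum fun n => (measurable_const.indicator hA).comp (hT n)

section Poisson

variable {Ω : Type*} [MeasurableSpace Ω] {μ : Measure Ω} {lam : ℝ} {T : ℕ → Ω → Plane}

theorem measure_lt_norm (hT : IsSortedPoissonProcess μ lam T) (hlam : 0 < lam) (n : ℕ) {r : ℝ}
    (hr : 0 ≤ r) :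
    μ {ω | r < ‖T n ω‖} = ENNReal.ofReal (poissonTail n (Real.pi * lam * r ^ 2)) := by
  have h1 : μ {ω | r < ‖T n ω‖} = μ (⋃ j ∈ Finset.range (n + 1),
      {ω | pointCount T (Metric.closedBall 0 r) ω = (j : ℝ≥0∞)}) := by
    refine measure_congr ?_
    filter_upwards [hT.sorted] with ω hω
    change (r < ‖T n ω‖) = (ω ∈ ⋃ j ∈ Finset.range (n + 1),
      {ω | pointCount T (Metric.closedBall 0 r) ω = (j : ℝ≥0∞)})
    rw [eq_iff_iff, lt_norm_iff_exists_pointCount_eq hω n r, Set.mem_iUnion₂]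
    simp only [Set.mem_ofPred_eq, exists_prop]
  have hvol : volume (Metric.closedBall (0 : Plane) r) = ENNReal.ofReal (Real.pi * r ^ 2) := by
    rw [EuclideanSpace.volume_closedBall_fin_two, mul_comm, ENNReal.ofReal_mul Real.pi_pos.le,
      ENNReal.ofReal_pow hr]
  rw [h1, measure_biUnion_finset]
  · have h2 : ∀ j : ℕ, μ {ω | pointCount T (Metric.closedBall 0 r) ω = (j : ℝ≥0∞)}
        = ENNReal.ofReal (Real.exp (-(Real.pi * lam * r ^ 2)) * (Real.pi * lam * r ^ 2) ^ j
            / (j.factorial : ℝ)) := by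
      intro j
      rw [hT.count_law _ Metric.isClosed_closedBall.measurableSet (by rw [hvol]; simp) j,
        poissonMeasure_singleton]
      have : ((lam.toNNReal * (volume (Metric.closedBall (0 : Plane) r)).toNNReal : ℝ≥0) : ℝ)
          = Real.pi * lam * r ^ 2 := by
        rw [hvol, NNReal.coe_mul, Real.coe_toNNReal _ hlam.le, ENNReal.coe_toNNReal_eq_toReal,
          ENNReal.toReal_ofReal (by positivity)]
        ring
      rw [this]
    simp_rw [h2]
    rw [← ENNReal.ofReal_sum_of_nonneg fun j _ => by positivity, poissonTail]
  · intro i _ j _ hij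
    refine Set.disjoint_left.2 fun ω h1 h2 => hij ?_
    have h3 : (i : ℝ≥0∞) = j := by
      rw [← show pointCount T (Metric.closedBall 0 r) ω = (i : ℝ≥0∞) from h1]
      exact h2
    exact_mod_cast h3
  · intro j _
    exact measurable_pointCount hT.measurable Metric.isClosed_closedBall.measurableSet
      (measurableSet_singleton _)

variable [IsProbabilityMeasure μ]

/-- The normalized squared distance to the `(n+1)`-st nearest point has a Gamma law. -/
theorem map_norm_sq (hT : IsSortedPoissonProcess μ lam T) (hlam : 0 < lam) (n : ℕ) :
    μ.map (fun ω => Real.pi * lam * ‖T n ω‖ ^ 2)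
      = (volume.restrict (Set.Ioi 0)).withDensity
          fun t => ENNReal.ofReal (Real.exp (-t) * t ^ n / (n.factorial : ℝ)) := by
  have hpl : 0 < Real.pi * lam := mul_pos Real.pi_pos hlam
  have hXm : Measurable fun ω => Real.pi * lam * ‖T n ω‖ ^ 2 :=
    ((hT.measurable n).norm.pow_const 2).const_mul _
  have hp := Measure.isProbabilityMeasure_map (μ := μ) hXm.aemeasurable
  set ν := (volume.restrict (Set.Ioi (0 : ℝ))).withDensity
    fun t => ENNReal.ofReal (Real.exp (-t) * t ^ n / (n.factorial : ℝ)) with hν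
  have hX : ∀ r, 0 ≤ r → μ.map (fun ω => Real.pi * lam * ‖T n ω‖ ^ 2) (Set.Ioi r)
      = ENNReal.ofReal (poissonTail n r) := by
    intro r hr
    rw [Measure.map_apply hXm measurableSet_Ioi]
    have h1 : (fun ω => Real.pi * lam * ‖T n ω‖ ^ 2) ⁻¹' Set.Ioi r
        = {ω | √(r / (Real.pi * lam)) < ‖T n ω‖} := by
      ext ω
      rw [Set.mem_preimage, Set.mem_Ioi, Set.mem_ofPred_eq, Real.sqrt_lt (by positivity)
        (norm_nonneg _), div_lt_iff₀ hpl, mul_comm]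
    rw [h1, measure_lt_norm hT hlam n (Real.sqrt_nonneg _), Real.sq_sqrt (by positivity)]
    congr 2
    field_simp
  have hN : ∀ r, 0 ≤ r → ν (Set.Ioi r) = ENNReal.ofReal (poissonTail n r) := by
    intro r hr
    rw [hν, withDensity_apply _ measurableSet_Ioi, Measure.restrict_restrict measurableSet_Ioi,
      Set.inter_eq_self_of_subset_left (Set.Ioi_subset_Ioi hr), lintegral_gamma_Ioi n hr]
  -- Only the term `0 ^ 0 = 1` survives. Hence both measures give full mass to the positive
  -- half-line, which settles the comparison of tails at negative `r`.
  have ht0 : poissonTail n 0 = 1 := by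
    rw [poissonTail, Finset.sum_eq_single 0]
    · simp
    · intro j _ hj
      simp [hj]
    · simp
  have hν1 : IsProbabilityMeasure ν := by
    constructor
    have := hN 0 le_rfl
    rw [ht0, ENNReal.ofReal_one] at this
    rw [← this, hν, withDensity_apply _ MeasurableSet.univ, withDensity_apply _ measurableSet_Ioi,
      Measure.restrict_restrict measurableSet_Ioi, Set.inter_self, Measure.restrict_univ]
  have hall : ∀ r, μ.map (fun ω => Real.pi * lam * ‖T n ω‖ ^ 2) (Set.Ioi r) = ν (Set.Ioi r) := by
    intro r
    rcases le_or_gt 0 r with hr | hr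
    · rw [hX r hr, hN r hr]
    · have e1 : ∀ m : Measure ℝ, IsProbabilityMeasure m →
          m (Set.Ioi 0) = ENNReal.ofReal (poissonTail n 0) → m (Set.Ioi r) = 1 := by
        intro m hm hm0
        rw [ht0, ENNReal.ofReal_one] at hm0
        exact le_antisymm prob_le_one (hm0.ge.trans (measure_mono (Set.Ioi_subset_Ioi hr.le)))
      rw [e1 _ hp (hX 0 le_rfl), e1 _ hν1 (hN 0 le_rfl)]
  refine Measure.ext_of_Iic _ _ fun r => ?_
  rw [← Set.compl_Ioi, prob_compl_eq_one_sub measurableSet_Ioi,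
    prob_compl_eq_one_sub measurableSet_Ioi, hall]

/-- Moments of the distance to the `(n+1)`-st nearest point. -/
theorem lintegral_enorm_rpow (hT : IsSortedPoissonProcess μ lam T) (hlam : 0 < lam) (n : ℕ) {s : ℝ}
    (hs : 0 < n + 1 + s) :
    ∫⁻ ω, ‖T n ω‖ₑ ^ (2 * s) ∂μ
      =
        ENNReal.ofReal ((Real.pi * lam) ^ (-s) * (Real.Gamma (n + 1 + s) / Real.Gamma (n + 1))) := by
  have hpl : 0 < Real.pi * lam := mul_pos Real.pi_pos hlam
  have hXm : Measurable fun ω => Real.pi * lam * ‖T n ω‖ ^ 2 :=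
    ((hT.measurable n).norm.pow_const 2).const_mul _
  -- After extraction of `(πλ)^(-s)` the moment is that of a Gamma variable. In `[0, ∞]` the
  -- identity also holds at distance `0` with negative `s`.
  have e1 : ∀ ω, ‖T n ω‖ₑ ^ (2 * s) = ENNReal.ofReal ((Real.pi * lam) ^ (-s))
      * ENNReal.ofReal (Real.pi * lam * ‖T n ω‖ ^ 2) ^ s := by
    intro ω
    rw [ENNReal.ofReal_mul hpl.le, ENNReal.mul_rpow_of_ne_top ENNReal.ofReal_ne_top
      ENNReal.ofReal_ne_top, ← mul_assoc, ENNReal.ofReal_rpow_of_pos hpl,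
      ← ENNReal.ofReal_mul (by positivity), ← Real.rpow_add hpl, neg_add_cancel, Real.rpow_zero,
      ENNReal.ofReal_one, one_mul, ENNReal.ofReal_pow (norm_nonneg _), ofReal_norm,
      ENNReal.rpow_mul, ENNReal.rpow_ofNat]
  simp_rw [e1]
  rw [lintegral_const_mul _ (by fun_prop), ENNReal.ofReal_mul (by positivity)]
  congr 1
  have hm : Measurable fun t : ℝ => ENNReal.ofReal t ^ s := by fun_prop
  rw [← lintegral_map (f := fun t : ℝ => ENNReal.ofReal t ^ s) hm hXm, map_norm_sq hT hlam n,
    lintegral_withDensity_eq_lintegral_mul _ (by fun_prop) hm]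
  have e2 : ∀ t ∈ Set.Ioi (0 : ℝ), ((fun t : ℝ => ENNReal.ofReal
      (Real.exp (-t) * t ^ n / (n.factorial : ℝ))) * fun t : ℝ => ENNReal.ofReal t ^ s) t
      = ENNReal.ofReal (Real.exp (-t) * t ^ ((n + 1 + s : ℝ) - 1) / (n.factorial : ℝ)) := by
    intro t ht
    have ht' : (0 : ℝ) < t := ht
    simp only [Pi.mul_apply]
    rw [ENNReal.ofReal_rpow_of_pos ht', ← ENNReal.ofReal_mul (by positivity)]
    congr 1
    rw [show (n + 1 + s : ℝ) - 1 = n + s by ring, Real.rpow_add ht', Real.rpow_natCast]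
    ring
  rw [setLIntegral_congr_fun measurableSet_Ioi e2,
    ← ofReal_integral_eq_lintegral_ofReal ((Real.GammaIntegral_convergent hs).div_const _),
    integral_div, ← Real.Gamma_eq_integral hs, Real.Gamma_nat_eq_factorial]
  refine (ae_restrict_iff' measurableSet_Ioi).2 (ae_of_all _ fun t ht => ?_)
  have : (0 : ℝ) < t := ht
  positivity

end Poisson

/-- With `f(x) = (a-1)⁻¹ Γ(x+1-a)/Γ(x)` the summand at `x = c + i` equals `f(x) - f(x+1)`, and the
last value of `f` is nonnegative. With `a = α/2` the summands are, up to `(πλ)^(α/2)`, the means of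
`d_n^(-α)` for `n > c`. The condition on `c` keeps all Gamma arguments positive. -/
theorem sum_range_Gamma_ratio_le {a : ℝ} (ha : 1 < a) {c : ℕ} (hc : a - 1 < c) (n : ℕ) :
    ∑ i ∈ Finset.range n, Real.Gamma ((c + i : ℕ) + 1 - a) / Real.Gamma ((c + i : ℕ) + 1)
      ≤ (a - 1)⁻¹ * (Real.Gamma (c + 1 - a) / Real.Gamma c) := by
  have ha1 : 0 < a - 1 := by linarith
  set f : ℕ → ℝ := fun i => (a - 1)⁻¹ *
    (Real.Gamma ((c + i : ℕ) + 1 - a) / Real.Gamma ((c + i : ℕ))) with hf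
  have hpos : ∀ i : ℕ, 0 < ((c + i : ℕ) : ℝ) + 1 - a := by
    intro i
    push_cast
    have : (0 : ℝ) ≤ i := Nat.cast_nonneg i
    linarith
  have hc0 : (0 : ℝ) < c := by linarith
  have hcpos : ∀ i : ℕ, (0 : ℝ) < ((c + i : ℕ) : ℝ) := by
    intro i
    push_cast
    positivity
  have hstep : ∀ i : ℕ, Real.Gamma ((c + i : ℕ) + 1 - a) / Real.Gamma ((c + i : ℕ) + 1)
      = f i - f (i + 1) := by
    intro i
    have h1 := Real.Gamma_add_one (hpos i).ne'
    have h2 := Real.Gamma_add_one (hcpos i).ne'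
    have h3 := Real.Gamma_pos_of_pos (hcpos i)
    have h4 := hcpos i
    simp only [hf]
    rw [show ((c + (i + 1) : ℕ) : ℝ) + 1 - a = ((c + i : ℕ) : ℝ) + 1 - a + 1 by push_cast; ring,
      show ((c + (i + 1) : ℕ) : ℝ) = ((c + i : ℕ) : ℝ) + 1 by push_cast; ring, h1, h2]
    field_simp
    ring
  rw [Finset.sum_congr rfl fun i _ => hstep i, Finset.sum_range_sub']
  have h0 : 0 ≤ f n := by
    have := Real.Gamma_pos_of_pos (hpos n)
    have := Real.Gamma_pos_of_pos (hcpos n)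
    positivity
  have : f 0 = (a - 1)⁻¹ * (Real.Gamma (c + 1 - a) / Real.Gamma c) := by simp [hf]
  linarith

/-- The two hypotheses make the joint law of `(t, s, x)` the product of the three marginals, and the
factors of a product measure may be regrouped. -/
theorem indepFun_swap_prodMk {Ω α β γ : Type*} [MeasurableSpace Ω] [MeasurableSpace α]
    [MeasurableSpace β] [MeasurableSpace γ] {μ : Measure Ω} [IsProbabilityMeasure μ]
    {t : Ω → α} {s : Ω → β} {x : Ω → γ} (ht : Measurable t) (hs : Measurable s)
    (hx : Measurable x) (h1 : IndepFun t (fun ω => (s ω, x ω)) μ) (h2 : IndepFun s x μ) :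
    IndepFun s (fun ω => (t ω, x ω)) μ := by
  have pt := Measure.isProbabilityMeasure_map (μ := μ) ht.aemeasurable
  have ps := Measure.isProbabilityMeasure_map (μ := μ) hs.aemeasurable
  have px := Measure.isProbabilityMeasure_map (μ := μ) hx.aemeasurable
  have e1 := (indepFun_iff_map_prod_eq_prod_map_map ht.aemeasurable
    (hs.prodMk hx).aemeasurable).1 h1
  have e2 := (indepFun_iff_map_prod_eq_prod_map_map hs.aemeasurable hx.aemeasurable).1 h2
  have h3 : IndepFun t x μ := h1.comp measurable_id measurable_snd
  have e3 := (indepFun_iff_map_prod_eq_prod_map_map ht.aemeasurable hx.aemeasurable).1 h3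
  rw [indepFun_iff_map_prod_eq_prod_map_map hs.aemeasurable (ht.prodMk hx).aemeasurable, e3]
  rw [e2] at e1
  have m1 : MeasurePreserving (MeasurableEquiv.prodAssoc.symm : α × β × γ ≃ᵐ (α × β) × γ)
      ((μ.map t).prod ((μ.map s).prod (μ.map x))) (((μ.map t).prod (μ.map s)).prod (μ.map x)) :=
    (measurePreserving_prodAssoc _ _ _).symm _
  have m2 : MeasurePreserving (Prod.map (Prod.swap : α × β → β × α) (id : γ → γ))
      (((μ.map t).prod (μ.map s)).prod (μ.map x)) (((μ.map s).prod (μ.map t)).prod (μ.map x)) :=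
    Measure.measurePreserving_swap.prod (MeasurePreserving.id _)
  have m3 := measurePreserving_prodAssoc (μ.map s) (μ.map t) (μ.map x)
  have m := (m3.comp (m2.comp m1)).map_eq
  rw [← e1, Measure.map_map (m3.comp (m2.comp m1)).measurable (ht.prodMk (hs.prodMk hx))] at m
  exact m

/-! ### Bounds on the outage probability -/

section Outage

variable {Ω : Type*} [MeasurableSpace Ω] {μ : Measure Ω} [IsProbabilityMeasure μ]
  {T : ℝ → ℕ → Ω → Plane} {h : ℕ → ℕ → ℕ → Ω → ℂ}

/-- The remaining interference is independent of the signal power, and its mean is finite. -/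
theorem exists_interference (hnet : IsNetwork μ T h) {lam : ℝ} (hlam : 0 < lam) {α : ℝ}
    (hα : 2 < α) (d : ℝ) {N k c l : ℕ} (hl : l < k) (hN : k - 1 + k * c < N)
    (hc : α / 2 - 1 < c) :
    ∃ I : Ω → ℝ≥0∞, Measurable I ∧ IndepFun (signalPower h N k c l) I μ ∧
      ∫⁻ ω, I ω ∂μ ≤ ENNReal.ofReal (k * ((Real.pi * lam) ^ (α / 2) *
        ((α / 2 - 1)⁻¹ * (Real.Gamma (c + 1 - α / 2) / Real.Gamma c)))) ∧
      ∀ᵐ ω ∂μ, sir α d (T lam) h N k c l ω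
        = ENNReal.ofReal (d ^ (-α) * signalPower h N k c l ω) / I ω := by
  obtain ⟨X, hXm, hXlaw, -, hsX, hTX, hint⟩ :=
    exists_fading hnet (N := N) (k := k) (c := c) (l := l) (by omega)
  have hP := hnet.poisson lam hlam
  have hTm : Measurable fun ω n => T lam n ω := measurable_pi_lambda _ hP.measurable
  have hXm' : Measurable fun ω p => X p ω := measurable_pi_lambda _ hXm
  have hsm := measurable_signalPower hnet N k c l
  set G : (ℕ → Plane) × (ℕ × ℕ → ℂ) → ℝ≥0∞ := fun q => ∑' n : ℕ, ‖q.1 (c + n)‖ₑ ^ (-α) *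
    ENNReal.ofReal (∑ j ∈ Finset.range k, ‖q.2 (n, j)‖ ^ 2) with hG
  have hGm : Measurable G := by
    refine Measurable.tsum fun n => ?_
    refine Measurable.mul ?_ ?_
    · exact ((measurable_pi_apply (c + n)).comp measurable_fst).enorm.pow_const _
    · refine ENNReal.measurable_ofReal.comp (Finset.measurable_sum _ fun j _ => ?_)
      exact ((measurable_pi_apply (n, j)).comp measurable_snd).norm.pow_const 2
  refine ⟨fun ω => G (fun n => T lam n ω, fun p => X p ω), hGm.comp (hTm.prodMk hXm'), ?_, ?_, ?_⟩
  · exact (indepFun_swap_prodMk hTm hsm hXm' (hTX lam hlam) hsX).comp measurable_id hGm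
  · have hterm : ∀ n : ℕ, ∫⁻ ω, ‖T lam (c + n) ω‖ₑ ^ (-α) *
        ENNReal.ofReal (∑ j ∈ Finset.range k, ‖X (n, j) ω‖ ^ 2) ∂μ
        = ENNReal.ofReal ((Real.pi * lam) ^ (α / 2) *
            (Real.Gamma ((c + n : ℕ) + 1 - α / 2) / Real.Gamma ((c + n : ℕ) + 1))) * k := by
      intro n
      have hm1 : Measurable fun t : ℕ → Plane => ‖t (c + n)‖ₑ ^ (-α) :=
        (measurable_pi_apply (c + n)).enorm.pow_const _
      have hm2 : Measurable fun q : ℝ × (ℕ × ℕ → ℂ) =>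
          ENNReal.ofReal (∑ j ∈ Finset.range k, ‖q.2 (n, j)‖ ^ 2) := by
        refine ENNReal.measurable_ofReal.comp (Finset.measurable_sum _ fun j _ => ?_)
        exact ((measurable_pi_apply (n, j)).comp measurable_snd).norm.pow_const 2
      have hi := (hTX lam hlam).comp hm1 hm2
      have hmul := lintegral_mul_eq_lintegral_mul_lintegral_of_indepFun (hm1.comp hTm)
        (hm2.comp (hsm.prodMk hXm')) hi
      simp only [Pi.mul_apply, Function.comp_apply] at hmul
      rw [hmul]
      congr 1
      · have hcn : (0 : ℝ) < (c + n : ℕ) + 1 + -(α / 2) := by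
          push_cast
          have : (0 : ℝ) ≤ n := Nat.cast_nonneg n
          linarith
        have := lintegral_enorm_rpow hP hlam (c + n) hcn
        rw [show 2 * -(α / 2) = -α by ring, neg_neg, ← sub_eq_add_neg] at this
        exact this
      · simp_rw [ENNReal.ofReal_sum_of_nonneg fun i _ => sq_nonneg _]
        rw [lintegral_finsetSum _ fun j _ => by fun_prop]
        have hone : ∀ j : ℕ, ∫⁻ ω, ENNReal.ofReal (‖X (n, j) ω‖ ^ 2) ∂μ = 1 := by
          intro j
          rw [← lintegral_normSq_complexGaussian_eq_one, ← hXlaw (n, j),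
            lintegral_map (by fun_prop) (hXm (n, j))]
        rw [Finset.sum_congr rfl fun j _ => hone j]
        simp
    simp only [hG]
    rw [lintegral_tsum]
    · simp_rw [hterm]
      rw [ENNReal.tsum_mul_right, mul_comm, ENNReal.ofReal_mul (Nat.cast_nonneg k),
        ENNReal.ofReal_natCast]
      gcongr
      refine ENNReal.tsum_le_of_sum_range_le fun n => ?_
      have hpl : 0 < Real.pi * lam := mul_pos Real.pi_pos hlam
      rw [← ENNReal.ofReal_sum_of_nonneg, ← Finset.mul_sum]
      · refine ENNReal.ofReal_le_ofReal ?_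
        have := sum_range_Gamma_ratio_le (a := α / 2) (by linarith) hc n
        gcongr
      · intro i _
        have h1 : (0 : ℝ) < (c + i : ℕ) + 1 - α / 2 := by
          push_cast
          have : (0 : ℝ) ≤ i := Nat.cast_nonneg i
          linarith
        have := Real.Gamma_pos_of_pos h1
        have := Real.Gamma_pos_of_pos (show (0 : ℝ) < (c + i : ℕ) + 1 by positivity)
        positivity
    · intro n
      refine (Measurable.mul ?_ ?_).aemeasurable
      · exact (hP.measurable (c + n)).enorm.pow_const _
      · exact ENNReal.measurable_ofReal.comp
          (Finset.measurable_sum _ fun j _ => (hXm (n, j)).norm.pow_const 2)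
  · filter_upwards [ae_signalPower_pos hnet hl hN] with ω hω
    unfold sir
    simp only [hG]
    congr 1
    refine tsum_congr fun n => ?_
    rw [hint ω hω.ne' n]

/-- A bound on the outage probability if at least one spatial degree of freedom is used to
increase the signal power. -/
theorem measure_sir_le_le (hnet : IsNetwork μ T h) {lam : ℝ} (hlam : 0 < lam) {α β d : ℝ}
    (hα : 2 < α) (hβ : 0 < β) (hd : 0 < d) {N k c l : ℕ} (hl : l < k)
    (hN : k - 1 + k * c + 2 ≤ N) (hc : α / 2 - 1 < c) :
    μ {ω | sir α d (T lam) h N k c l ω ≤ ENNReal.ofReal β}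
      ≤ ENNReal.ofReal (β * d ^ α * ((N : ℝ) - (k - 1 + k * c : ℕ) - 1)⁻¹ *
        (k * ((Real.pi * lam) ^ (α / 2) *
          ((α / 2 - 1)⁻¹ * (Real.Gamma (c + 1 - α / 2) / Real.Gamma c))))) := by
  obtain ⟨I, hIm, hind, hmean, hsir⟩ := exists_interference hnet hlam hα d hl
    (show k - 1 + k * c < N by omega) hc
  set B := (k * ((Real.pi * lam) ^ (α / 2) *
    ((α / 2 - 1)⁻¹ * (Real.Gamma (c + 1 - α / 2) / Real.Gamma c))))
  have hsm := measurable_signalPower hnet N k c l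
  have hD : 0 ≤ ((N : ℝ) - (k - 1 + k * c : ℕ) - 1)⁻¹ := by
    have : ((k - 1 + k * c + 2 : ℕ) : ℝ) ≤ N := by exact_mod_cast hN
    rw [Nat.cast_add] at this
    exact inv_nonneg.2 (by push_cast at this ⊢; linarith)
  -- Outage forces `β d^α I / s ≥ 1`. By independence the mean of this ratio is `β d^α E(1/s) E I`,
  -- and Markov's inequality gives the bound.
  set g : Ω → ℝ≥0∞ := fun ω => ENNReal.ofReal (β * d ^ α) *
    ((ENNReal.ofReal (signalPower h N k c l ω))⁻¹ * I ω) with hg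
  have hgm : Measurable g := by fun_prop
  have hsub : μ {ω | sir α d (T lam) h N k c l ω ≤ ENNReal.ofReal β} ≤ μ {ω | 1 ≤ g ω} := by
    refine measure_mono_ae ?_
    filter_upwards [hsir, ae_signalPower_pos hnet hl (show k - 1 + k * c < N by omega)]
      with ω h1 h2 h3
    change sir α d (T lam) h N k c l ω ≤ ENNReal.ofReal β at h3
    change 1 ≤ g ω
    have hA : 0 < d ^ (-α) * signalPower h N k c l ω := mul_pos (Real.rpow_pos_of_pos hd _) h2
    have hβ0 : ENNReal.ofReal β ≠ 0 := by simpa using hβ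
    rw [h1, ENNReal.div_le_iff_le_mul (Or.inr ENNReal.ofReal_ne_top) (Or.inr hβ0)] at h3
    have hA0 : ENNReal.ofReal (d ^ (-α) * signalPower h N k c l ω) ≠ 0 := by simpa using hA
    calc (1 : ℝ≥0∞) = (ENNReal.ofReal (d ^ (-α) * signalPower h N k c l ω))⁻¹
          * ENNReal.ofReal (d ^ (-α) * signalPower h N k c l ω) :=
          (ENNReal.inv_mul_cancel hA0 ENNReal.ofReal_ne_top).symm
      _ ≤ (ENNReal.ofReal (d ^ (-α) * signalPower h N k c l ω))⁻¹ * (ENNReal.ofReal β * I ω) := by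
          gcongr
      _ = g ω := by
          simp only [hg]
          rw [← ENNReal.ofReal_inv_of_pos hA, ← ENNReal.ofReal_inv_of_pos h2, ← mul_assoc,
            ← mul_assoc, ← ENNReal.ofReal_mul (by positivity), ← ENNReal.ofReal_mul (by positivity)]
          congr 2
          rw [Real.rpow_neg hd.le]
          field_simp
  have hmarkov := mul_meas_ge_le_lintegral hgm 1 (μ := μ)
  rw [one_mul] at hmarkov
  refine hsub.trans (hmarkov.trans ?_)
  simp only [hg]
  have hi := hind.comp (φ := fun x => (ENNReal.ofReal x)⁻¹) (ψ := id) (by fun_prop) measurable_id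
  have hmul := lintegral_mul_eq_lintegral_mul_lintegral_of_indepFun
    (ENNReal.measurable_ofReal.comp hsm).inv hIm hi
  simp only [Pi.mul_apply, Pi.inv_apply, Function.comp_apply] at hmul
  rw [lintegral_const_mul _ (by fun_prop), hmul, lintegral_inv_signalPower hnet hl hN,
    mul_assoc (β * d ^ α), ENNReal.ofReal_mul (p := β * d ^ α) (by positivity),
    ENNReal.ofReal_mul hD]
  gcongr

/-- A bound on the outage probability for any number of spatial degrees of freedom. -/
theorem measure_sir_le_le_one_sub_exp (hnet : IsNetwork μ T h) {lam : ℝ} (hlam : 0 < lam)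
    {α β d : ℝ} (hα : 2 < α) (hβ : 0 < β) (hd : 0 < d) {N k c l : ℕ} (hl : l < k)
    (hN : k - 1 + k * c < N) (hc : α / 2 - 1 < c) :
    μ {ω | sir α d (T lam) h N k c l ω ≤ ENNReal.ofReal β}
      ≤ ENNReal.ofReal (1 - Real.exp (-(β * d ^ α *
        (k * ((Real.pi * lam) ^ (α / 2) *
          ((α / 2 - 1)⁻¹ * (Real.Gamma (c + 1 - α / 2) / Real.Gamma c))))))) := by
  obtain ⟨I, hIm, hind, hmean, hsir⟩ := exists_interference hnet hlam hα d hl hN hc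
  set B := (k * ((Real.pi * lam) ^ (α / 2) *
    ((α / 2 - 1)⁻¹ * (Real.Gamma (c + 1 - α / 2) / Real.Gamma c)))) with hB
  have hB0 : 0 ≤ B := by
    have h0 : (0 : ℝ) < c + 1 - α / 2 := by linarith
    have := Real.Gamma_pos_of_pos h0
    have := Real.Gamma_pos_of_pos (show (0 : ℝ) < c by linarith)
    have : 0 < (α / 2 - 1)⁻¹ := inv_pos.2 (by linarith)
    have := mul_pos Real.pi_pos hlam
    positivity
  set b := β * d ^ α * B with hb
  have hb0 : 0 ≤ b := by positivity
  have hsm := measurable_signalPower hnet N k c l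
  set S : Set (ℝ≥0∞ × ℝ) := {q | ENNReal.ofReal q.2 ≤ ENNReal.ofReal (β * d ^ α) * q.1} with hS
  have hSm : MeasurableSet S := measurableSet_le (by fun_prop) (by fun_prop)
  have hsub : μ {ω | sir α d (T lam) h N k c l ω ≤ ENNReal.ofReal β}
      ≤ μ ((fun ω => (I ω, signalPower h N k c l ω)) ⁻¹' S) := by
    refine measure_mono_ae ?_
    filter_upwards [hsir, ae_signalPower_pos hnet hl hN] with ω h1 h2 h3
    change sir α d (T lam) h N k c l ω ≤ ENNReal.ofReal β at h3
    change ENNReal.ofReal (signalPower h N k c l ω) ≤ ENNReal.ofReal (β * d ^ α) * I ω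
    have hβ0 : ENNReal.ofReal β ≠ 0 := by simpa using hβ
    rw [h1, ENNReal.div_le_iff_le_mul (Or.inr ENNReal.ofReal_ne_top) (Or.inr hβ0)] at h3
    calc ENNReal.ofReal (signalPower h N k c l ω)
        = ENNReal.ofReal (d ^ α) * ENNReal.ofReal (d ^ (-α) * signalPower h N k c l ω) := by
          rw [← ENNReal.ofReal_mul (by positivity), ← mul_assoc, ← Real.rpow_add hd,
            add_neg_cancel, Real.rpow_zero, one_mul]
      _ ≤ ENNReal.ofReal (d ^ α) * (ENNReal.ofReal β * I ω) := by gcongr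
      _ = ENNReal.ofReal (β * d ^ α) * I ω := by
          rw [← mul_assoc, ← ENNReal.ofReal_mul (by positivity), mul_comm β]
  have hlaw := (indepFun_iff_map_prod_eq_prod_map_map hIm.aemeasurable hsm.aemeasurable).1 hind.symm
  have ps := Measure.isProbabilityMeasure_map (μ := μ) hsm.aemeasurable
  refine hsub.trans ?_
  rw [← Measure.map_apply (hIm.prodMk hsm) hSm, hlaw, Measure.prod_apply hSm,
    lintegral_map (measurable_measure_prodMk_left hSm) hIm]
  have hexp1 : 0 ≤ 1 - Real.exp (-b) * (1 + b) := by
    have h1 := Real.add_one_le_exp b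
    have h2 : Real.exp (-b) * Real.exp b = 1 := by rw [← Real.exp_add]; simp
    nlinarith [Real.exp_pos (-b)]
  -- Given `I`, the outage probability is at most `1 - exp(-y)` with `y = β d^α I`. The right side
  -- is the tangent line at `b` of this concave function of `y`. Integrating the tangent is Jensen's
  -- inequality in a form that also admits `I = ∞`.
  have hpt : ∀ ω, μ.map (signalPower h N k c l) (Prod.mk (I ω) ⁻¹' S)
      ≤ ENNReal.ofReal (1 - Real.exp (-b) * (1 + b))
        + ENNReal.ofReal (Real.exp (-b)) * (ENNReal.ofReal (β * d ^ α) * I ω) := by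
    intro ω
    have hyκ : ENNReal.ofReal (β * d ^ α) ≠ 0 := by
      simpa using mul_pos hβ (Real.rpow_pos_of_pos hd α)
    rcases eq_or_ne (ENNReal.ofReal (β * d ^ α) * I ω) ⊤ with htop | hfin
    · rw [htop, ENNReal.mul_top (by simpa using Real.exp_pos _), add_top]
      exact le_top
    · set y := (ENNReal.ofReal (β * d ^ α) * I ω).toReal with hy
      have hy0 : 0 ≤ y := ENNReal.toReal_nonneg
      have hyeq : ENNReal.ofReal (β * d ^ α) * I ω = ENNReal.ofReal y :=
        (ENNReal.ofReal_toReal hfin).symm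
      have hset : Prod.mk (I ω) ⁻¹' S = (Set.Ioi y)ᶜ := by
        ext x
        change ENNReal.ofReal x ≤ ENNReal.ofReal (β * d ^ α) * I ω ↔ _
        rw [hyeq, ENNReal.ofReal_le_ofReal_iff hy0]
        simp
      rw [hset, prob_compl_eq_one_sub measurableSet_Ioi, hyeq,
        Measure.map_apply hsm measurableSet_Ioi, ← ENNReal.ofReal_mul (Real.exp_pos _).le,
        ← ENNReal.ofReal_add hexp1 (by positivity)]
      have h1 := exp_neg_le_measure_signalPower hnet hl hN hy0
      calc 1 - μ (signalPower h N k c l ⁻¹' Set.Ioi y)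
          ≤ 1 - ENNReal.ofReal (Real.exp (-y)) := tsub_le_tsub_left h1 _
        _ = ENNReal.ofReal (1 - Real.exp (-y)) := by
            rw [ENNReal.ofReal_sub _ (Real.exp_pos _).le, ENNReal.ofReal_one]
        _ ≤ _ := by
            refine ENNReal.ofReal_le_ofReal ?_
            have h2 := Real.add_one_le_exp (b - y)
            have h3 : Real.exp (-y) = Real.exp (-b) * Real.exp (b - y) := by
              rw [← Real.exp_add]; congr 1; ring
            rw [h3]
            nlinarith [Real.exp_pos (-b)]
  refine (lintegral_mono hpt).trans ?_
  rw [lintegral_add_left measurable_const, lintegral_const_mul _ (by fun_prop),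
    lintegral_const_mul _ hIm]
  calc _ ≤ ENNReal.ofReal (1 - Real.exp (-b) * (1 + b))
        + ENNReal.ofReal (Real.exp (-b)) * (ENNReal.ofReal (β * d ^ α) * ENNReal.ofReal B) := by
        simp only [lintegral_const, measure_univ, mul_one]
        gcongr
    _ = ENNReal.ofReal (1 - Real.exp (-b)) := by
        rw [← ENNReal.ofReal_mul (by positivity), ← ENNReal.ofReal_mul (by positivity),
          ← ENNReal.ofReal_add hexp1 (by positivity)]
        congr 1
        rw [← hb]
        ring

/-- Markov's inequality for the signal-to-interference ratio, in which only the interference of the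
`M` nearest interferers that are not canceled is taken into account. -/
theorem mul_measure_lt_sir_le (hnet : IsNetwork μ T h) {lam : ℝ} (hlam : 0 < lam) {α d : ℝ}
    (hα : 2 < α) (hd : 0 < d) {N k c l M : ℕ} (hl : l < k) (hN : k - 1 + k * c < N)
    (hM : 2 ≤ M * k) (β : ℝ) :
    ENNReal.ofReal β * μ {ω | ENNReal.ofReal β < sir α d (T lam) h N k c l ω}
      ≤ ENNReal.ofReal (d ^ (-α) * (N - (k - 1 + k * c) : ℕ) * ((M * k : ℕ) - 1 : ℝ)⁻¹ *
        ((Real.pi * lam) ^ (-(α / 2)) *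
          (Real.Gamma (c + M + α / 2) / Real.Gamma (c + M)))) := by
  obtain ⟨X, hXm, hXlaw, hXind, hsX, hTX, hint⟩ :=
    exists_fading hnet (N := N) (k := k) (c := c) (l := l) (by omega)
  have hM0 : 0 < M := Nat.pos_of_ne_zero (by rintro rfl; simp at hM)
  have hP := hnet.poisson lam hlam
  have hTm : Measurable fun ω n => T lam n ω := measurable_pi_lambda _ hP.measurable
  have hXm' : Measurable fun ω p => X p ω := measurable_pi_lambda _ hXm
  have hsm := measurable_signalPower hnet N k c l
  set A := Finset.range M ×ˢ Finset.range k
  have hAcard : A.card = M * k := by simp [A]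
  have hinv := lintegral_inv_sum_normSq hXm hXlaw hXind A (by rwa [hAcard])
  rw [hAcard] at hinv
  -- The first `M` remaining interferers are no farther than the one of index `c + (M - 1)`. Moving
  -- them out to that distance raises the SIR to at most `g`, a product of independent factors: a
  -- power of a distance, the signal power, and the inverse of a sum of `Mk` exponentials.
  set g : Ω → ℝ≥0∞ := fun ω => ‖T lam (c + (M - 1)) ω‖ₑ ^ α *
    (ENNReal.ofReal (d ^ (-α) * signalPower h N k c l ω)
      * (ENNReal.ofReal (∑ p ∈ A, ‖X p ω‖ ^ 2))⁻¹) with hg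
  have hgm : Measurable g := by
    refine ((hP.measurable _).enorm.pow_const _).mul (Measurable.mul (by fun_prop) ?_)
    fun_prop
  have hSm : Measurable fun ω => (ENNReal.ofReal (∑ p ∈ A, ‖X p ω‖ ^ 2))⁻¹ := by fun_prop
  -- Finite mean of the inverse shows that the sum is almost surely nonzero, which is needed to
  -- invert the product in the denominator whatever the distance is.
  have hSfin : ∀ᵐ ω ∂μ, (ENNReal.ofReal (∑ p ∈ A, ‖X p ω‖ ^ 2))⁻¹ < ⊤ :=
    ae_lt_top hSm (by rw [hinv]; exact ENNReal.ofReal_ne_top)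
  have hle : ∀ᵐ ω ∂μ, sir α d (T lam) h N k c l ω ≤ g ω := by
    filter_upwards [ae_signalPower_pos hnet hl hN, hP.sorted, hSfin] with ω h1 h2 h3
    have hS0 : ENNReal.ofReal (∑ p ∈ A, ‖X p ω‖ ^ 2) ≠ 0 := ENNReal.inv_lt_top.1 h3 |>.ne'
    have hden : ‖T lam (c + (M - 1)) ω‖ₑ ^ (-α) * ENNReal.ofReal (∑ p ∈ A, ‖X p ω‖ ^ 2)
        ≤ ∑' n : ℕ, ‖T lam (c + n) ω‖ₑ ^ (-α)
          * ENNReal.ofReal (interfererPower h N k c l (c + n) ω) := by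
      refine le_trans ?_ (ENNReal.sum_le_tsum (Finset.range M))
      rw [Finset.sum_product, ENNReal.ofReal_sum_of_nonneg fun i _ => by positivity,
        Finset.mul_sum]
      refine Finset.sum_le_sum fun n hn => ?_
      rw [hint ω h1.ne' n]
      refine mul_le_mul_left ?_ _
      rw [ENNReal.rpow_neg, ENNReal.rpow_neg, ENNReal.inv_le_inv]
      refine ENNReal.rpow_le_rpow ?_ (by linarith)
      rw [← ofReal_norm, ← ofReal_norm]
      refine ENNReal.ofReal_le_ofReal (h2 ?_)
      have := Finset.mem_range.1 hn
      omega
    unfold sir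
    refine (ENNReal.div_le_div_left hden _).trans (le_of_eq ?_)
    simp only [hg]
    rw [div_eq_mul_inv, ENNReal.mul_inv (Or.inr ENNReal.ofReal_ne_top) (Or.inr hS0),
      ENNReal.rpow_neg, inv_inv]
    ring
  have hmarkov := mul_meas_ge_le_lintegral hgm (ENNReal.ofReal β) (μ := μ)
  have hsub : μ {ω | ENNReal.ofReal β < sir α d (T lam) h N k c l ω}
      ≤ μ {ω | ENNReal.ofReal β ≤ g ω} := by
    refine measure_mono_ae ?_
    filter_upwards [hle] with ω h1 h2
    exact (le_of_lt (show ENNReal.ofReal β < sir α d (T lam) h N k c l ω from h2)).trans h1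
  refine (mul_le_mul_right hsub _).trans (hmarkov.trans (le_of_eq ?_))
  have hm1 : Measurable fun t : ℕ → Plane => ‖t (c + (M - 1))‖ₑ ^ α :=
    (measurable_pi_apply _).enorm.pow_const _
  have hm3 : Measurable fun x : ℕ × ℕ → ℂ => (ENNReal.ofReal (∑ p ∈ A, ‖x p‖ ^ 2))⁻¹ := by
    refine (ENNReal.measurable_ofReal.comp (Finset.measurable_sum _ fun p _ => ?_)).inv
    exact (measurable_pi_apply p).norm.pow_const 2
  have hm0 : Measurable fun s : ℝ => ENNReal.ofReal (d ^ (-α) * s) := by fun_prop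
  have hm2 : Measurable fun q : ℝ × (ℕ × ℕ → ℂ) => ENNReal.ofReal (d ^ (-α) * q.1) *
      (ENNReal.ofReal (∑ p ∈ A, ‖q.2 p‖ ^ 2))⁻¹ :=
    (hm0.comp measurable_fst).mul (hm3.comp measurable_snd)
  have e1 := lintegral_mul_eq_lintegral_mul_lintegral_of_indepFun (hm1.comp hTm)
    (hm2.comp (hsm.prodMk hXm')) ((hTX lam hlam).comp hm1 hm2)
  have e2 := lintegral_mul_eq_lintegral_mul_lintegral_of_indepFun (hm0.comp hsm)
    (hm3.comp hXm') (hsX.comp hm0 hm3)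
  simp only [Pi.mul_apply, Function.comp_apply] at e1 e2
  have hd0 : 0 ≤ d ^ (-α) := (Real.rpow_pos_of_pos hd _).le
  have e3 : ∫⁻ ω, ENNReal.ofReal (d ^ (-α) * signalPower h N k c l ω) ∂μ
      = ENNReal.ofReal (d ^ (-α) * (N - (k - 1 + k * c) : ℕ)) := by
    simp_rw [ENNReal.ofReal_mul hd0]
    rw [lintegral_const_mul _ (by fun_prop), lintegral_signalPower hnet hl hN.le,
      ENNReal.ofReal_natCast]
  have hcM : (0 : ℝ) < (c + (M - 1) : ℕ) + 1 + α / 2 := by positivity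
  have e4 := lintegral_enorm_rpow hP hlam (c + (M - 1)) hcM
  rw [show 2 * (α / 2) = α by ring,
    show ((c + (M - 1) : ℕ) : ℝ) + 1 = c + M by
      rw [← Nat.cast_add_one, show c + (M - 1) + 1 = c + M by omega, Nat.cast_add]] at e4
  simp only [hg]
  rw [e1, e2, e3, e4, hinv, mul_comm, ← ENNReal.ofReal_mul (by positivity), ← ENNReal.ofReal_mul]
  have : (2 : ℝ) ≤ (M * k : ℕ) := by exact_mod_cast hM
  exact mul_nonneg (by positivity) (inv_nonneg.2 (by linarith))

end Outage

/-! ### Inequalities and limits for Gamma ratios -/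

theorem Gamma_add_natCast {x : ℝ} (hx : 0 < x) (n : ℕ) :
    Real.Gamma (x + n) = Real.Gamma x * ∏ i ∈ Finset.range n, (x + i) := by
  induction n with
  | zero => simp
  | succ n ih =>
    rw [Finset.prod_range_succ, ← mul_assoc, ← ih, Nat.cast_succ, ← add_assoc,
      Real.Gamma_add_one (by positivity), mul_comm]

/-- This is log-convexity of `Γ` between `x` and `x + 1`, combined with `Γ(x + 1) = x Γ(x)`. -/
theorem Gamma_add_le_mul_rpow {x s : ℝ} (hx : 0 < x) (hs0 : 0 ≤ s) (hs1 : s < 1) :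
    Real.Gamma (x + s) ≤ Real.Gamma x * x ^ s := by
  rcases hs0.eq_or_lt with rfl | hs
  · simp
  have h := Real.Gamma_mul_add_mul_le_rpow_Gamma_mul_rpow_Gamma hx (show 0 < x + 1 by linarith)
    (show 0 < 1 - s by linarith) hs (by ring)
  have hG := Real.Gamma_pos_of_pos hx
  rw [show (1 - s) * x + s * (x + 1) = x + s by ring, Real.Gamma_add_one hx.ne',
    Real.mul_rpow hx.le hG.le, mul_comm (x ^ s), ← mul_assoc, ← Real.rpow_add hG,
    show 1 - s + s = 1 by ring, Real.rpow_one] at h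
  exact h

/-- A Kershaw type bound for ratios of Gamma values. -/
theorem Gamma_add_le {x a : ℝ} (hx : 0 < x) (ha : 1 ≤ a) :
    Real.Gamma (x + a) ≤ Real.Gamma x * (x + a / 2 - 3 / 8) ^ a := by
  -- With `a = n + s`, the ratio is at most `x^s ∏_{i<n} (x + s + i)`, a geometric mean of total
  -- weight `a`. Weighted AM-GM, in the form `z ≤ A exp(z/A - 1)` for each factor, bounds it by
  -- `A^a` once the weighted arithmetic mean is at most `A`.
  set n := ⌊a⌋₊
  set s := a - n with hs
  have hn1 : 1 ≤ n := (Nat.one_le_floor_iff a).2 ha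
  have hs0 : 0 ≤ s := by have := Nat.floor_le (by linarith : 0 ≤ a); simp only [hs]; linarith
  have hs1 : s < 1 := by have := Nat.lt_floor_add_one a; simp only [hs]; linarith
  set A := x + a / 2 - 3 / 8 with hA
  have hA0 : 0 < A := by simp only [hA]; linarith
  have hG := Real.Gamma_pos_of_pos hx
  have htan : ∀ z : ℝ, z ≤ A * Real.exp (z / A - 1) := by
    intro z
    have := Real.add_one_le_exp (z / A - 1)
    calc z = A * (z / A - 1 + 1) := by field_simp; ring
      _ ≤ _ := by gcongr
  have h1 : x ^ s ≤ A ^ s * Real.exp (s * (x / A - 1)) := by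
    calc x ^ s ≤ (A * Real.exp (x / A - 1)) ^ s := Real.rpow_le_rpow hx.le (htan x) hs0
      _ = _ := by
        rw [Real.mul_rpow hA0.le (Real.exp_pos _).le, ← Real.exp_mul, mul_comm s]
  have h2 : ∏ i ∈ Finset.range n, (x + s + i)
      ≤ A ^ n * Real.exp (∑ i ∈ Finset.range n, ((x + s + i) / A - 1)) := by
    calc _ ≤ ∏ i ∈ Finset.range n, A * Real.exp ((x + s + i) / A - 1) :=
          Finset.prod_le_prod (fun i _ => by positivity) fun i _ => htan _
      _ = _ := by rw [Finset.prod_mul_distrib, Finset.prod_const, Finset.card_range, Real.exp_sum]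
  have hsum : ∑ i ∈ Finset.range n, ((x + s + i) / A - 1)
      = (n * (x + s) + n * (n - 1) / 2) / A - n := by
    have hid : ∀ m : ℕ, ∑ i ∈ Finset.range m, (i : ℝ) = m * (m - 1) / 2 := by
      intro m
      induction m with
      | zero => simp
      | succ m ih => rw [Finset.sum_range_succ, ih]; push_cast; ring
    rw [Finset.sum_sub_distrib, ← Finset.sum_div, Finset.sum_add_distrib, hid]
    simp [mul_add]
  have hexp : Real.exp (s * (x / A - 1)) * Real.exp (∑ i ∈ Finset.range n, ((x + s + i) / A - 1))
      ≤ 1 := by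
    rw [← Real.exp_add, Real.exp_le_one_iff, hsum]
    have has : a = n + s := by simp only [hs]; ring
    have hn1' : (1 : ℝ) ≤ n := by exact_mod_cast hn1
    -- The right side exceeds the left by `s²/2 - 3s/8 + n/8`, which is positive because `n ≥ 1`.
    -- This is where the shift `3/8` and the assumption `1 ≤ a` enter.
    have hkey : s * x + (n * (x + s) + n * (n - 1) / 2) ≤ (n + s) * A := by
      simp only [hA]
      rw [has]
      nlinarith [sq_nonneg (s - 3 / 8), sq_nonneg (n - 1 : ℝ)]
    have : s * (x / A - 1) + ((n * (x + s) + n * (n - 1) / 2) / A - n)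
        = (s * x + (n * (x + s) + n * (n - 1) / 2) - (n + s) * A) / A := by
      field_simp
      ring
    rw [this]
    exact div_nonpos_of_nonpos_of_nonneg (by linarith) hA0.le
  have hxa : x + a = x + s + n := by simp only [hs]; ring
  rw [hxa, Gamma_add_natCast (by linarith : 0 < x + s)]
  have hprod : 0 ≤ ∏ i ∈ Finset.range n, (x + s + i) :=
    Finset.prod_nonneg fun i _ => by positivity
  calc Real.Gamma (x + s) * ∏ i ∈ Finset.range n, (x + s + i)
      ≤ Real.Gamma x * (A ^ s * Real.exp (s * (x / A - 1))) *
        (A ^ n * Real.exp (∑ i ∈ Finset.range n, ((x + s + i) / A - 1))) := by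
        refine mul_le_mul ((Gamma_add_le_mul_rpow hx hs0 hs1).trans ?_) h2 hprod (by positivity)
        gcongr
    _ = Real.Gamma x * (A ^ s * A ^ n) * (Real.exp (s * (x / A - 1)) *
        Real.exp (∑ i ∈ Finset.range n, ((x + s + i) / A - 1))) := by ring
    _ ≤ Real.Gamma x * (A ^ s * A ^ n) * 1 := by gcongr
    _ = Real.Gamma x * A ^ a := by
        rw [mul_one, ← Real.rpow_natCast, ← Real.rpow_add hA0, show s + (n : ℝ) = a by
          simp only [hs]; ring]

theorem Gamma_ratio_rpow_le {x a : ℝ} (hx : 0 < x) (ha : 1 ≤ a) :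
    (Real.Gamma (x + a) / Real.Gamma x) ^ (1 / a) ≤ x + a / 2 - 3 / 8 := by
  have hG := Real.Gamma_pos_of_pos hx
  have hG2 := Real.Gamma_pos_of_pos (show 0 < x + a by linarith)
  have hA : 0 ≤ x + a / 2 - 3 / 8 := by linarith
  calc (Real.Gamma (x + a) / Real.Gamma x) ^ (1 / a)
      ≤ ((x + a / 2 - 3 / 8) ^ a) ^ (1 / a) := by
        refine Real.rpow_le_rpow (by positivity) ?_ (by positivity)
        rw [div_le_iff₀ hG, mul_comm]
        exact Gamma_add_le hx ha
    _ = _ := by rw [← Real.rpow_mul hA, mul_one_div_cancel (by linarith), Real.rpow_one]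

theorem meanCorrection_pos {α : ℝ} (hα : 2 < α) {c : ℕ} (hc : α / 2 - 1 < c) :
    0 < meanCorrection α c := by
  have h1 := Real.Gamma_pos_of_pos (show (0 : ℝ) < c by linarith)
  have h2 := Real.Gamma_pos_of_pos (show (0 : ℝ) < c + 1 - α / 2 by linarith)
  unfold meanCorrection
  positivity

/-- Euler's limit formula for `Γ(s)`, with the product in its denominator written as `Γ(n + 1 +
s)/Γ(s)`. -/
theorem tendsto_Gamma_ratio {s : ℝ} (hs : 0 < s) :
    Tendsto (fun n : ℕ => (n : ℝ) ^ s * n.factorial / Real.Gamma (n + 1 + s)) atTop (𝓝 1) := by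
  have hG := Real.Gamma_pos_of_pos hs
  have h := (Real.GammaSeq_tendsto_Gamma s).div_const (Real.Gamma s)
  rw [div_self hG.ne'] at h
  refine h.congr fun n => ?_
  have h1 := Gamma_add_natCast hs (n + 1)
  rw [Real.GammaSeq, show (n : ℝ) + 1 + s = s + (n + 1 : ℕ) by push_cast; ring, h1]
  rw [div_div, mul_comm (Real.Gamma s)]

theorem tendsto_meanCorrection {α : ℝ} (hα : 2 < α) :
    Tendsto (meanCorrection α) atTop (𝓝 1) := by
  set a := α / 2 with ha
  -- Euler's limit is available for a positive shift, whereas the shift here is `-a`. Raising the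
  -- Gamma argument by `K > a` repairs this at the cost of `K` factors, each asymptotic to `c`.
  obtain ⟨K, hK⟩ := exists_nat_gt a
  have hs : 0 < (K : ℝ) - a := by linarith
  have hcast : Tendsto (fun c : ℕ => (c : ℝ)) atTop atTop := tendsto_natCast_atTop_atTop
  have hinv : Tendsto (fun c : ℕ => ((c : ℝ))⁻¹) atTop (𝓝 0) := tendsto_inv_atTop_zero.comp hcast
  have hlin : ∀ b : ℝ, Tendsto (fun c : ℕ => ((c : ℝ) + b) / c) atTop (𝓝 1) := by
    intro b
    have : Tendsto (fun c : ℕ => 1 + b * (c : ℝ)⁻¹) atTop (𝓝 (1 + b * 0)) :=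
      tendsto_const_nhds.add (hinv.const_mul b)
    rw [mul_zero, add_zero] at this
    refine this.congr' ?_
    filter_upwards [eventually_gt_atTop 0] with c hc
    have : (c : ℝ) ≠ 0 := by positivity
    field_simp
  have h2 : Tendsto (fun c : ℕ => ∏ i ∈ Finset.range K, ((c : ℝ) + (1 - a + i)) / c) atTop
      (𝓝 1) := by
    have := tendsto_finsetProd (f := fun (i : ℕ) (c : ℕ) => ((c : ℝ) + (1 - a + i)) / c)
      (Finset.range K) fun i _ => hlin (1 - a + i)
    simpa using this
  have h3 : Tendsto (fun c : ℕ => (((c : ℝ) + 1) / c) ^ (1 - a)) atTop (𝓝 1) := by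
    have := (hlin 1).rpow_const (p := 1 - a) (Or.inl one_ne_zero)
    simpa using this
  have hall := ((tendsto_Gamma_ratio hs).mul h2).mul h3
  rw [mul_one, mul_one] at hall
  have hfin := hall.rpow_const (p := 2 / α) (Or.inl one_ne_zero)
  rw [Real.one_rpow] at hfin
  refine hfin.congr' ?_
  filter_upwards [eventually_gt_atTop 0, hcast.eventually_gt_atTop a] with c hc hca
  have hc0 : (0 : ℝ) < c := by positivity
  unfold meanCorrection
  rw [← ha]
  congr 1
  have hx : 0 < (c : ℝ) + 1 - a := by linarith
  have h4 := Gamma_add_natCast hx K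
  have h5 := Real.Gamma_pos_of_pos hx
  have h6 : (0 : ℝ) < ∏ i ∈ Finset.range K, ((c : ℝ) + 1 - a + i) :=
    Finset.prod_pos fun i _ => by positivity
  rw [show (c : ℝ) + 1 + (K - a) = c + 1 - a + K by ring, h4, Finset.prod_div_distrib,
    Finset.prod_const, Finset.card_range,
    show ∏ i ∈ Finset.range K, ((c : ℝ) + (1 - a + i)) = ∏ i ∈ Finset.range K, ((c : ℝ) + 1 - a + i)
      from Finset.prod_congr rfl fun i _ => by ring,
    Real.div_rpow (by linarith) hc0.le, show (c : ℝ) ^ ((K : ℝ) - a) = c ^ K * c ^ (1 - a) / c by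
      rw [show (K : ℝ) - a = K + (1 - a) - 1 by ring, Real.rpow_sub hc0, Real.rpow_add hc0,
        Real.rpow_natCast, Real.rpow_one],
    show ((c.factorial : ℕ) : ℝ) = c * Real.Gamma c by
      rw [← Real.Gamma_nat_eq_factorial, Real.Gamma_add_one hc0.ne']]
  have h7 : (0 : ℝ) < c ^ (1 - a) := Real.rpow_pos_of_pos hc0 _
  field_simp

/-! ### The lower bound and the number of streams -/

/-- The effective received energy in the lower bound when `j` of `N` degrees of freedom are used. -/
def energy (ε : ℝ) (N j : ℕ) : ℝ := if j = N then -Real.log (1 - ε) else ((N : ℝ) - j) * ε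

theorem energy_pos {ε : ℝ} (hε0 : 0 < ε) (hε1 : ε < 1) {N j : ℕ} (hj : j ≤ N) :
    0 < energy ε N j := by
  unfold energy
  split_ifs with h
  · have := Real.log_neg (by linarith : 0 < 1 - ε) (by linarith)
    linarith
  · have : (j : ℝ) < N := by exact_mod_cast lt_of_le_of_ne hj h
    exact mul_pos (by linarith) hε0

theorem lowerBound_eq_energy (α β d ε R : ℝ) (N k m : ℕ) : lowerBound α β d ε R N k m
    = k * R * (1 - ε) / Real.pi * (energy ε N (k + m) / (k * β * d ^ α)) ^ (2 / α)
      * ((α / 2 - 1)⁻¹ * (((m / k : ℕ) : ℝ) + 1) ^ (1 - α / 2)) ^ (-(2 / α)) := by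
  unfold lowerBound energy
  split_ifs
  · rfl
  · push_cast
    rw [sub_add_eq_sub_sub]

/-- The exponents of `k` and of `c + 1` are both `1 - 2/α`. The parameters thus enter only through
the total `k + m` and the product `k(c + 1)`, which makes the comparison of different `k`
transparent. -/
theorem lowerBound_eq {α β d ε R : ℝ} (hα : 2 < α) (hβ : 0 < β) (hd : 0 < d) (hε0 : 0 < ε)
    (hε1 : ε < 1) {N k m : ℕ} (hk : 1 ≤ k) (hN : k + m ≤ N) :
    lowerBound α β d ε R N k m
      = R * (1 - ε) / Real.pi * ((α / 2 - 1) / (β * d ^ α)) ^ (2 / α)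
        * (energy ε N (k + m) ^ (2 / α) * ((k : ℝ) * ((m / k : ℕ) + 1)) ^ (1 - 2 / α)) := by
  have hη := energy_pos hε0 hε1 hN
  have hk0 : (0 : ℝ) < k := by exact_mod_cast hk
  have hdα : 0 < d ^ α := Real.rpow_pos_of_pos hd _
  have ha : 0 < α / 2 - 1 := by linarith
  have hα0 : α ≠ 0 := by linarith
  rw [lowerBound_eq_energy]
  set η := energy ε N (k + m)
  set c : ℝ := ((m / k : ℕ) : ℝ)
  have hc : 0 < c + 1 := by positivity
  have e1 : ((α / 2 - 1)⁻¹ * (c + 1) ^ (1 - α / 2)) ^ (-(2 / α))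
      = (α / 2 - 1) ^ (2 / α) * (c + 1) ^ (1 - 2 / α) := by
    rw [Real.mul_rpow (by positivity) (by positivity), Real.rpow_neg (by positivity),
      Real.inv_rpow ha.le, inv_inv, ← Real.rpow_mul hc.le]
    congr 2
    field_simp
    ring
  have hkp : (k : ℝ) ^ (1 - 2 / α) = k / k ^ (2 / α) := by
    rw [Real.rpow_sub hk0, Real.rpow_one]
  rw [e1, Real.div_rpow hη.le (by positivity), Real.div_rpow ha.le (by positivity),
    Real.mul_rpow hk0.le hc.le, mul_assoc (k : ℝ) β, Real.mul_rpow hk0.le (by positivity), hkp]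
  field_simp

theorem Admissible.one_le_div {α : ℝ} (hα : 2 < α) {N k m : ℕ} (h : Admissible α N k m) :
    1 ≤ m / k := by
  have h1 : (0 : ℝ) < (m / k : ℕ) := by have := h.2.2; linarith
  exact_mod_cast h1

theorem Admissible.le_right {α : ℝ} (hα : 2 < α) {N k m : ℕ} (h : Admissible α N k m) :
    k ≤ m :=
  (Nat.one_le_div_iff h.1).1 (h.one_le_div hα)

theorem Admissible.mul_div_add_one_le {α : ℝ} {N k m : ℕ} (_h : Admissible α N k m) :
    k * (m / k + 1) ≤ k + m := by
  have := Nat.mul_div_le m k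
  rw [mul_add]
  omega

theorem Admissible.single {α : ℝ} {N k m m' : ℕ} (h : Admissible α N k m) (h1 : m ≤ m')
    (h2 : 1 + m' ≤ N) : Admissible α N 1 m' := by
  refine ⟨le_rfl, h2, h.2.2.trans_le ?_⟩
  rw [Nat.div_one]
  exact_mod_cast (Nat.div_le_self m k).trans h1

/-- The new pair has the same total `k + m`, hence the same energy. Moreover `k(⌊m/k⌋ + 1) ≤ k + m`,
with equality for a single stream, and the exponent `1 - 2/α` is nonnegative. -/
theorem lowerBound_le_single {α β d ε R : ℝ} (hα : 2 < α) (hβ : 0 < β) (hd : 0 < d)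
    (hε0 : 0 < ε) (hε1 : ε < 1) (hR : 0 < R) {N k m : ℕ} (h : Admissible α N k m) :
    Admissible α N 1 (m + k - 1) ∧
      lowerBound α β d ε R N k m ≤ lowerBound α β d ε R N 1 (m + k - 1) := by
  have hk := h.1
  have hN := h.2.1
  refine ⟨h.single (by omega) (by omega), ?_⟩
  rw [lowerBound_eq hα hβ hd hε0 hε1 hk hN, lowerBound_eq hα hβ hd hε0 hε1 le_rfl (by omega),
    show 1 + (m + k - 1) = k + m by omega]
  have hη := energy_pos hε0 hε1 hN
  have hp : 0 ≤ 1 - 2 / α := by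
    rw [sub_nonneg, div_le_one (by linarith)]
    exact hα.le
  have h1 : (k : ℝ) * ((m / k : ℕ) + 1) ≤ ((1 : ℕ) : ℝ) * (((m + k - 1) / 1 : ℕ) + 1) := by
    rw [Nat.div_one]
    have h2 := h.mul_div_add_one_le
    have h3 : k * (m / k + 1) ≤ 1 * ((m + k - 1) + 1) := by omega
    exact_mod_cast h3
  have h4 : 0 ≤ 1 - ε := by linarith
  have h5 : 0 ≤ ((α / 2 - 1) / (β * d ^ α)) ^ (2 / α) := by
    have : 0 < α / 2 - 1 := by linarith
    positivity
  gcongr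

/-! ### The upper bound and the number of streams -/

/-- The factor of the upper bound that depends neither on `N` nor on `k` and `m`. -/
def upperFactor (α β d ε R : ℝ) : ℝ :=
  R * (1 - ε) ^ (1 - 2 / α) / Real.pi * (1 / (d ^ α * β)) ^ (2 / α)

theorem upperFactor_pos {α β d ε R : ℝ} (hβ : 0 < β) (hd : 0 < d)
    (hε1 : ε < 1) (hR : 0 < R) : 0 < upperFactor α β d ε R := by
  have : 0 < 1 - ε := by linarith
  unfold upperFactor
  positivity

theorem upperBound_one {α β d ε R : ℝ} (hβ : 0 < β) (hd : 0 < d) {N m : ℕ} (hm : m ≤ N) :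
    upperBound α β d ε R N 1 m
      = upperFactor α β d ε R * ((N : ℝ) - m) ^ (2 / α) * (m + 21 / 8 + α / 4) := by
  have h0 : (0 : ℝ) ≤ N - m := sub_nonneg.2 (by exact_mod_cast hm)
  rw [upperBound, if_pos rfl, upperFactor, div_eq_mul_one_div ((N : ℝ) - m),
    Real.mul_rpow h0 (by positivity)]
  ring

theorem upperBound_of_one_lt {α β d ε R : ℝ} (hβ : 0 < β) (hd : 0 < d) {N k m : ℕ} (hk : 1 < k)
    (hm : k + m ≤ N) :
    upperBound α β d ε R N k m
      = upperFactor α β d ε R * ((N : ℝ) - m - k + 1) ^ (2 / α)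
        * (k * (((m / k : ℕ) : ℝ) + 5 / 8 + α / 4) / ((k : ℝ) - 1) ^ (2 / α)) := by
  have h0 : (0 : ℝ) ≤ N - m - k + 1 := by
    have : ((k + m : ℕ) : ℝ) ≤ N := by exact_mod_cast hm
    push_cast at this
    linarith
  have hk1 : (0 : ℝ) < k - 1 := by
    have : (1 : ℝ) < k := by exact_mod_cast hk
    linarith
  have hdα : 0 < d ^ α := Real.rpow_pos_of_pos hd _
  rw [upperBound, if_neg hk.ne', upperFactor, mul_assoc ((k : ℝ) - 1),
    Real.div_rpow h0 (by positivity), Real.mul_rpow hk1.le (by positivity),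
    Real.div_rpow zero_le_one (by positivity), Real.one_rpow]
  have := Real.rpow_pos_of_pos hk1 (2 / α)
  have := Real.rpow_pos_of_pos (mul_pos hdα hβ) (2 / α)
  field_simp

/-- The number `4/11` is `2/α` at the extreme `α = 11/2`. Taking eleventh powers replaces a real
exponent by an arithmetic check. -/
theorem le_rpow_of_pow_le {x p r : ℝ} (hx : 1 ≤ x) (hp : 4 / 11 ≤ p) (hr : 0 ≤ r)
    (h : r ^ 11 ≤ x ^ 4) : r ≤ x ^ p := by
  have hx0 : 0 ≤ x := by linarith
  refine le_trans ?_ (Real.rpow_le_rpow_of_exponent_le hx hp)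
  refine (pow_le_pow_iff_left₀ hr (Real.rpow_nonneg hx0 _) (show (11 : ℕ) ≠ 0 by norm_num)).1 ?_
  rw [← Real.rpow_natCast (x ^ (4 / 11 : ℝ)), ← Real.rpow_mul hx0,
    show (4 / 11 : ℝ) * (11 : ℕ) = (4 : ℕ) by norm_num, Real.rpow_natCast]
  exact h

theorem rpow_pred_bounds {p : ℝ} (hp : 4 / 11 ≤ p) {k : ℕ} (hk : 3 ≤ k) :
    3 * (k : ℝ) ≤ ((k : ℝ) - 1) ^ p * (2 * k + 1) ∧
      21 * (k : ℝ) ≤ ((k : ℝ) - 1) ^ p * (8 * k + 29) := by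
  have hk3 : (3 : ℝ) ≤ k := by exact_mod_cast hk
  rcases le_or_gt 16 k with h16 | h16
  · have hk16 : (16 : ℝ) ≤ k := by exact_mod_cast h16
    -- The number `21/8` is the ratio of the coefficients of `k` in the second inequality, and it
    -- suffices for both. The remaining `k` from `3` to `15` are checked one by one.
    have h : (21 / 8 : ℝ) ≤ ((k : ℝ) - 1) ^ p := by
      refine le_rpow_of_pow_le (by linarith) hp (by norm_num) ?_
      calc ((21 : ℝ) / 8) ^ 11 ≤ 15 ^ 4 := by norm_num
        _ ≤ ((k : ℝ) - 1) ^ 4 := by gcongr; linarith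
    constructor <;> nlinarith
  · have h1 : 3 * (k : ℝ) / (2 * k + 1) ≤ ((k : ℝ) - 1) ^ p := by
      refine le_rpow_of_pow_le (by linarith) hp (by positivity) ?_
      interval_cases k <;> norm_num
    have h2 : 21 * (k : ℝ) / (8 * k + 29) ≤ ((k : ℝ) - 1) ^ p := by
      refine le_rpow_of_pow_le (by linarith) hp (by positivity) ?_
      interval_cases k <;> norm_num
    exact ⟨(div_le_iff₀ (by positivity)).1 h1, (div_le_iff₀ (by positivity)).1 h2⟩

theorem mul_add_le_rpow_mul {α : ℝ} (hα : 2 < α) (hα' : α ≤ 11 / 2) {k c : ℕ} (hk : 1 < k)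
    (hc : α / 2 - 1 < c) :
    (k : ℝ) * (c + 5 / 8 + α / 4) ≤ ((k : ℝ) - 1) ^ (2 / α) * (k * c + 21 / 8 + α / 4) := by
  have hc1 : (1 : ℝ) ≤ c := by
    have : (0 : ℝ) < c := by linarith
    exact_mod_cast this
  -- For `k = 2` the power of `k - 1` is `1` and the claim is equivalent to `α ≤ 11/2`: this case
  -- fixes the threshold.
  rcases (show 2 ≤ k from hk).eq_or_lt with rfl | hk3
  · norm_num
    linarith
  · have hp : 4 / 11 ≤ 2 / α := by
      rw [div_le_div_iff₀ (by norm_num) (by linarith)]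
      linarith
    have hp1 : 2 / α ≤ 1 := (div_le_one (by linarith)).2 hα.le
    have hk3' : (3 : ℝ) ≤ k := by exact_mod_cast hk3
    obtain ⟨h1, h2⟩ := rpow_pred_bounds hp hk3
    have hxk : ((k : ℝ) - 1) ^ (2 / α) ≤ k := by
      calc ((k : ℝ) - 1) ^ (2 / α) ≤ ((k : ℝ) - 1) ^ (1 : ℝ) :=
            Real.rpow_le_rpow_of_exponent_le (by linarith) hp1
        _ ≤ k := by rw [Real.rpow_one]; linarith
    set x := ((k : ℝ) - 1) ^ (2 / α)
    have hA : 5 / 8 + α / 4 ≤ (c : ℝ) / 2 + 9 / 8 := by linarith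
    -- As `x ≤ k`, the term `5/8 + α/4` may be raised to its bound `c/2 + 9/8`. What remains is
    -- linear in `c ≥ 1`: the first inequality of `rpow_pred_bounds` is its slope, the second its
    -- value at `c = 1`.
    have h3 : 0 ≤ ((c : ℝ) - 1) * (x * (2 * k + 1) - 3 * k) :=
      mul_nonneg (by linarith) (by linarith)
    have h4 : 0 ≤ ((k : ℝ) - x) * ((c : ℝ) / 2 + 9 / 8 - (5 / 8 + α / 4)) :=
      mul_nonneg (by linarith) (by linarith)
    nlinarith

theorem Admissible.freedom_pos {α : ℝ} {N k m : ℕ} (h : Admissible α N k m) :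
    (0 : ℝ) < N - m - k + 1 := by
  have : ((k + m : ℕ) : ℝ) ≤ N := by exact_mod_cast h.2.1
  push_cast at this
  linarith

theorem cast_mul_div_le (k m : ℕ) : (k : ℝ) * ((m / k : ℕ) : ℝ) ≤ m := by
  exact_mod_cast Nat.mul_div_le m k

theorem upperBound_lt_single {α β d ε R : ℝ} (hα : 2 < α) (hα' : α ≤ 11 / 2) (hβ : 0 < β)
    (hd : 0 < d) (hε1 : ε < 1) (hR : 0 < R) {N k m : ℕ} (h : Admissible α N k m)
    (hk : 1 < k) :
    Admissible α N 1 m ∧ upperBound α β d ε R N k m < upperBound α β d ε R N 1 m := by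
  have hN := h.2.1
  refine ⟨h.single le_rfl (by omega), ?_⟩
  rw [upperBound_of_one_lt hβ hd hk hN, upperBound_one hβ hd (by omega)]
  have hQ := upperFactor_pos (α := α) hβ hd hε1 hR
  have hk1 : (1 : ℝ) < k := by exact_mod_cast hk
  have hx := Real.rpow_pos_of_pos (show (0 : ℝ) < k - 1 by linarith) (2 / α)
  have hy : ((N : ℝ) - m - k + 1) ^ (2 / α) < ((N : ℝ) - m) ^ (2 / α) :=
    Real.rpow_lt_rpow h.freedom_pos.le (by linarith) (by positivity)
  have hz : (k : ℝ) * (((m / k : ℕ) : ℝ) + 5 / 8 + α / 4) / ((k : ℝ) - 1) ^ (2 / α)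
      ≤ m + 21 / 8 + α / 4 := by
    rw [div_le_iff₀ hx, mul_comm _ (((k : ℝ) - 1) ^ (2 / α))]
    refine (mul_add_le_rpow_mul hα hα' hk h.2.2).trans ?_
    have := cast_mul_div_le k m
    gcongr
  have hy0 := Real.rpow_nonneg h.freedom_pos.le (2 / α)
  calc _ ≤ upperFactor α β d ε R * ((N : ℝ) - m - k + 1) ^ (2 / α) * (m + 21 / 8 + α / 4) := by
        gcongr
    _ < _ := by gcongr

/-- With `A = 5/8 + α/4`, several streams replace the factor of order `m` by at most `(m +
kA)/(k-1)^(2/α)`, where `k ≤ m`. For large `k` the denominator exceeds `1 + A`. For bounded `k` and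
large `m` the excess `kA` is at most `δm`. In both cases `m' = m` works. If `m` is bounded, so is
`k`, the bound is `O(N^(2/α))`, and `m' = ⌊N/2⌋` is far better. -/
theorem upperBound_le_single_asymptotically {α β d ε R : ℝ} (hα : 2 < α) (hβ : 0 < β)
    (hd : 0 < d) (hε1 : ε < 1) (hR : 0 < R) {δ : ℝ} (hδ : 0 < δ) :
    ∀ᶠ N : ℕ in atTop, ∀ k m : ℕ, Admissible α N k m → ∃ m' : ℕ, Admissible α N 1 m' ∧
      upperBound α β d ε R N k m ≤ (1 + δ) * upperBound α β d ε R N 1 m' := by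
  have hQ := upperFactor_pos (α := α) hβ hd hε1 hR
  have hp : 0 < 2 / α := by positivity
  have hp1 : 2 / α ≤ 1 := (div_le_one (by linarith)).2 hα.le
  set A := 5 / 8 + α / 4 with hA
  have hA0 : 0 < A := by positivity
  obtain ⟨K, hK⟩ := (((tendsto_rpow_atTop hp).comp (tendsto_atTop_add_const_right atTop (-1 : ℝ)
    tendsto_natCast_atTop_atTop)).eventually_ge_atTop (1 + A)).exists_forall_of_atTop
  simp only [Function.comp_apply, ← sub_eq_add_neg] at hK
  set M := A * K / δ + 1 with hM
  have hM1 : 1 ≤ M := by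
    have : 0 ≤ A * K / δ := by positivity
    linarith
  filter_upwards [tendsto_natCast_atTop_atTop.eventually_ge_atTop (4 * (M * (1 + A))),
    tendsto_natCast_atTop_atTop.eventually_ge_atTop (2 * M + 2)] with N hN1 hN2 k m h
  have hN := h.2.1
  rcases (show 1 ≤ k from h.1).eq_or_lt with rfl | hk
  · refine ⟨m, h, ?_⟩
    have h0 : 0 ≤ upperBound α β d ε R N 1 m := by
      rw [upperBound_one hβ hd (by omega)]
      have : (0 : ℝ) ≤ N - m := sub_nonneg.2 (by exact_mod_cast (by omega : m ≤ N))
      positivity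
    nlinarith
  have hk1 : (1 : ℝ) < k := by exact_mod_cast hk
  have hkm : (k : ℝ) ≤ m := by exact_mod_cast h.le_right hα
  have hx1 : 1 ≤ ((k : ℝ) - 1) ^ (2 / α) := by
    refine Real.one_le_rpow ?_ hp.le
    have : (2 : ℝ) ≤ k := by exact_mod_cast hk
    linarith
  have hcm := cast_mul_div_le k m
  have hy0 := Real.rpow_nonneg h.freedom_pos.le (2 / α)
  rw [upperBound_of_one_lt hβ hd hk hN]
  have hnum : (k : ℝ) * (((m / k : ℕ) : ℝ) + 5 / 8 + α / 4) ≤ m + k * A := by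
    rw [hA]
    linarith
  rcases le_or_gt M m with hmM | hmM
  · refine ⟨m, h.single le_rfl (by omega), ?_⟩
    rw [upperBound_one hβ hd (by omega)]
    have hy : ((N : ℝ) - m - k + 1) ^ (2 / α) ≤ ((N : ℝ) - m) ^ (2 / α) :=
      Real.rpow_le_rpow h.freedom_pos.le (by linarith) hp.le
    have hz : (k : ℝ) * (((m / k : ℕ) : ℝ) + 5 / 8 + α / 4) / ((k : ℝ) - 1) ^ (2 / α)
        ≤ (1 + δ) * (m + 21 / 8 + α / 4) := by
      rw [div_le_iff₀ (by positivity)]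
      have hm0 : (0 : ℝ) ≤ m := Nat.cast_nonneg m
      have hgoal : (1 + δ) * m * 1 ≤ (1 + δ) * (m + 21 / 8 + α / 4) * ((k : ℝ) - 1) ^ (2 / α) := by
        gcongr
        linarith
      rcases le_or_gt K k with hKk | hKk
      · have hxA := hK k hKk
        calc _ ≤ (m : ℝ) + k * A := hnum
          _ ≤ 1 * m * (1 + A) := by nlinarith
          _ ≤ (1 + δ) * (m + 21 / 8 + α / 4) * ((k : ℝ) - 1) ^ (2 / α) := by
            gcongr
            · linarith
            · linarith
      · have hkK : (k : ℝ) ≤ K := by exact_mod_cast hKk.le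
        have : A * K ≤ δ * m := by
          have : A * K / δ ≤ m := by linarith
          rwa [div_le_iff₀ hδ, mul_comm (m : ℝ)] at this
        nlinarith
    have hNm : (0 : ℝ) ≤ N - m := sub_nonneg.2 (by exact_mod_cast (by omega : m ≤ N))
    calc _ ≤ upperFactor α β d ε R * ((N : ℝ) - m) ^ (2 / α) *
          ((1 + δ) * (m + 21 / 8 + α / 4)) := by gcongr
      _ = _ := by ring
  · have hmN : m ≤ N / 2 := by
      have : (2 : ℝ) * m + 2 ≤ N := by linarith
      have : 2 * m + 2 ≤ N := by exact_mod_cast this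
      omega
    have hN2' : 2 ≤ N := by
      have : (2 : ℝ) ≤ N := by linarith
      exact_mod_cast this
    refine ⟨N / 2, h.single hmN (by omega), ?_⟩
    rw [upperBound_one hβ hd (by omega)]
    have hNpos : (0 : ℝ) < N := by positivity
    have hhalf1 : (N : ℝ) / 2 ≤ N - (N / 2 : ℕ) := by
      have := Nat.cast_div_le (α := ℝ) (m := N) (n := 2)
      push_cast at this
      linarith
    have hhalf2 : (N : ℝ) / 2 ≤ (N / 2 : ℕ) + 21 / 8 + α / 4 := by
      have : (N : ℝ) ≤ 2 * (N / 2 : ℕ) + 1 := by exact_mod_cast (by omega : N ≤ 2 * (N / 2) + 1)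
      linarith
    have hy : ((N : ℝ) - m - k + 1) ^ (2 / α) ≤ (N : ℝ) ^ (2 / α) := by
      refine Real.rpow_le_rpow h.freedom_pos.le ?_ hp.le
      have : (0 : ℝ) ≤ m := Nat.cast_nonneg m
      linarith
    have h2p : (N : ℝ) ^ (2 / α) ≤ 2 * ((N : ℝ) / 2) ^ (2 / α) := by
      calc (N : ℝ) ^ (2 / α) = (2 * ((N : ℝ) / 2)) ^ (2 / α) := by congr 1; ring
        _ = 2 ^ (2 / α) * ((N : ℝ) / 2) ^ (2 / α) := Real.mul_rpow (by norm_num) (by positivity)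
        _ ≤ 2 ^ (1 : ℝ) * ((N : ℝ) / 2) ^ (2 / α) := by
          gcongr
          norm_num
        _ = _ := by rw [Real.rpow_one]
    calc upperFactor α β d ε R * ((N : ℝ) - m - k + 1) ^ (2 / α)
        * (k * (((m / k : ℕ) : ℝ) + 5 / 8 + α / 4) / ((k : ℝ) - 1) ^ (2 / α))
        ≤ upperFactor α β d ε R * (N : ℝ) ^ (2 / α) * (M * (1 + A)) := by
          gcongr
          rw [div_le_iff₀ (by positivity)]
          calc _ ≤ (m : ℝ) + k * A := hnum
            _ ≤ M * (1 + A) * 1 := by nlinarith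
            _ ≤ _ := by gcongr
      _ ≤ upperFactor α β d ε R * (2 * ((N : ℝ) / 2) ^ (2 / α)) * (N / 4) := by
          gcongr
          linarith
      _ = 1 * (upperFactor α β d ε R * ((N : ℝ) / 2) ^ (2 / α) * (N / 2)) := by ring
      _ ≤ (1 + δ) * (upperFactor α β d ε R * ((N : ℝ) - (N / 2 : ℕ)) ^ (2 / α) *
          ((N / 2 : ℕ) + 21 / 8 + α / 4)) := by
          have hhalf0 : (0 : ℝ) ≤ N - (N / 2 : ℕ) := by linarith
          gcongr
          linarith

/-! ### Largest possible growth in the number of antennas -/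

theorem lowerBound_le_linear {α β d ε R : ℝ} (hα : 2 < α) (hβ : 0 < β) (hd : 0 < d)
    (hε0 : 0 < ε) (hε1 : ε < 1) (hR : 0 < R) :
    ∃ K : ℝ, 0 ≤ K ∧ ∀ N k m : ℕ, Admissible α N k m → lowerBound α β d ε R N k m ≤ K * N := by
  have hlog : 0 ≤ -Real.log (1 - ε) := by
    have := Real.log_nonpos (by linarith : 0 ≤ 1 - ε) (by linarith)
    linarith
  have ha : 0 < α / 2 - 1 := by linarith
  have hε' : 0 < 1 - ε := by linarith
  have hdα : 0 < d ^ α := Real.rpow_pos_of_pos hd _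
  have hp1 : 0 ≤ 1 - 2 / α := sub_nonneg.2 ((div_le_one (by linarith)).2 hα.le)
  set E := -Real.log (1 - ε) + 1 with hE
  refine ⟨R * (1 - ε) / Real.pi * ((α / 2 - 1) / (β * d ^ α)) ^ (2 / α) * E ^ (2 / α),
    by positivity, fun N k m h => ?_⟩
  rw [lowerBound_eq hα hβ hd hε0 hε1 h.1 h.2.1]
  have hN1 : (1 : ℝ) ≤ N := by
    have h1 := h.1
    have h2 := h.2.1
    exact_mod_cast (by omega : 1 ≤ N)
  have hen : energy ε N (k + m) ≤ E * N := by
    unfold energy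
    split_ifs
    · nlinarith
    · have : (0 : ℝ) ≤ (k + m : ℕ) := Nat.cast_nonneg _
      nlinarith
  have hkc : (k : ℝ) * ((m / k : ℕ) + 1) ≤ N := by
    exact_mod_cast h.mul_div_add_one_le.trans h.2.1
  have he0 := energy_pos hε0 hε1 h.2.1
  rw [mul_assoc _ (E ^ (2 / α))]
  refine mul_le_mul_of_nonneg_left
    (a := R * (1 - ε) / Real.pi * ((α / 2 - 1) / (β * d ^ α)) ^ (2 / α))
    ?_ (by positivity)
  -- The energy is at most `E N` and `k(c + 1)` at most `N`. The exponents `2/α` and `1 - 2/α` add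
  -- up to one.
  calc energy ε N (k + m) ^ (2 / α) * ((k : ℝ) * ((m / k : ℕ) + 1)) ^ (1 - 2 / α)
      ≤ (E * N) ^ (2 / α) * (N : ℝ) ^ (1 - 2 / α) := by gcongr
    _ = E ^ (2 / α) * N := by
      rw [Real.mul_rpow (by positivity) (by positivity), mul_assoc, ← Real.rpow_add (by linarith),
        add_sub_cancel, Real.rpow_one]

theorem upperBound_le_rpow {α β d ε R : ℝ} (hα : 2 < α) (hβ : 0 < β) (hd : 0 < d)
    (hε1 : ε < 1) (hR : 0 < R) :
    ∃ K : ℝ, 0 ≤ K ∧ ∀ N k m : ℕ, Admissible α N k m →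
      upperBound α β d ε R N k m ≤ K * (N : ℝ) ^ (1 + 2 / α) := by
  have hQ := upperFactor_pos (α := α) hβ hd hε1 hR
  have hp : 0 < 2 / α := by positivity
  refine ⟨upperFactor α β d ε R * (1 + 21 / 8 + α / 4), by positivity, fun N k m h => ?_⟩
  have hN := h.2.1
  have hk := h.1
  have hN1 : (1 : ℝ) ≤ N := by exact_mod_cast (by omega : 1 ≤ N)
  have hmN : (m : ℝ) ≤ N := by exact_mod_cast (by omega : m ≤ N)
  have hkm : ((k + m : ℕ) : ℝ) ≤ N := by exact_mod_cast hN
  push_cast at hkm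
  have hm0 : (0 : ℝ) ≤ m := Nat.cast_nonneg m
  have hk0 : (1 : ℝ) ≤ k := by exact_mod_cast hk
  have hpow : (N : ℝ) ^ (1 + 2 / α) = (N : ℝ) ^ (2 / α) * N := by
    rw [add_comm, Real.rpow_add (by linarith), Real.rpow_one]
  rw [hpow]
  have hα0 : 0 < α := by linarith
  rcases hk.eq_or_lt with rfl | hk
  · rw [upperBound_one hβ hd (by omega)]
    have h0 : (0 : ℝ) ≤ N - m := by linarith
    calc _ ≤ upperFactor α β d ε R * (N : ℝ) ^ (2 / α) * ((1 + 21 / 8 + α / 4) * N) := by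
          gcongr
          · linarith
          · nlinarith
      _ = _ := by ring
  · rw [upperBound_of_one_lt hβ hd hk hN]
    have hx1 : 1 ≤ ((k : ℝ) - 1) ^ (2 / α) := by
      refine Real.one_le_rpow ?_ hp.le
      have : (2 : ℝ) ≤ k := by exact_mod_cast hk
      linarith
    have hy0 := h.freedom_pos
    have hcm := cast_mul_div_le k m
    calc _ ≤ upperFactor α β d ε R * (N : ℝ) ^ (2 / α) * ((1 + 21 / 8 + α / 4) * N) := by
          gcongr
          · linarith
          · rw [div_le_iff₀ (by linarith)]
            refine le_trans ?_ (le_mul_of_one_le_right (by positivity) hx1)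
            nlinarith
      _ = _ := by ring

/-! ### The profile of the lower bound for a single stream -/

/-- The profile of the lower bound for a single stream as a function of the fraction of degrees of
freedom that is used for cancelation. -/
def profile (p θ : ℝ) : ℝ := (1 - θ) ^ p * θ ^ (1 - p)

theorem profile_pos {p θ : ℝ} (h0 : 0 < θ) (h1 : θ < 1) : 0 < profile p θ :=
  mul_pos (Real.rpow_pos_of_pos (by linarith) _) (Real.rpow_pos_of_pos h0 _)

theorem log_profile {p θ : ℝ} (h0 : 0 < θ) (h1 : θ < 1) :
    Real.log (profile p θ) = p * Real.log (1 - θ) + (1 - p) * Real.log θ := by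
  have h2 : 0 < 1 - θ := by linarith
  rw [profile, Real.log_mul (Real.rpow_pos_of_pos h2 _).ne' (Real.rpow_pos_of_pos h0 _).ne',
    Real.log_rpow h2, Real.log_rpow h0]

/-- The sign condition puts `y` between `x` and the peak `1 - p`, the peak included. The difference
of the logarithms is bounded with `log u ≤ u - 1`, strictly in one term since `x ≠ y`, and the
resulting expression is `(y - x)(y - (1 - p))/(y(1 - y))`. This covers both monotone branches and
the maximum without derivatives. -/
theorem profile_lt_profile {p x y : ℝ} (hp0 : 0 < p) (hp1 : p < 1) (hx0 : 0 < x) (hx1 : x < 1)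
    (hy0 : 0 < y) (hy1 : y < 1) (hxy : x ≠ y) (h : (y - x) * (y - (1 - p)) ≤ 0) :
    profile p x < profile p y := by
  rw [← Real.log_lt_log_iff (profile_pos hx0 hx1) (profile_pos hy0 hy1), log_profile hx0 hx1,
    log_profile hy0 hy1]
  have hx2 : 0 < 1 - x := by linarith
  have hy2 : 0 < 1 - y := by linarith
  have h1 : Real.log (1 - x) - Real.log (1 - y) ≤ (1 - x) / (1 - y) - 1 := by
    rw [← Real.log_div hx2.ne' hy2.ne']
    exact Real.log_le_sub_one_of_pos (by positivity)
  have h2 : Real.log x - Real.log y < x / y - 1 := by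
    rw [← Real.log_div hx0.ne' hy0.ne']
    refine Real.log_lt_sub_one_of_pos (by positivity) fun h => hxy ?_
    rwa [div_eq_one_iff_eq hy0.ne'] at h
  have h3 : p * ((1 - x) / (1 - y) - 1) + (1 - p) * (x / y - 1)
      = (y - x) * (y - (1 - p)) / (y * (1 - y)) := by
    field_simp
    ring
  have h4 : (y - x) * (y - (1 - p)) / (y * (1 - y)) ≤ 0 :=
    div_nonpos_of_nonpos_of_nonneg h (by positivity)
  nlinarith [mul_le_mul_of_nonneg_left h1 hp0.le, mul_lt_mul_of_pos_left h2 (sub_pos.2 hp1)]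

/-- An exact identity at finite `N`: the natural fraction is `(m + 1)/N`, since the desired stream
uses one degree of freedom too. Both the limit and the discrete optimum are read off from it. -/
theorem lowerBound_one {α β d ε R : ℝ} (hα : 2 < α) (hβ : 0 < β) (hd : 0 < d)
    (hε0 : 0 < ε) (hε1 : ε < 1) {N m : ℕ} (hm : m + 1 < N) :
    lowerBound α β d ε R N 1 m
      = R * (1 - ε) / Real.pi * (ε * (α / 2 - 1) / (β * d ^ α)) ^ (2 / α)
        * (N * profile (2 / α) (((m + 1 : ℕ) : ℝ) / N)) := by
  have hN : (0 : ℝ) < N := by exact_mod_cast (by omega : 0 < N)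
  have hm' : ((m + 1 : ℕ) : ℝ) < N := by exact_mod_cast hm
  have ha : 0 < α / 2 - 1 := by linarith
  have h1 : (0 : ℝ) < N - (m + 1 : ℕ) := by linarith
  have h2 : (1 : ℝ) - (m + 1 : ℕ) / N = (N - (m + 1 : ℕ)) / N := by field_simp
  rw [lowerBound_eq hα hβ hd hε0 hε1 le_rfl (by omega), energy, if_neg (by omega), profile,
    Nat.div_one, add_comm 1 m, Nat.cast_one, one_mul, h2, Real.div_rpow h1.le hN.le,
    Real.div_rpow (Nat.cast_nonneg _) hN.le, Real.mul_rpow h1.le hε0.le,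
    mul_div_assoc ε, Real.mul_rpow hε0.le (by positivity), Real.rpow_sub hN, Real.rpow_one,
    Nat.cast_succ]
  have := Real.rpow_pos_of_pos hN (2 / α)
  field_simp

theorem lowerBound_full {α β d ε R : ℝ} (hα : 2 < α) (hβ : 0 < β) (hd : 0 < d)
    (hε0 : 0 < ε) (hε1 : ε < 1) {N m : ℕ} (hm : m + 1 = N) :
    lowerBound α β d ε R N 1 m
      = R * (1 - ε) / Real.pi * ((α / 2 - 1) / (β * d ^ α)) ^ (2 / α)
        * ((-Real.log (1 - ε)) ^ (2 / α) * (N : ℝ) ^ (1 - 2 / α)) := by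
  rw [lowerBound_eq hα hβ hd hε0 hε1 le_rfl (by omega), energy, if_pos (by omega), ← hm]
  simp

/-- With every degree of freedom spent, the energy no longer grows with `N` and the lower bound has
order `N^(1-2/α)` only. This excludes the boundary case as an optimum. -/
theorem tendsto_lowerBound_full_div {α β d ε R : ℝ} (hα : 2 < α) (hβ : 0 < β) (hd : 0 < d)
    (hε0 : 0 < ε) (hε1 : ε < 1) :
    Tendsto (fun N : ℕ => lowerBound α β d ε R N 1 (N - 1) / N) atTop (𝓝 0) := by
  have h := ((tendsto_rpow_neg_atTop (show 0 < 2 / α by positivity)).comp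
    tendsto_natCast_atTop_atTop).const_mul (R * (1 - ε) / Real.pi *
      ((α / 2 - 1) / (β * d ^ α)) ^ (2 / α) * (-Real.log (1 - ε)) ^ (2 / α))
  rw [mul_zero] at h
  refine h.congr' ?_
  filter_upwards [eventually_gt_atTop 0] with N hN
  have hN' : (0 : ℝ) < N := by exact_mod_cast hN
  rw [lowerBound_full hα hβ hd hε0 hε1 (by omega), Function.comp_apply, Real.rpow_neg hN'.le,
    Real.rpow_sub hN', Real.rpow_one]
  field_simp

/-! ### Asymptotics for a fixed fraction and the optimal fraction -/

section Fraction

variable {θ : ℝ} {m : ℕ → ℕ}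

theorem tendsto_cast_of_tendsto_div (hθ0 : 0 < θ)
    (hm : Tendsto (fun N : ℕ => (m N : ℝ) / N) atTop (𝓝 θ)) :
    Tendsto (fun N => (m N : ℝ)) atTop atTop := by
  refine (hm.pos_mul_atTop hθ0 tendsto_natCast_atTop_atTop).congr' ?_
  filter_upwards [eventually_gt_atTop 0] with N hN
  have : (N : ℝ) ≠ 0 := by positivity
  field_simp

theorem tendsto_cast_succ_div (hm : Tendsto (fun N : ℕ => (m N : ℝ) / N) atTop (𝓝 θ)) :
    Tendsto (fun N : ℕ => ((m N + 1 : ℕ) : ℝ) / N) atTop (𝓝 θ) := by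
  have := hm.add (tendsto_one_div_atTop_nhds_zero_nat (𝕜 := ℝ))
  rw [add_zero] at this
  refine this.congr fun N => ?_
  push_cast
  ring

theorem eventually_succ_lt (hθ1 : θ < 1)
    (hm : Tendsto (fun N : ℕ => (m N : ℝ) / N) atTop (𝓝 θ)) : ∀ᶠ N in atTop, m N + 1 < N := by
  filter_upwards [(tendsto_cast_succ_div hm).eventually_lt_const hθ1, eventually_gt_atTop 0]
    with N h1 h2
  rw [div_lt_one (by positivity)] at h1
  exact_mod_cast h1

theorem eventually_admissible {α : ℝ} (hθ0 : 0 < θ) (hθ1 : θ < 1)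
    (hm : Tendsto (fun N : ℕ => (m N : ℝ) / N) atTop (𝓝 θ)) :
    ∀ᶠ N in atTop, Admissible α N 1 (m N) := by
  filter_upwards [eventually_succ_lt hθ1 hm,
    (tendsto_cast_of_tendsto_div hθ0 hm).eventually_gt_atTop (α / 2 - 1)] with N h1 h2
  refine ⟨le_rfl, by omega, ?_⟩
  rwa [Nat.div_one]

theorem tendsto_lowerBound_div {α β d ε R : ℝ} (hα : 2 < α) (hβ : 0 < β) (hd : 0 < d)
    (hε0 : 0 < ε) (hε1 : ε < 1) (hθ0 : 0 < θ) (hθ1 : θ < 1)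
    (hm : Tendsto (fun N : ℕ => (m N : ℝ) / N) atTop (𝓝 θ)) :
    Tendsto (fun N : ℕ => lowerBound α β d ε R N 1 (m N) / N) atTop
      (𝓝 (R * (1 - ε) / Real.pi * (ε * (α / 2 - 1) / (β * d ^ α)) ^ (2 / α)
        * profile (2 / α) θ)) := by
  have h1 := tendsto_cast_succ_div hm
  have h2 : Tendsto (fun N : ℕ => profile (2 / α) (((m N + 1 : ℕ) : ℝ) / N)) atTop
      (𝓝 (profile (2 / α) θ)) :=
    ((h1.const_sub 1).rpow_const (Or.inl (by linarith))).mul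
      (h1.rpow_const (Or.inl hθ0.ne'))
  refine (h2.const_mul _).congr' ?_
  filter_upwards [eventually_succ_lt hθ1 hm] with N hN
  have hN' : (N : ℝ) ≠ 0 := by exact_mod_cast (by omega : N ≠ 0)
  rw [lowerBound_one hα hβ hd hε0 hε1 hN]
  field_simp

theorem isTheta_upperBound {α β d ε R : ℝ} (hβ : 0 < β) (hd : 0 < d)
    (hε1 : ε < 1) (hR : 0 < R) (hθ0 : 0 < θ) (hθ1 : θ < 1)
    (hm : Tendsto (fun N : ℕ => (m N : ℝ) / N) atTop (𝓝 θ)) :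
    (fun N : ℕ => upperBound α β d ε R N 1 (m N)) =Θ[atTop]
      (fun N : ℕ => (N : ℝ) ^ (1 + 2 / α)) := by
  have hQ := upperFactor_pos (α := α) hβ hd hε1 hR
  have h1 := ((hm.const_sub 1).rpow_const (p := 2 / α) (Or.inl (by linarith))).const_mul
    (upperFactor α β d ε R)
  have h2 := hm.add ((tendsto_const_div_atTop_nhds_zero_nat (𝕜 := ℝ) (21 / 8 + α / 4)))
  rw [add_zero] at h2
  have hθ2 : 0 < 1 - θ := by linarith
  refine IsTheta.symm <| isTheta_of_div_tendsto_nhds_ne_zero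
    (c := upperFactor α β d ε R * (1 - θ) ^ (2 / α) * θ) ?_ (by positivity)
  refine (h1.mul h2).congr' ?_
  filter_upwards [eventually_succ_lt hθ1 hm] with N hN
  have hN' : (0 : ℝ) < N := by exact_mod_cast (by omega : 0 < N)
  have hNm : (0 : ℝ) ≤ N - m N := sub_nonneg.2 (by exact_mod_cast (by omega : m N ≤ N))
  have := Real.rpow_pos_of_pos hN' (2 / α)
  rw [upperBound_one hβ hd (by omega),
    show 1 - (m N : ℝ) / N = (N - m N) / N by field_simp, Real.div_rpow hNm hN'.le,
    Real.rpow_add hN', Real.rpow_one]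
  field_simp
  ring

end Fraction

theorem tendsto_floor_pred_div {θ : ℝ} (hθ : 0 < θ) :
    Tendsto (fun N : ℕ => ((⌊θ * (N : ℝ)⌋₊ - 1 : ℕ) : ℝ) / N) atTop (𝓝 θ) := by
  have h := ((tendsto_nat_floor_mul_div_atTop hθ.le).comp
    (tendsto_natCast_atTop_atTop (R := ℝ))).sub (tendsto_one_div_atTop_nhds_zero_nat (𝕜 := ℝ))
  rw [sub_zero] at h
  refine h.congr' ?_
  filter_upwards [(tendsto_natCast_atTop_atTop.const_mul_atTop hθ).eventually_ge_atTop 1]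
    with N hN
  have : 1 ≤ ⌊θ * (N : ℝ)⌋₊ := (Nat.one_le_floor_iff _).2 hN
  rw [Nat.cast_sub this, Function.comp_apply, Nat.cast_one, sub_div]

theorem eventually_eq_floor_or_eq_ceil {α β d ε R : ℝ} (hα : 2 < α) (hβ : 0 < β) (hd : 0 < d)
    (hε0 : 0 < ε) (hε1 : ε < 1) (hR : 0 < R) :
    ∀ᶠ N : ℕ in atTop, ∀ m : ℕ, Admissible α N 1 m →
      (∀ k' m' : ℕ, Admissible α N k' m' →
        lowerBound α β d ε R N k' m' ≤ lowerBound α β d ε R N 1 m) →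
      m + 1 = ⌊(1 - 2 / α) * N⌋₊ ∨ m + 1 = ⌈(1 - 2 / α) * N⌉₊ := by
  have hp0 : 0 < 2 / α := by positivity
  have hp1 : 2 / α < 1 := (div_lt_one (by linarith)).2 hα
  have ha : 0 < α / 2 - 1 := by linarith
  have hε' : 0 < 1 - ε := by linarith
  set t := 1 - 2 / α with ht
  have ht0 : 0 < t := by linarith
  have ht1 : t < 1 := by linarith
  have hfl := tendsto_floor_pred_div ht0
  set C := R * (1 - ε) / Real.pi * (ε * (α / 2 - 1) / (β * d ^ α)) ^ (2 / α) with hC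
  have hC0 : 0 < C := by positivity
  have hlim := tendsto_lowerBound_div (R := R) hα hβ hd hε0 hε1 ht0 ht1 hfl
  have hpos : 0 < C * profile (2 / α) t := mul_pos hC0 (profile_pos ht0 ht1)
  filter_upwards [eventually_admissible (α := α) ht0 ht1 hfl, eventually_succ_lt ht1 hfl,
    hlim.eventually_const_lt (half_lt_self hpos),
    (tendsto_lowerBound_full_div (R := R) hα hβ hd hε0 hε1).eventually_lt_const (half_pos hpos),
    (tendsto_natCast_atTop_atTop.const_mul_atTop ht0).eventually_ge_atTop 1]
    with N hadm hFN hF1 hN1 htN m hm hmax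
  have hN0 : 0 < N := by omega
  have hN : (0 : ℝ) < N := by exact_mod_cast hN0
  have hF0 : 1 ≤ ⌊t * (N : ℝ)⌋₊ := (Nat.one_le_floor_iff _).2 htN
  have hFle : (⌊t * (N : ℝ)⌋₊ : ℝ) ≤ t * N := Nat.floor_le (by positivity)
  have hCle : t * N ≤ (⌈t * (N : ℝ)⌉₊ : ℝ) := Nat.le_ceil _
  have hFC : ⌊t * (N : ℝ)⌋₊ ≤ ⌈t * (N : ℝ)⌉₊ := Nat.floor_le_ceil _
  have hCF : ⌈t * (N : ℝ)⌉₊ ≤ ⌊t * (N : ℝ)⌋₊ + 1 := Nat.ceil_le_floor_add_one _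
  set F := ⌊t * (N : ℝ)⌋₊
  set G := ⌈t * (N : ℝ)⌉₊
  have hmN := hm.2.1
  -- The competitor with `m' + 1 = ⌊tN⌋` exceeds half of its linear limit, while the boundary choice
  -- lies below that half for large `N`.
  have hne : m + 1 ≠ N := by
    intro h
    have h1 := hmax _ _ hadm
    have h2 : m = N - 1 := by omega
    rw [← h2] at hN1
    have := hF1.trans_le (div_le_div_of_nonneg_right h1 hN.le)
    exact absurd (this.trans hN1) (lt_irrefl _)
  -- No admissible `j` other than `m + 1` may lie between `m + 1` and `tN`, because moving there
  -- would strictly increase the profile. Taking `j` as the floor or the ceiling of `tN` confines `m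
  -- + 1`.
  have key : ∀ j : ℕ, 1 ≤ j → j < N → j ≠ m + 1 → Admissible α N 1 (j - 1) →
      ((j : ℝ) - (m + 1 : ℕ)) * (j - t * N) ≤ 0 → False := by
    intro j hj hjN hjm hja hsign
    have h1 := hmax _ _ hja
    rw [lowerBound_one hα hβ hd hε0 hε1 (by omega : m + 1 < N),
      lowerBound_one hα hβ hd hε0 hε1 (by omega : j - 1 + 1 < N), Nat.sub_add_cancel hj] at h1
    refine absurd h1 (not_le.2 ?_)
    have hj0 : (0 : ℝ) < j := by exact_mod_cast hj
    have hjN' : (j : ℝ) < N := by exact_mod_cast hjN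
    have hmN' : ((m + 1 : ℕ) : ℝ) < N := by exact_mod_cast (by omega : m + 1 < N)
    have hm0 : (0 : ℝ) < (m + 1 : ℕ) := by positivity
    have := profile_lt_profile hp0 hp1 (x := ((m + 1 : ℕ) : ℝ) / N) (y := (j : ℝ) / N)
      (by positivity) ((div_lt_one hN).2 hmN') (by positivity) ((div_lt_one hN).2 hjN')
      (fun h => hjm (by rw [div_left_inj' hN.ne'] at h; exact_mod_cast h.symm))
      (by
        have : ((j : ℝ) / N - ((m + 1 : ℕ) : ℝ) / N) * ((j : ℝ) / N - t)
            = ((j : ℝ) - (m + 1 : ℕ)) * (j - t * N) / N ^ 2 := by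
          field_simp
        rw [this]
        exact div_nonpos_of_nonpos_of_nonneg hsign (by positivity))
    gcongr
  have hlow : F ≤ m + 1 := by
    by_contra! h
    refine key F hF0 (by omega) (by omega) hadm (mul_nonpos_of_nonneg_of_nonpos ?_ (by linarith))
    have : ((m + 1 : ℕ) : ℝ) < F := by exact_mod_cast h
    linarith
  have hhigh : m + 1 ≤ G := by
    by_contra! h
    refine key G (by omega) (by omega) (by omega) (hadm.single (by omega) (by omega))
      (mul_nonpos_of_nonpos_of_nonneg ?_ (by linarith))
    have : (G : ℝ) < (m + 1 : ℕ) := by exact_mod_cast h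
    linarith
  omega

/-- Nonnegativity of `B` takes care of an empty set of intensities, whose supremum is `0` by
convention. -/
theorem capacity_le_of_forall {Ω : Type*} [MeasurableSpace Ω] {μ : Measure Ω}
    {T : ℝ → ℕ → Ω → Plane} {h : ℕ → ℕ → ℕ → Ω → ℂ} {α β d ε R B : ℝ} {N k m : ℕ}
    (hε1 : ε < 1) (hR : 0 < R) (hk : 1 ≤ k) (hB : 0 ≤ B)
    (hall : ∀ lam : ℝ, 0 < lam → outageProb μ α β d (T lam) h N k m 0 ≤ ε →
      k * lam * (1 - ε) * R ≤ B) :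
    capacity μ α β d ε R T h N k m ≤ B := by
  have hε' : 0 < 1 - ε := by linarith
  have hk0 : (0 : ℝ) < k := by exact_mod_cast hk
  have h1 : sSup {lam : ℝ | 0 < lam ∧ outageProb μ α β d (T lam) h N k m 0 ≤ ε}
      ≤ B / (k * (1 - ε) * R) := by
    refine Real.sSup_le (fun lam hl => ?_) (by positivity)
    rw [le_div_iff₀ (by positivity)]
    refine (le_of_eq ?_).trans (hall lam hl.1 hl.2)
    ring
  rw [le_div_iff₀ (by positivity)] at h1
  refine (le_of_eq ?_).trans h1
  rw [capacity]
  ring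

/-! ### Upper bounds on the capacity -/

section Capacity

variable {Ω : Type*} [MeasurableSpace Ω] {μ : Measure Ω} [IsProbabilityMeasure μ]
  {T : ℝ → ℕ → Ω → Plane} {h : ℕ → ℕ → ℕ → Ω → ℂ} {α β d ε R : ℝ} {N k m : ℕ}

/-- Subadditivity suffices, so measurability of the SIR is not required. -/
theorem one_sub_le_of_outageProb_le {T : ℕ → Ω → Plane} {l : ℕ}
    (ho : outageProb μ α β d T h N k m l ≤ ε) :
    1 - ε ≤ μ.real {ω | ENNReal.ofReal β < sir α d T h N k (m / k) l ω} := by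
  have h1 := measureReal_union_le (μ := μ) {ω | sir α d T h N k (m / k) l ω ≤ ENNReal.ofReal β}
    {ω | ENNReal.ofReal β < sir α d T h N k (m / k) l ω}
  have h2 : {ω | sir α d T h N k (m / k) l ω ≤ ENNReal.ofReal β} ∪
      {ω | ENNReal.ofReal β < sir α d T h N k (m / k) l ω} = Set.univ :=
    Set.eq_univ_of_forall fun ω => by
      simpa using le_or_gt (sir α d T h N k (m / k) l ω) (ENNReal.ofReal β)
  rw [h2, probReal_univ] at h1
  unfold outageProb at ho
  linarith

theorem Admissible.nulled_lt (hadm : Admissible α N k m) : k - 1 + k * (m / k) < N := by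
  have h1 := hadm.1
  have h2 := hadm.2.1
  have := Nat.mul_div_le m k
  omega

/-- Markov's inequality bounds `β(1 - ε)` by a multiple of `(πλ)^(-α/2)`. Solving for `πλ` leaves
the power `2/α` of a Gamma ratio, to which `Gamma_ratio_rpow_le` applies. The number `M` of
interferers taken into account stays free for later choice. -/
theorem intensity_le (hnet : IsNetwork μ T h) (hα : 2 < α) (hβ : 0 < β) (hd : 0 < d)
    (hε1 : ε < 1) (hadm : Admissible α N k m) {lam : ℝ} (hlam : 0 < lam)
    (ho : outageProb μ α β d (T lam) h N k m 0 ≤ ε) {M : ℕ} (hM : 2 ≤ M * k) :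
    Real.pi * lam ≤
      ((N - (k - 1 + k * (m / k)) : ℕ) / ((((M * k : ℕ) : ℝ) - 1) * ((1 - ε) * (d ^ α * β))))
        ^ (2 / α) * ((m / k : ℕ) + M + α / 4 - 3 / 8) := by
  have h1 := mul_measure_lt_sir_le hnet hlam hα hd (show 0 < k from hadm.1) hadm.nulled_lt hM β
  have h2 := one_sub_le_of_outageProb_le ho
  have hc := hadm.2.2
  set c := m / k
  set D : ℝ := ((N - (k - 1 + k * c) : ℕ) : ℝ)
  have hD0 : 0 ≤ D := Nat.cast_nonneg _
  have hc0 : (0 : ℝ) < c := by linarith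
  have hM1 : (0 : ℝ) < (M * k : ℕ) - 1 := by
    have : ((2 : ℕ) : ℝ) ≤ (M * k : ℕ) := by exact_mod_cast hM
    push_cast at this ⊢
    linarith
  have hM0 : (0 : ℝ) ≤ M := Nat.cast_nonneg _
  have hG1 := Real.Gamma_pos_of_pos (show (0 : ℝ) < c + M by linarith)
  have hG2 := Real.Gamma_pos_of_pos (show (0 : ℝ) < c + M + α / 2 by linarith)
  have hdα : 0 < d ^ α := Real.rpow_pos_of_pos hd _
  have hε' : 0 < 1 - ε := by linarith
  have hpl : 0 < Real.pi * lam := by positivity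
  have hpa : 0 < (Real.pi * lam) ^ (α / 2) := Real.rpow_pos_of_pos hpl _
  have h3 := ENNReal.toReal_mono ENNReal.ofReal_ne_top h1
  rw [ENNReal.toReal_mul, ENNReal.toReal_ofReal hβ.le, ENNReal.toReal_ofReal (by positivity),
    Real.rpow_neg hd.le, Real.rpow_neg hpl.le] at h3
  have h4 : β * (1 - ε) ≤ (d ^ α)⁻¹ * D * ((M * k : ℕ) - 1 : ℝ)⁻¹ *
      (((Real.pi * lam) ^ (α / 2))⁻¹ * (Real.Gamma (c + M + α / 2) / Real.Gamma (c + M))) :=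
    le_trans (by gcongr; exact h2) h3
  have h5 : (Real.pi * lam) ^ (α / 2) ≤
      D / ((((M * k : ℕ) : ℝ) - 1) * ((1 - ε) * (d ^ α * β))) *
        (Real.Gamma (c + M + α / 2) / Real.Gamma (c + M)) := by
    have h6 := mul_le_mul_of_nonneg_right h4
      (show 0 ≤ (Real.pi * lam) ^ (α / 2) * ((1 - ε) * β)⁻¹ by positivity)
    refine (le_of_eq ?_).trans (h6.trans_eq ?_)
    · field_simp
    · field_simp
  have h7 : (1 : ℝ) / (α / 2) = 2 / α := one_div_div _ _
  have h8 := Gamma_ratio_rpow_le (x := c + M) (a := α / 2) (by linarith) (by linarith)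
  rw [h7] at h8
  have h9 := Real.rpow_le_rpow hpa.le h5 (show 0 ≤ 2 / α by positivity)
  rw [← Real.rpow_mul hpl.le, show α / 2 * (2 / α) = 1 by field_simp, Real.rpow_one,
    Real.mul_rpow (by positivity) (by positivity)] at h9
  refine h9.trans ?_
  gcongr
  linarith

theorem le_mul_of_mem_intensities (hnet : IsNetwork μ T h) (hα : 2 < α) (hβ : 0 < β) (hd : 0 < d)
    (hε1 : ε < 1) (hR : 0 < R) (hadm : Admissible α N k m) {lam : ℝ} (hlam : 0 < lam)
    (ho : outageProb μ α β d (T lam) h N k m 0 ≤ ε) {M : ℕ} (hM : 2 ≤ M * k) :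
    k * lam * (1 - ε) * R ≤ upperFactor α β d ε R * ((N - (k - 1 + k * (m / k)) : ℕ) : ℝ) ^ (2 / α)
        * (k * ((m / k : ℕ) + M + α / 4 - 3 / 8) / (((M * k : ℕ) : ℝ) - 1) ^ (2 / α)) := by
  have h1 := intensity_le hnet hα hβ hd hε1 hadm hlam ho hM
  have hM1 : (0 : ℝ) < (M * k : ℕ) - 1 := by
    have : ((2 : ℕ) : ℝ) ≤ (M * k : ℕ) := by exact_mod_cast hM
    push_cast at this ⊢
    linarith
  have hdα : 0 < d ^ α := Real.rpow_pos_of_pos hd _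
  have hε' : 0 < 1 - ε := by linarith
  rw [Real.div_rpow (Nat.cast_nonneg _) (by positivity), Real.mul_rpow hM1.le (by positivity),
    Real.mul_rpow hε'.le (by positivity)] at h1
  rw [upperFactor, Real.div_rpow zero_le_one (by positivity), Real.one_rpow,
    Real.rpow_sub hε', Real.rpow_one]
  have := Real.rpow_pos_of_pos hM1 (2 / α)
  have := Real.rpow_pos_of_pos hε' (2 / α)
  have := Real.rpow_pos_of_pos (mul_pos hdα hβ) (2 / α)
  have h2 := mul_le_mul_of_nonneg_left h1 (show 0 ≤ k * (1 - ε) * R / Real.pi by positivity)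
  refine (le_of_eq ?_).trans (h2.trans_eq ?_)
  · field_simp
  · field_simp

theorem capacity_le (hnet : IsNetwork μ T h) (hα : 2 < α) (hβ : 0 < β) (hd : 0 < d)
    (hε1 : ε < 1) (hR : 0 < R) (hadm : Admissible α N k m) {M : ℕ} (hM : 2 ≤ M * k) :
    capacity μ α β d ε R T h N k m ≤
      upperFactor α β d ε R * ((N - (k - 1 + k * (m / k)) : ℕ) : ℝ) ^ (2 / α)
        * (k * ((m / k : ℕ) + M + α / 4 - 3 / 8) / (((M * k : ℕ) : ℝ) - 1) ^ (2 / α)) := by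
  refine capacity_le_of_forall hε1 hR hadm.1 ?_ fun lam hlam ho =>
    le_mul_of_mem_intensities hnet hα hβ hd hε1 hR hadm hlam ho hM
  have hQ := upperFactor_pos (α := α) hβ hd hε1 hR
  have hM1 : (0 : ℝ) < (M * k : ℕ) - 1 := by
    have : ((2 : ℕ) : ℝ) ≤ (M * k : ℕ) := by exact_mod_cast hM
    push_cast at this ⊢
    linarith
  have hM0 : (0 : ℝ) ≤ M := Nat.cast_nonneg _
  have hc0 : (0 : ℝ) ≤ (m / k : ℕ) := Nat.cast_nonneg _
  have : (0 : ℝ) ≤ (m / k : ℕ) + M + α / 4 - 3 / 8 := by linarith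
  positivity

theorem capacity_le_upperBound (hnet : IsNetwork μ T h) (hα : 2 < α) (hβ : 0 < β) (hd : 0 < d)
    (hε1 : ε < 1) (hR : 0 < R) (hadm : Admissible α N k m) :
    capacity μ α β d ε R T h N k m ≤ upperBound α β d ε R N k (k * (m / k)) := by
  have hlt := hadm.nulled_lt
  have hQ := upperFactor_pos (α := α) hβ hd hε1 hR
  rcases (show 1 ≤ k from hadm.1).eq_or_lt with rfl | hk
  -- A single interfering stream has infinite mean inverse power, so `k = 1` needs `M = 2`. This
  -- gives `m + 13/8 + α/4`, and the further `1` in `U` is slack. For `k > 1`, `M = 1` gives `U`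
  -- exactly.
  · refine (capacity_le hnet hα hβ hd hε1 hR hadm (M := 2) (by norm_num)).trans ?_
    have hmN : m ≤ N := by have := hadm.2.1; omega
    simp only [Nat.div_one, one_mul]
    have h0 : (0 : ℝ) ≤ N - m := sub_nonneg.2 (by exact_mod_cast hmN)
    rw [upperBound_one hβ hd hmN, Nat.sub_self, zero_add, Nat.cast_sub hmN]
    norm_num
    gcongr
    linarith
  · refine (capacity_le hnet hα hβ hd hε1 hR hadm (M := 1) (by omega)).trans_eq ?_
    have hm := Nat.mul_div_le m k
    have hN := hadm.2.1
    rw [upperBound_of_one_lt hβ hd hk (by omega), Nat.mul_div_cancel_left _ hadm.1,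
      Nat.cast_sub hlt.le, one_mul, Nat.cast_add, Nat.cast_sub hadm.1, Nat.cast_one]
    congr 3
    · ring
    · ring

/-- Counting as many remaining interferers as were canceled, plus one, balances the estimate. The
factor becomes of order `x/x^(2/α)` with `x = k(c + 1) ≤ N`, and multiplied by `N^(2/α)` it is at
most linear in `N`. -/
theorem capacity_le_linear (hnet : IsNetwork μ T h) (hα : 2 < α) (hβ : 0 < β) (hd : 0 < d)
    (hε1 : ε < 1) (hR : 0 < R) :
    ∃ K : ℝ, 0 ≤ K ∧ ∀ N k m : ℕ, Admissible α N k m →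
      capacity μ α β d ε R T h N k m ≤ K * N := by
  have hQ := upperFactor_pos (α := α) hβ hd hε1 hR
  have hp0 : 0 < 2 / α := by positivity
  have hp1 : 0 ≤ 1 - 2 / α := sub_nonneg.2 ((div_le_one (by linarith)).2 hα.le)
  refine ⟨upperFactor α β d ε R * ((2 + α / 4) * 2 ^ (2 / α)), by positivity,
    fun N k m hadm => ?_⟩
  have hc := hadm.one_le_div hα
  have hM : 2 ≤ (m / k + 1) * k := by
    have := hadm.1
    nlinarith
  refine (capacity_le hnet hα hβ hd hε1 hR hadm hM).trans ?_
  have hle : (m / k + 1) * k ≤ N := by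
    have h1 := hadm.mul_div_add_one_le
    have h2 := hadm.2.1
    rw [mul_comm]
    omega
  have hN : (0 : ℝ) < N := by exact_mod_cast (by omega : 0 < N)
  have hx2 : ((2 : ℕ) : ℝ) ≤ ((m / k + 1) * k : ℕ) := Nat.cast_le.2 hM
  have hxN : (((m / k + 1) * k : ℕ) : ℝ) ≤ N := Nat.cast_le.2 hle
  rw [Nat.cast_ofNat] at hx2
  set x : ℝ := (((m / k + 1) * k : ℕ) : ℝ) with hx
  have hx' : x = ((m / k : ℕ) + 1) * k := by rw [hx]; push_cast; ring
  have hk0 : (0 : ℝ) ≤ k := Nat.cast_nonneg k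
  have hc0 : (0 : ℝ) ≤ (m / k : ℕ) := Nat.cast_nonneg _
  have hnum : (k : ℝ) * ((m / k : ℕ) + (m / k + 1 : ℕ) + α / 4 - 3 / 8) ≤ (2 + α / 4) * x := by
    rw [hx']
    push_cast
    calc _ ≤ (k : ℝ) * ((2 + α / 4) * ((m / k : ℕ) + 1)) := by
          gcongr
          nlinarith
      _ = _ := by ring
  have hsum : (0 : ℝ) ≤ (m / k : ℕ) + (m / k + 1 : ℕ) + α / 4 - 3 / 8 := by
    push_cast
    linarith
  have hx1 : 0 ≤ x - 1 := by linarith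
  have hxp : 0 < x ^ (2 / α) := Real.rpow_pos_of_pos (by linarith) _
  -- Since `x ≥ 2`, one has `x - 1 ≥ x/2`.
  have hden : x ^ (2 / α) / 2 ^ (2 / α) ≤ (x - 1) ^ (2 / α) := by
    rw [← Real.div_rpow (by linarith) (by norm_num)]
    exact Real.rpow_le_rpow (by linarith) (by linarith) hp0.le
  calc _ ≤ upperFactor α β d ε R * (N : ℝ) ^ (2 / α) *
        ((2 + α / 4) * x / (x ^ (2 / α) / 2 ^ (2 / α))) := by
        gcongr
        exact Nat.sub_le _ _
    _ = upperFactor α β d ε R * ((2 + α / 4) * 2 ^ (2 / α)) *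
        ((N : ℝ) ^ (2 / α) * x ^ (1 - 2 / α)) := by
        rw [Real.rpow_sub (by linarith), Real.rpow_one]
        field_simp
    _ ≤ upperFactor α β d ε R * ((2 + α / 4) * 2 ^ (2 / α)) *
        ((N : ℝ) ^ (2 / α) * (N : ℝ) ^ (1 - 2 / α)) := by gcongr
    _ = _ := by rw [← Real.rpow_add hN, add_sub_cancel, Real.rpow_one]

/-! ### The lower bound on the capacity and its attained scaling -/

/-- The constant in the mean interference that is left after the `c` nearest interferers are
canceled. -/
def meanInterference (α : ℝ) (c : ℕ) : ℝ :=
  (α / 2 - 1)⁻¹ * (Real.Gamma (c + 1 - α / 2) / Real.Gamma c)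

theorem meanInterference_pos (hα : 2 < α) {c : ℕ} (hc : α / 2 - 1 < c) :
    0 < meanInterference α c := by
  have h1 := Real.Gamma_pos_of_pos (show (0 : ℝ) < c by linarith)
  have h2 := Real.Gamma_pos_of_pos (show (0 : ℝ) < c + 1 - α / 2 by linarith)
  have h3 : 0 < (α / 2 - 1)⁻¹ := inv_pos.2 (by linarith)
  unfold meanInterference
  positivity

/-- The intensity at which the bounds on the outage probability equal `ε`. -/
def attainedIntensity (α β d ε : ℝ) (N k m : ℕ) : ℝ :=
  1 / Real.pi * (energy ε N (k + m) / (k * β * d ^ α) * (1 / meanInterference α (m / k))) ^ (2 / α)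

theorem attainedIntensity_pos (hα : 2 < α) (hβ : 0 < β) (hd : 0 < d) (hε0 : 0 < ε)
    (hε1 : ε < 1) (hadm : Admissible α N k m) : 0 < attainedIntensity α β d ε N k m := by
  have h1 := energy_pos hε0 hε1 hadm.2.1
  have h2 := meanInterference_pos hα hadm.2.2
  have hk : (0 : ℝ) < k := by exact_mod_cast hadm.1
  unfold attainedIntensity
  positivity

theorem interference_attainedIntensity (hα : 2 < α) (hβ : 0 < β) (hd : 0 < d) (hε0 : 0 < ε)
    (hε1 : ε < 1) (hadm : Admissible α N k m) :
    β * d ^ α * (k * ((Real.pi * attainedIntensity α β d ε N k m) ^ (α / 2) *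
      meanInterference α (m / k))) = energy ε N (k + m) := by
  have h1 := energy_pos hε0 hε1 hadm.2.1
  have h2 := meanInterference_pos hα hadm.2.2
  have hk : (0 : ℝ) < k := by exact_mod_cast hadm.1
  have hdα : 0 < d ^ α := Real.rpow_pos_of_pos hd _
  rw [attainedIntensity, ← mul_assoc Real.pi, mul_one_div_cancel Real.pi_ne_zero, one_mul,
    ← Real.rpow_mul (by positivity), show 2 / α * (α / 2) = 1 by field_simp, Real.rpow_one]
  field_simp

theorem outageProb_attainedIntensity_le (hnet : IsNetwork μ T h) (hα : 2 < α) (hβ : 0 < β)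
    (hd : 0 < d) (hε0 : 0 < ε) (hε1 : ε < 1) (hadm : Admissible α N k m) :
    outageProb μ α β d (T (attainedIntensity α β d ε N k m)) h N k m 0 ≤ ε := by
  have hlam := attainedIntensity_pos hα hβ hd hε0 hε1 hadm
  have hint := interference_attainedIntensity hα hβ hd hε0 hε1 hadm
  have hm := Nat.mul_div_le m k
  have hk := hadm.1
  have hN := hadm.2.1
  rw [meanInterference] at hint
  refine ENNReal.toReal_le_of_le_ofReal hε0.le ?_
  -- The energy is the value of `β d^α` times the bound on the mean interference. If `k + m = N`,
  -- then `1 - exp(-η) = ε`. Otherwise the Markov bound is `η/(D - 1)` with `η = (N - k - m)ε`, and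
  -- `D - 1 ≥ N - k - m` because `kc ≤ m`.
  rcases eq_or_ne (k + m) N with h1 | h1
  · refine (measure_sir_le_le_one_sub_exp hnet hlam hα hβ hd hadm.1 hadm.nulled_lt
      hadm.2.2).trans (ENNReal.ofReal_le_ofReal ?_)
    rw [hint, energy, if_pos h1, neg_neg, Real.exp_log (by linarith)]
    linarith
  · have hsum : k - 1 + k * (m / k) + 2 ≤ N := by omega
    refine (measure_sir_le_le hnet hlam hα hβ hd hadm.1 hsum hadm.2.2).trans
      (ENNReal.ofReal_le_ofReal ?_)
    rw [mul_right_comm (β * d ^ α), hint, energy, if_neg h1]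
    have hlt : ((k + m : ℕ) : ℝ) < N := by exact_mod_cast lt_of_le_of_ne hN h1
    have hle : ((k - 1 + k * (m / k) : ℕ) : ℝ) + 1 ≤ (k + m : ℕ) := by
      exact_mod_cast (by omega : k - 1 + k * (m / k) + 1 ≤ k + m)
    rw [← div_eq_mul_inv, div_le_iff₀ (by linarith)]
    nlinarith

/-- The correction replaces `(c+1)^(1-α/2)` in `L` by the Gamma ratio of the interference estimate,
after which `L` is the rate at the attained intensity. -/
theorem meanCorrection_mul_lowerBound (hα : 2 < α) (hβ : 0 < β) (hd : 0 < d) (hε0 : 0 < ε)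
    (hε1 : ε < 1) (hadm : Admissible α N k m) :
    meanCorrection α (m / k) * lowerBound α β d ε R N k m
      = k * attainedIntensity α β d ε N k m * (1 - ε) * R := by
  have hη := energy_pos hε0 hε1 hadm.2.1
  have hI := meanInterference_pos hα hadm.2.2
  have hk : (0 : ℝ) < k := by exact_mod_cast hadm.1
  have hdα : 0 < d ^ α := Real.rpow_pos_of_pos hd _
  have hc := hadm.2.2
  rw [lowerBound_eq_energy, attainedIntensity,
    Real.mul_rpow (x := energy ε N (k + m) / (k * β * d ^ α)) (by positivity) (by positivity)]
  have key : meanCorrection α (m / k) *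
      ((α / 2 - 1)⁻¹ * (((m / k : ℕ) : ℝ) + 1) ^ (1 - α / 2)) ^ (-(2 / α))
      = (1 / meanInterference α (m / k)) ^ (2 / α) := by
    have ha : 0 < α / 2 - 1 := by linarith
    have hG1 := Real.Gamma_pos_of_pos (show (0 : ℝ) < (m / k : ℕ) by linarith)
    have hG2 := Real.Gamma_pos_of_pos (show (0 : ℝ) < (m / k : ℕ) + 1 - α / 2 by linarith)
    have hx : 0 < (((m / k : ℕ) : ℝ) + 1) ^ (1 - α / 2) := Real.rpow_pos_of_pos (by linarith) _
    rw [meanCorrection, Real.rpow_neg (by positivity), ← Real.inv_rpow (by positivity),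
      ← Real.mul_rpow (by positivity) (by positivity), meanInterference]
    congr 1
    field_simp
  rw [← key]
  ring

theorem mul_lowerBound_le_capacity (hnet : IsNetwork μ T h) (hα : 2 < α) (hβ : 0 < β)
    (hd : 0 < d) (hε0 : 0 < ε) (hε1 : ε < 1) (hR : 0 < R) (hadm : Admissible α N k m) :
    meanCorrection α (m / k) * lowerBound α β d ε R N k m
      ≤ capacity μ α β d ε R T h N k m := by
  rw [meanCorrection_mul_lowerBound hα hβ hd hε0 hε1 hadm, capacity]
  -- The real supremum of an unbounded set would be `0`, so boundedness must come from the upper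
  -- estimate. Two interferers suffice for every `k ≥ 1`.
  have hbdd : BddAbove {lam : ℝ | 0 < lam ∧ outageProb μ α β d (T lam) h N k m 0 ≤ ε} := by
    have hM : 2 ≤ 2 * k := by have := hadm.1; omega
    exact ⟨_, fun lam hl => (le_div_iff₀' Real.pi_pos).2
      (intensity_le hnet hα hβ hd hε1 hadm hl.1 hl.2 hM)⟩
  have hle := le_csSup hbdd ⟨attainedIntensity_pos hα hβ hd hε0 hε1 hadm,
    outageProb_attainedIntensity_le hnet hα hβ hd hε0 hε1 hadm⟩
  have hε' : 0 ≤ 1 - ε := by linarith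
  gcongr

theorem isTheta_capacity (hnet : IsNetwork μ T h) (hα : 2 < α) (hβ : 0 < β) (hd : 0 < d)
    (hε0 : 0 < ε) (hε1 : ε < 1) (hR : 0 < R) {θ : ℝ} (hθ0 : 0 < θ) (hθ1 : θ < 1) {m : ℕ → ℕ}
    (hm : Tendsto (fun N : ℕ => (m N : ℝ) / N) atTop (𝓝 θ)) :
    (fun N : ℕ => capacity μ α β d ε R T h N 1 (m N)) =Θ[atTop] (fun N : ℕ => (N : ℝ)) := by
  obtain ⟨K, -, hK⟩ := capacity_le_linear (T := T) (h := h) hnet hα hβ hd hε1 hR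
  have hadm := eventually_admissible (α := α) hθ0 hθ1 hm
  have hL := tendsto_lowerBound_div (R := R) hα hβ hd hε0 hε1 hθ0 hθ1 hm
  have hκ : Tendsto (fun N => meanCorrection α (m N)) atTop (𝓝 1) :=
    (tendsto_meanCorrection hα).comp
      (tendsto_natCast_atTop_iff.1 (tendsto_cast_of_tendsto_div hθ0 hm))
  have hlim := hκ.mul hL
  rw [one_mul] at hlim
  have ha : 0 < α / 2 - 1 := by linarith
  have hε' : 0 < 1 - ε := by linarith
  have hpos : 0 < R * (1 - ε) / Real.pi * (ε * (α / 2 - 1) / (β * d ^ α)) ^ (2 / α)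
      * profile (2 / α) θ := mul_pos (by positivity) (profile_pos hθ0 hθ1)
  set B := R * (1 - ε) / Real.pi * (ε * (α / 2 - 1) / (β * d ^ α)) ^ (2 / α)
    * profile (2 / α) θ
  have hlow : ∀ᶠ N : ℕ in atTop,
      B / 2 * (N : ℝ) ≤ capacity μ α β d ε R T h N 1 (m N) := by
    filter_upwards [hadm, hlim.eventually_const_lt (half_lt_self hpos)] with N h1 h2
    have hN : (0 : ℝ) < N := by
      have := h1.2.1
      exact_mod_cast (by omega : 0 < N)
    have h3 := mul_lowerBound_le_capacity hnet hα hβ hd hε0 hε1 hR h1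
    rw [Nat.div_one] at h3
    rw [← mul_div_assoc, lt_div_iff₀ hN] at h2
    exact h2.le.trans h3
  constructor
  · refine IsBigO.of_bound K ?_
    filter_upwards [hadm, hlow] with N h1 h2
    have h3 : 0 ≤ B / 2 * (N : ℝ) := by positivity
    rw [Real.norm_of_nonneg (h3.trans h2), Real.norm_natCast]
    exact hK N 1 (m N) h1
  · refine IsBigO.of_bound (2 / B) ?_
    filter_upwards [hlow] with N h2
    have h3 : 0 ≤ B / 2 * (N : ℝ) := by positivity
    rw [Real.norm_of_nonneg (h3.trans h2), Real.norm_natCast]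
    calc (N : ℝ) = 2 / B * (B / 2 * N) := by field_simp
      _ ≤ _ := by gcongr

end Capacity

end AdHoc
end

/-! ### Assembly of the results -/

theorem corollary1 {Ω : Type*} [MeasurableSpace Ω] (μ : Measure Ω) [IsProbabilityMeasure μ]
    (T : ℝ → ℕ → Ω → AdHoc.Plane) (h : ℕ → ℕ → ℕ → Ω → ℂ) (hnet : AdHoc.IsNetwork μ T h)
    (α β d ε R : ℝ) (hα : 2 < α) (hβ : 0 < β) (hd : 0 < d) (hε0 : 0 < ε) (hε1 : ε < 1)
    (hR : 0 < R) :
    -- the two expressions are bounds on the transmission capacity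
    ((∀ N k m : ℕ, AdHoc.Admissible α N k m →
        AdHoc.meanCorrection α (m / k) * AdHoc.lowerBound α β d ε R N k m
            ≤ AdHoc.capacity μ α β d ε R T h N k m ∧
          AdHoc.capacity μ α β d ε R T h N k m
            ≤ AdHoc.upperBound α β d ε R N k (k * (m / k))) ∧
      (∀ c : ℕ, α / 2 - 1 < c → 0 < AdHoc.meanCorrection α c) ∧
      Tendsto (AdHoc.meanCorrection α) atTop (𝓝 1)) ∧
    -- a single stream maximizes the lower bound
    (∀ N k m : ℕ, AdHoc.Admissible α N k m →
      AdHoc.Admissible α N 1 (m + k - 1) ∧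
        AdHoc.lowerBound α β d ε R N k m ≤ AdHoc.lowerBound α β d ε R N 1 (m + k - 1)) ∧
    -- a single stream maximizes the upper bound: exactly for moderate path loss exponents, and
    -- asymptotically for all of them
    (α ≤ 11 / 2 → ∀ N k m : ℕ, AdHoc.Admissible α N k m → 1 < k →
      AdHoc.Admissible α N 1 m ∧
        AdHoc.upperBound α β d ε R N k m < AdHoc.upperBound α β d ε R N 1 m) ∧
    (∀ δ : ℝ, 0 < δ → ∀ᶠ N : ℕ in atTop, ∀ k m : ℕ, AdHoc.Admissible α N k m →
      ∃ m' : ℕ, AdHoc.Admissible α N 1 m' ∧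
        AdHoc.upperBound α β d ε R N k m ≤ (1 + δ) * AdHoc.upperBound α β d ε R N 1 m') ∧
    -- no choice of `k` and `m` gives a better scaling than `N` for the lower bound and for the
    -- transmission capacity, and than `N ^ (1 + 2 / α)` for the upper bound
    (∃ K : ℝ, ∀ N k m : ℕ, AdHoc.Admissible α N k m →
      AdHoc.lowerBound α β d ε R N k m ≤ K * N ∧
      AdHoc.capacity μ α β d ε R T h N k m ≤ K * N ∧
      AdHoc.upperBound α β d ε R N k m ≤ K * (N : ℝ) ^ (1 + 2 / α)) ∧
    -- these scalings are attained with `k = 1` and `m = θ N`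
    (∀ θ : ℝ, 0 < θ → θ < 1 → ∀ m : ℕ → ℕ,
      Tendsto (fun N : ℕ => (m N : ℝ) / N) atTop (𝓝 θ) →
        (∀ᶠ N : ℕ in atTop, AdHoc.Admissible α N 1 (m N)) ∧
        (fun N : ℕ => AdHoc.capacity μ α β d ε R T h N 1 (m N)) =Θ[atTop] (fun N : ℕ => (N : ℝ)) ∧
        (fun N : ℕ => AdHoc.upperBound α β d ε R N 1 (m N)) =Θ[atTop]
          (fun N : ℕ => (N : ℝ) ^ (1 + 2 / α)) ∧
        Tendsto (fun N : ℕ => AdHoc.lowerBound α β d ε R N 1 (m N) / N) atTop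
          (𝓝 (R * (1 - ε) / Real.pi * (ε * (α / 2 - 1) / (β * d ^ α)) ^ (2 / α)
            * ((1 - θ) ^ (2 / α) * θ ^ (1 - 2 / α))))) ∧
    -- the fraction that is optimal for the lower bound is `1 - 2 / α`
    (0 < 1 - 2 / α ∧ 1 - 2 / α < 1 ∧
      (∀ θ : ℝ, 0 < θ → θ < 1 → θ ≠ 1 - 2 / α →
        (1 - θ) ^ (2 / α) * θ ^ (1 - 2 / α)
          < (1 - (1 - 2 / α)) ^ (2 / α) * (1 - 2 / α) ^ (1 - 2 / α)) ∧
      (∀ᶠ N : ℕ in atTop, ∀ m : ℕ, AdHoc.Admissible α N 1 m →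
        (∀ k' m' : ℕ, AdHoc.Admissible α N k' m' →
          AdHoc.lowerBound α β d ε R N k' m' ≤ AdHoc.lowerBound α β d ε R N 1 m) →
        m + 1 = ⌊(1 - 2 / α) * N⌋₊ ∨ m + 1 = ⌈(1 - 2 / α) * N⌉₊)) := by
  have hp0 : 0 < 2 / α := by positivity
  have hp1 : 2 / α < 1 := (div_lt_one (by linarith)).2 hα
  obtain ⟨K₁, hK₁, hL⟩ := AdHoc.lowerBound_le_linear hα hβ hd hε0 hε1 hR
  obtain ⟨K₂, hK₂, hC⟩ := AdHoc.capacity_le_linear (h := h) hnet hα hβ hd hε1 hR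
  obtain ⟨K₃, hK₃, hU⟩ := AdHoc.upperBound_le_rpow hα hβ hd hε1 hR
  refine ⟨⟨fun N k m hadm => ⟨AdHoc.mul_lowerBound_le_capacity hnet hα hβ hd hε0 hε1 hR hadm,
      AdHoc.capacity_le_upperBound hnet hα hβ hd hε1 hR hadm⟩,
      fun c hc => AdHoc.meanCorrection_pos hα hc, AdHoc.tendsto_meanCorrection hα⟩,
    fun N k m hadm => AdHoc.lowerBound_le_single hα hβ hd hε0 hε1 hR hadm,
    fun hα' N k m hadm hk => AdHoc.upperBound_lt_single hα hα' hβ hd hε1 hR hadm hk,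
    fun δ hδ => AdHoc.upperBound_le_single_asymptotically hα hβ hd hε1 hR hδ,
    ⟨K₁ + K₂ + K₃, fun N k m hadm => ⟨?_, ?_, ?_⟩⟩,
    fun θ hθ0 hθ1 m hm => ⟨AdHoc.eventually_admissible hθ0 hθ1 hm,
      AdHoc.isTheta_capacity hnet hα hβ hd hε0 hε1 hR hθ0 hθ1 hm,
      AdHoc.isTheta_upperBound hβ hd hε1 hR hθ0 hθ1 hm,
      AdHoc.tendsto_lowerBound_div hα hβ hd hε0 hε1 hθ0 hθ1 hm⟩,
    by linarith, by linarith, fun θ hθ0 hθ1 hne => ?_,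
    AdHoc.eventually_eq_floor_or_eq_ceil hα hβ hd hε0 hε1 hR⟩
  · exact (hL N k m hadm).trans (by gcongr; linarith)
  · exact (hC N k m hadm).trans (by gcongr; linarith)
  · exact (hU N k m hadm).trans (by gcongr; linarith)
  -- At the peak itself the second factor of the sign condition vanishes.
  · exact AdHoc.profile_lt_profile hp0 hp1 hθ0 hθ1 (by linarith) (by linarith) hne (by simp)
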